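/- Conventions. An operator system is a complex $*$-vector space $\mathcal S$ with a matrix ordering $\{M_p(\mathcal S)_+\}_{p\ge1}$ and an Archimedean matrix order unit $1_{\mathcal S}$. A linear map of operator systems is ucp if it is unital and completely positive; a complete order embedding is an injective unital $*$-linear map $\varphi:\mathcal S\to\mathcal T$ such that, for every $p$ and $X\in M_p(\mathcal S)$, $X\in M_p(\mathcal S)_+$ if and only if $\varphi^{(p)}(X)\in M_p(\mathcal T)_+$. For operator systems $\mathcal S,\mathcal T$ the following cones of self-adjoint matrices over the algebraic tensor product $\mathcal S\otimes\mathcal T$, with unit $1\otimes1$, define three operator systems: - $\mathcal S\otimes_{\min}\mathcal T$: all $X=X^*\in M_p(\mathcal S\otimes\mathcal T)$ with $(\varphi\otimes\psi)^{(p)}(X)\ge0$ for all $k,m$ and all ucp maps $\varphi:\mathcal S\to M_k$, $\psi:\mathcal T\to M_m$; - $\mathcal S\otimes_{c}\mathcal T$: all $X=X^*\in M_p(\mathcal S\otimes\mathcal T)$ with $(\varphi\cdot\psi)^{(p)}(X)\ge0$ for every Hilbert space $\mathcal H$ and all ucp maps $\varphi:\mathcal S\to\mathcal B(\mathcal H)$,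 $\psi:\mathcal T\to\mathcal B(\mathcal H)$ with commuting ranges, where $(\varphi\cdot\psi)(s\otimes t)=\varphi(s)\psi(t)$; - $\mathcal S\otimes_{\max}\mathcal T$: all $X=X^*\in M_p(\mathcal S\otimes\mathcal T)$ such that for every $\varepsilon>0$ there are $k,m$, $P\in M_k(\mathcal S)_+$, $Q\in M_m(\mathcal T)_+$ and a linear map $A:\mathbb C^k\otimes\mathbb C^m\to\mathbb C^p$ with $X+\varepsilon(1\otimes1)I_p=A(P\otimes Q)A^*$. Let $\mathcal U_{nc}(n)$ be the universal unital $C^*$-algebra generated by elements $u_{ij}$, $1\le i,j\le n$, subject to the relation that the matrix $(u_{ij})$ is unitary, and let $\mathcal V_n\subseteq\mathcal U_{nc}(n)$ be the operator subsystem spanned by $1$, the $u_{ij}$ and the $u_{ij}^*$. Statement. Let $\mathcal S$ be any operator system and let $n\ge2$. Then 1. the inclusion $\mathcal V_n\otimes_c\mathcal S\subseteq\mathcal U_{nc}(n)\otimes_{\max}\mathcal S$ is a complete order embedding; 2. $\mathcal V_n\otimes_{\min}\mathcal S=\mathcal V_n\otimes_c\mathcal S$ if and only if $\mathcal U_{nc}(n)\otimes_{\min}\mathcal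 S=\mathcal U_{nc}(n)\otimes_{\max}\mathcal S$, where equality means that the positive cones coincide at every matrix level. -/

import Mathlib

open scoped TensorProduct ComplexConjugate

noncomputable section

/-- The free unital complex `*`-algebra on letters `x i j`, `1 ≤ i, j ≤ n`: the algebra of
noncommutative polynomials in the letters `((i, j), false)`, standing for `x i j`, and
`((i, j), true)`, standing for `(x i j)*`. -/
abbrev StarPoly (n : ℕ) : Type := MonoidAlgebra ℂ (FreeMonoid ((Fin n × Fin n) × Bool))

namespace StarPoly

variable {n : ℕ}

/-- A letter, as a polynomial. -/
def letter (x : (Fin n × Fin n) × Bool) : StarPoly n :=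
  MonoidAlgebra.of ℂ (FreeMonoid ((Fin n × Fin n) × Bool)) (FreeMonoid.of x)

/-- The letter `x i j`. -/
def gen (i j : Fin n) : StarPoly n := letter ((i, j), false)

/-- The conjugate-linear multiplication-reversing ring homomorphism exchanging `x i j` and
`(x i j)*`. -/
def starHom : StarPoly n →+* (StarPoly n)ᵐᵒᵖ :=
  MonoidAlgebra.liftNCRingHom
    ((algebraMap ℂ (StarPoly n)ᵐᵒᵖ).comp (starRingEnd ℂ))
    (FreeMonoid.lift fun x => MulOpposite.op (letter (x.1, !x.2)))
    (fun c _ => Algebra.commute_algebraMap_left (starRingEnd ℂ c) _)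

lemma starHom_letter (x : (Fin n × Fin n) × Bool) :
    starHom (letter x) = MulOpposite.op (letter (x.1, !x.2)) := by
  refine (MonoidAlgebra.liftNCRingHom_single _ _ _ _ _).trans ?_
  simp [← MonoidAlgebra.one_def]

lemma starHom_algebraMap (c : ℂ) :
    starHom (algebraMap ℂ (StarPoly n) c) = algebraMap ℂ (StarPoly n)ᵐᵒᵖ (conj c) := by
  refine (MonoidAlgebra.liftNCRingHom_single _ _ _ _ _).trans ?_
  simp

/-- Induction on noncommutative polynomials. -/
lemma induction {P : StarPoly n → Prop} (a : StarPoly n)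
    (hc : ∀ c : ℂ, P (algebraMap ℂ _ c)) (hl : ∀ x, P (letter x))
    (hm : ∀ a b, P a → P b → P (a * b)) (ha : ∀ a b, P a → P b → P (a + b)) : P a := by
  refine MonoidAlgebra.induction_on (motive := P) a (fun w => ?_) ha (fun c f hf => ?_)
  · induction w using FreeMonoid.inductionOn' with
    | one => simpa using! hc 1
    | of_mul x w ih =>
      rw [map_mul]
      exact hm _ _ (hl x) ih
  · rw [Algebra.smul_def]
    exact hm _ _ (hc c) hf

instance : StarRing (StarPoly n) where
  star a := (starHom a).unop
  star_involutive a := by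
    induction a using induction with
    | hc c => simp [starHom_algebraMap, MulOpposite.algebraMap_apply, -MonoidAlgebra.coe_algebraMap]
    | hl x => simp [starHom_letter]
    | hm a b ha hb => simp [ha, hb]
    | ha a b ha hb => simp [ha, hb]
  star_mul a b := by simp
  star_add a b := by simp

lemma star_letter (x : (Fin n × Fin n) × Bool) : star (letter x) = letter (x.1, !x.2) := by
  change (starHom (letter x)).unop = _
  rw [starHom_letter]; rfl

lemma star_algebraMap (c : ℂ) :
    star (algebraMap ℂ (StarPoly n) c) = algebraMap ℂ (StarPoly n) (conj c) := by
  change (starHom _).unop = _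
  rw [starHom_algebraMap]; rfl

instance : StarModule ℂ (StarPoly n) where
  star_smul c a := by
    rw [Algebra.smul_def, star_mul, star_algebraMap, Algebra.smul_def, ← Algebra.commutes]
    rfl

/-- A `C*`-seminorm on the free `*`-algebra for which the matrix `(x i j)` is unitary. Such a
seminorm satisfies `p (x i j) ≤ 1`; the last field records this and excludes nothing. -/
structure IsUnitarySeminorm (p : Seminorm ℂ (StarPoly n)) : Prop where
  mul_le : ∀ a b, p (a * b) ≤ p a * p b
  cstar : ∀ a, p (star a * a) = p a * p a
  star_mul_gen : ∀ i j, p ((∑ k, star (gen k i) * gen k j) - if i = j then 1 else 0) = 0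
  gen_mul_star : ∀ i j, p ((∑ k, gen i k * star (gen j k)) - if i = j then 1 else 0) = 0
  gen_le : ∀ i j, p (gen i j) ≤ 1

namespace IsUnitarySeminorm

variable {p : Seminorm ℂ (StarPoly n)}

lemma zero : IsUnitarySeminorm (0 : Seminorm ℂ (StarPoly n)) where
  mul_le := by simp
  cstar := by simp
  star_mul_gen := by simp
  gen_mul_star := by simp
  gen_le := by simp

lemma map_star (hp : IsUnitarySeminorm p) (a : StarPoly n) : p (star a) = p a := by
  have key : ∀ b, p b ≤ p (star b) := fun b => by
    have h := hp.mul_le (star b) b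
    rw [hp.cstar] at h
    rcases (apply_nonneg p b).eq_or_lt with h0 | h0
    · rw [← h0]; exact apply_nonneg p _
    · exact le_of_mul_le_mul_right h h0
  exact le_antisymm (by simpa using key (star a)) (key a)

lemma map_one_le (hp : IsUnitarySeminorm p) : p 1 ≤ 1 := by
  have h := hp.cstar 1
  simp only [star_one, mul_one] at h
  nlinarith [sq_nonneg (p 1 - 1)]

lemma map_letter_le (hp : IsUnitarySeminorm p) (x : (Fin n × Fin n) × Bool) :
    p (letter x) ≤ 1 := by
  obtain ⟨⟨i, j⟩, b⟩ := x
  cases b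
  · exact hp.gen_le i j
  · have h := hp.map_star (gen i j)
    rw [gen, star_letter] at h
    exact h.le.trans (hp.gen_le i j)

end IsUnitarySeminorm

/-- All admissible seminorms are uniformly bounded at each polynomial. -/
lemma exists_bound (a : StarPoly n) :
    ∃ C : ℝ, 0 ≤ C ∧ ∀ p : Seminorm ℂ (StarPoly n), IsUnitarySeminorm p → p a ≤ C := by
  induction a using induction with
  | hc c =>
    refine ⟨‖c‖, norm_nonneg c, fun p hp => ?_⟩
    rw [Algebra.algebraMap_eq_smul_one, map_smul_eq_mul]
    exact mul_le_of_le_one_right (norm_nonneg c) hp.map_one_le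
  | hl x => exact ⟨1, zero_le_one, fun p hp => hp.map_letter_le x⟩
  | hm a b ha hb =>
    obtain ⟨C, hC, h⟩ := ha
    obtain ⟨D, hD, h'⟩ := hb
    exact ⟨C * D, mul_nonneg hC hD, fun p hp => (hp.mul_le a b).trans
      (mul_le_mul (h p hp) (h' p hp) (apply_nonneg p b) hC)⟩
  | ha a b ha hb =>
    obtain ⟨C, hC, h⟩ := ha
    obtain ⟨D, hD, h'⟩ := hb
    exact ⟨C + D, add_nonneg hC hD, fun p hp => (map_add_le_add p a b).trans
      (add_le_add (h p hp) (h' p hp))⟩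

/-- The universal `C*`-seminorm: the supremum of all `C*`-seminorms for which the matrix `(x i j)`
is unitary. -/
def univNorm (a : StarPoly n) : ℝ :=
  ⨆ p : {p : Seminorm ℂ (StarPoly n) // IsUnitarySeminorm p}, p.1 a

instance : Nonempty {p : Seminorm ℂ (StarPoly n) // IsUnitarySeminorm p} := ⟨⟨0, .zero⟩⟩

lemma le_univNorm {p : Seminorm ℂ (StarPoly n)} (hp : IsUnitarySeminorm p) (a : StarPoly n) :
    p a ≤ univNorm a := by
  obtain ⟨C, _, h⟩ := exists_bound a
  exact le_ciSup (f := fun p : {p : Seminorm ℂ (StarPoly n) // IsUnitarySeminorm p} => p.1 a)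
    ⟨C, by rintro _ ⟨q, rfl⟩; exact h q.1 q.2⟩ ⟨p, hp⟩

lemma univNorm_le {a : StarPoly n} {C : ℝ}
    (h : ∀ p : Seminorm ℂ (StarPoly n), IsUnitarySeminorm p → p a ≤ C) : univNorm a ≤ C :=
  ciSup_le fun p => h p.1 p.2

lemma univNorm_nonneg (a : StarPoly n) : 0 ≤ univNorm a :=
  (apply_nonneg (0 : Seminorm ℂ (StarPoly n)) a).trans (le_univNorm .zero a)

instance : SeminormedRing (StarPoly n) :=
  { (inferInstance : Ring (StarPoly n)),
    AddGroupSeminorm.toSeminormedAddCommGroup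
      { toFun := univNorm (n := n)
        map_zero' := le_antisymm (univNorm_le fun p _ => (map_zero p).le) (univNorm_nonneg 0)
        add_le' := fun a b => univNorm_le fun p hp => (map_add_le_add p a b).trans
          (add_le_add (le_univNorm hp a) (le_univNorm hp b))
        neg' := fun a => by simp [univNorm, map_neg_eq_map] } with
    norm_mul_le := fun a b => univNorm_le fun p hp => (hp.mul_le a b).trans
      (mul_le_mul (le_univNorm hp a) (le_univNorm hp b) (apply_nonneg p b) (univNorm_nonneg a)) }

lemma norm_def (a : StarPoly n) : ‖a‖ = univNorm a := rfl

instance : NormedAlgebra ℂ (StarPoly n) where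
  norm_smul_le c a := univNorm_le fun p hp => by
    rw [map_smul_eq_mul]
    exact mul_le_mul_of_nonneg_left (le_univNorm hp a) (norm_nonneg c)

lemma norm_star (a : StarPoly n) : ‖star a‖ = ‖a‖ := by
  have key : ∀ b : StarPoly n, ‖star b‖ ≤ ‖b‖ := fun b => univNorm_le fun p hp => by
    rw [hp.map_star]
    exact le_univNorm hp b
  exact le_antisymm (key a) (by simpa using key (star a))

lemma norm_mul_self_le (a : StarPoly n) : ‖a‖ * ‖a‖ ≤ ‖star a * a‖ := by
  have h : ‖a‖ ≤ √‖star a * a‖ := univNorm_le fun p hp => by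
    refine Real.le_sqrt_of_sq_le ?_
    rw [pow_two, ← hp.cstar]
    exact le_univNorm hp _
  calc ‖a‖ * ‖a‖ ≤ √‖star a * a‖ * √‖star a * a‖ :=
        mul_self_le_mul_self (norm_nonneg a) h
    _ = ‖star a * a‖ := Real.mul_self_sqrt (norm_nonneg _)

end StarPoly

/-- Brown's algebra `U_nc(n)`, the universal unital `C*`-algebra generated by the entries of a
unitary `n × n` matrix: the separated completion of the free `*`-algebra on `x i j` in the
universal `C*`-seminorm. -/
def Unc (n : ℕ) : Type := UniformSpace.Completion (StarPoly n)

namespace Unc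

open UniformSpace

variable {n : ℕ}

instance : NormedRing (Unc n) := inferInstanceAs (NormedRing (Completion (StarPoly n)))

instance : CompleteSpace (Unc n) := inferInstanceAs (CompleteSpace (Completion (StarPoly n)))

instance : Algebra ℂ (Unc n) := inferInstanceAs (Algebra ℂ (Completion (StarPoly n)))

instance : NormedAlgebra ℂ (Unc n) where
  norm_smul_le c x :=
    norm_smul_le (α := ℂ) (β := Completion (StarPoly n)) c x

/-- The canonical map from noncommutative polynomials to `U_nc(n)`. -/
def ofPoly : StarPoly n →ₐ[ℂ] Unc n where
  __ := (Completion.coeRingHom : StarPoly n →+* Completion (StarPoly n))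
  commutes' _ := rfl

lemma norm_ofPoly (a : StarPoly n) : ‖ofPoly a‖ = ‖a‖ := Completion.norm_coe a

lemma denseRange_ofPoly : DenseRange (ofPoly : StarPoly n → Unc n) := Completion.denseRange_coe

lemma continuous_ofPoly : Continuous (ofPoly : StarPoly n → Unc n) := Completion.continuous_coe _

lemma uniformContinuous_star : UniformContinuous (star : StarPoly n → StarPoly n) :=
  (AddMonoidHomClass.isometry_of_norm (starAddEquiv : StarPoly n ≃+ StarPoly n)
    StarPoly.norm_star).uniformContinuous

instance : Star (Unc n) where
  star := Completion.map (star : StarPoly n → StarPoly n)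

lemma star_ofPoly (a : StarPoly n) : star (ofPoly a) = ofPoly (star a) :=
  Completion.map_coe uniformContinuous_star a

instance : ContinuousStar (Unc n) where
  continuous_star := Completion.continuous_map

lemma induction {P : Unc n → Prop} (x : Unc n) (hP : IsClosed {x | P x})
    (h : ∀ a, P (ofPoly a)) : P x := Completion.induction_on x hP h

lemma induction₂ {P : Unc n → Unc n → Prop} (x y : Unc n)
    (hP : IsClosed {z : Unc n × Unc n | P z.1 z.2}) (h : ∀ a b, P (ofPoly a) (ofPoly b)) :
    P x y := Completion.induction_on₂ x y hP h

instance : StarRing (Unc n) where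
  star_involutive x := by
    refine induction (P := fun x => star (star x) = x) x (isClosed_eq (by fun_prop) (by fun_prop))
      fun a => ?_
    rw [star_ofPoly, star_ofPoly, star_star]
  star_mul x y := by
    refine induction₂ (P := fun x y => star (x * y) = star y * star x) x y
      (isClosed_eq (by fun_prop) (by fun_prop)) fun a b => ?_
    rw [← map_mul, star_ofPoly, star_ofPoly, star_ofPoly, star_mul, map_mul]
  star_add x y := by
    refine induction₂ (P := fun x y => star (x + y) = star x + star y) x y
      (isClosed_eq (by fun_prop) (by fun_prop)) fun a b => ?_
    rw [← map_add, star_ofPoly, star_ofPoly, star_ofPoly, star_add, map_add]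

instance : CStarRing (Unc n) where
  norm_mul_self_le x := by
    refine induction (P := fun x => ‖x‖ * ‖x‖ ≤ ‖star x * x‖) x
      (isClosed_le (by fun_prop) (by fun_prop)) fun a => ?_
    rw [star_ofPoly, ← map_mul, norm_ofPoly, norm_ofPoly]
    exact StarPoly.norm_mul_self_le a

instance : StarModule ℂ (Unc n) where
  star_smul c x := by
    have h : Continuous fun x : Unc n => c • x := continuous_const_smul c
    have h' : Continuous fun x : Unc n => star c • x := continuous_const_smul (star c)
    refine induction (P := fun x => star (c • x) = star c • star x) x
      (isClosed_eq (ContinuousStar.continuous_star.comp h)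
        (h'.comp ContinuousStar.continuous_star)) fun a => ?_
    rw [← map_smul, star_ofPoly, star_ofPoly, star_smul, map_smul]

instance : CStarAlgebra (Unc n) where

/-- The generators `u i j` of `U_nc(n)`, as a matrix. -/
def u : Matrix (Fin n) (Fin n) (Unc n) := .of fun i j => ofPoly (StarPoly.gen i j)

lemma ofPoly_eq_zero {a : StarPoly n}
    (h : ∀ p : Seminorm ℂ (StarPoly n), StarPoly.IsUnitarySeminorm p → p a = 0) : ofPoly a = 0 := by
  rw [← norm_eq_zero, norm_ofPoly]
  exact le_antisymm (StarPoly.univNorm_le fun p hp => (h p hp).le) (StarPoly.univNorm_nonneg a)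

open Matrix in
lemma star_u_mul_u : (u : Matrix (Fin n) (Fin n) (Unc n))ᴴ * u = 1 := by
  ext i j
  have := ofPoly_eq_zero fun p hp => StarPoly.IsUnitarySeminorm.star_mul_gen hp i j
  rw [map_sub, sub_eq_zero] at this
  simpa [Matrix.mul_apply, u, star_ofPoly, Matrix.one_apply, apply_ite] using this

open Matrix in
lemma u_mul_star_u : (u : Matrix (Fin n) (Fin n) (Unc n)) * uᴴ = 1 := by
  ext i j
  have := ofPoly_eq_zero fun p hp => StarPoly.IsUnitarySeminorm.gen_mul_star hp i j
  rw [map_sub, sub_eq_zero] at this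
  simpa [Matrix.mul_apply, u, star_ofPoly, Matrix.one_apply, apply_ite] using this

section Universal

variable {B : Type*} [CStarAlgebra B]

/-- Evaluation of noncommutative polynomials at a matrix of elements of a `C*`-algebra. -/
def evalPoly (W : Matrix (Fin n) (Fin n) B) : StarPoly n →ₐ[ℂ] B :=
  MonoidAlgebra.lift ℂ B _
    (FreeMonoid.lift fun x => if x.2 then star (W x.1.1 x.1.2) else W x.1.1 x.1.2)

lemma evalPoly_letter (W : Matrix (Fin n) (Fin n) B) (x : (Fin n × Fin n) × Bool) :
    evalPoly W (StarPoly.letter x) = if x.2 then star (W x.1.1 x.1.2) else W x.1.1 x.1.2 := by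
  refine (MonoidAlgebra.lift_of _ _).trans ?_
  simp

lemma evalPoly_gen (W : Matrix (Fin n) (Fin n) B) (i j : Fin n) :
    evalPoly W (StarPoly.gen i j) = W i j := by
  rw [StarPoly.gen, evalPoly_letter]; simp

lemma evalPoly_star (W : Matrix (Fin n) (Fin n) B) (a : StarPoly n) :
    evalPoly W (star a) = star (evalPoly W a) := by
  induction a using StarPoly.induction with
  | hc c =>
    rw [StarPoly.star_algebraMap, AlgHom.commutes, AlgHom.commutes, starRingEnd_apply, algebraMap_star_comm]
  | hl x =>
    rw [StarPoly.star_letter, evalPoly_letter, evalPoly_letter]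
    cases x.2 <;> simp
  | hm a b ha hb => rw [star_mul, map_mul, ha, hb, map_mul, star_mul]
  | ha a b ha hb => rw [star_add, map_add, ha, hb, map_add, star_add]

open Matrix in
lemma norm_entry_le_one {W : Matrix (Fin n) (Fin n) B} (h : Wᴴ * W = 1) (i j : Fin n) :
    ‖W i j‖ ≤ 1 := by
  let _ := CStarAlgebra.spectralOrder B
  let _ := CStarAlgebra.spectralOrderedRing B
  have h1 : ∑ k, star (W k j) * W k j = 1 := by
    simpa [Matrix.mul_apply] using congrFun (congrFun h j) j
  have h2 : star (W i j) * W i j ≤ 1 := by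
    rw [← h1]
    exact Finset.single_le_sum (f := fun k => star (W k j) * W k j)
      (fun k _ => star_mul_self_nonneg _) (Finset.mem_univ i)
  have h3 : ‖star (W i j) * W i j‖ ≤ 1 :=
    (CStarAlgebra.norm_le_one_iff_of_nonneg _ (star_mul_self_nonneg _)).2 h2
  rw [CStarRing.norm_star_mul_self] at h3
  nlinarith [norm_nonneg (W i j)]

open Matrix in
lemma isUnitarySeminorm {W : Matrix (Fin n) (Fin n) B} (h : Wᴴ * W = 1) (h' : W * Wᴴ = 1) :
    StarPoly.IsUnitarySeminorm ((normSeminorm ℂ B).comp (evalPoly W).toLinearMap) where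
  mul_le a b := by simpa using norm_mul_le _ _
  cstar a := by simp [evalPoly_star, CStarRing.norm_star_mul_self]
  star_mul_gen i j := by
    have := congrFun (congrFun h i) j
    simp only [Matrix.mul_apply, Matrix.conjTranspose_apply, Matrix.one_apply] at this
    simp [evalPoly_star, evalPoly_gen, this, apply_ite (evalPoly W)]
  gen_mul_star i j := by
    have := congrFun (congrFun h' i) j
    simp only [Matrix.mul_apply, Matrix.conjTranspose_apply, Matrix.one_apply] at this
    simp [evalPoly_star, evalPoly_gen, this, apply_ite (evalPoly W)]
  gen_le i j := by simpa [evalPoly_gen] using norm_entry_le_one h i j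

open Matrix in
open scoped CStarAlgebra in
/-- The universal property: every unitary `n × n` matrix over a unital `C*`-algebra is the image of
the matrix of generators under a unique unital `*`-homomorphism. -/
theorem existsUnique_lift (W : Matrix (Fin n) (Fin n) B) (h : Wᴴ * W = 1) (h' : W * Wᴴ = 1) :
    ∃! π : Unc n →⋆ₐ[ℂ] B, ∀ i j, π (u i j) = W i j := by
  have hle : ∀ a, ‖evalPoly W a‖ ≤ 1 * ‖a‖ := fun a => by
    rw [one_mul]; exact StarPoly.le_univNorm (isUnitarySeminorm h h') a
  have huc : UniformContinuous (evalPoly W : StarPoly n → B) :=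
    (AddMonoidHomClass.lipschitz_of_bound (evalPoly W) 1 hle).uniformContinuous
  let f : Unc n → B := Completion.extension (evalPoly W : StarPoly n → B)
  have hf : Continuous f := Completion.continuous_extension
  have hfa : ∀ a, f (ofPoly a) = evalPoly W a := fun a => Completion.extension_coe huc a
  let π : Unc n →⋆ₐ[ℂ] B :=
    { toFun := f
      map_one' := by rw [← map_one (ofPoly (n := n)), hfa, map_one]
      map_zero' := by rw [← map_zero (ofPoly (n := n)), hfa, map_zero]
      map_mul' := fun x y => by
        refine induction₂ (P := fun x y => f (x * y) = f x * f y) x y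
          (isClosed_eq (by fun_prop) (by fun_prop)) fun a b => ?_
        rw [← map_mul, hfa, hfa, hfa, map_mul]
      map_add' := fun x y => by
        refine induction₂ (P := fun x y => f (x + y) = f x + f y) x y
          (isClosed_eq (by fun_prop) (by fun_prop)) fun a b => ?_
        rw [← map_add, hfa, hfa, hfa, map_add]
      commutes' := fun c => by
        rw [← AlgHom.commutes (ofPoly (n := n)), hfa, AlgHom.commutes]
      map_star' := fun x => by
        refine induction (P := fun x => f (star x) = star (f x)) x
          (isClosed_eq (by fun_prop) (by fun_prop)) fun a => ?_
        rw [star_ofPoly, hfa, hfa, evalPoly_star] }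
  refine ⟨π, fun i j => (hfa _).trans (evalPoly_gen W i j), fun ρ hρ => ?_⟩
  ext x
  have hρc : Continuous ρ := map_continuous ρ
  refine induction (P := fun x => ρ x = f x) x (isClosed_eq hρc hf) fun a => ?_
  rw [hfa]
  induction a using StarPoly.induction with
  | hc c => rw [AlgHom.commutes, AlgHom.commutes]; exact AlgHomClass.commutes ρ c
  | hl x =>
    obtain ⟨⟨i, j⟩, b⟩ := x
    have h1 : ρ (ofPoly (StarPoly.gen i j)) = W i j := hρ i j
    cases b
    · rw [evalPoly_letter]; simpa using! h1
    · have h2 : StarPoly.letter ((i, j), true) = star (StarPoly.gen i j) := by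
        rw [StarPoly.gen, StarPoly.star_letter]; rfl
      rw [h2, ← star_ofPoly, map_star, h1, evalPoly_star, evalPoly_gen]
  | hm a b ha hb => rw [map_mul, map_mul, ha, hb, map_mul]
  | ha a b ha hb => rw [map_add, map_add, ha, hb, map_add]

end Universal

end Unc

/-! ### Operator systems -/

/-- The data of an operator system on `S`: a unit and a set of matrices over `S` of each size. -/
@[ext]
structure MatrixOrder (S : Type*) where
  unit : S
  cone : (n : ℕ) → Set (Matrix (Fin n) (Fin n) S)

/-- `A X A*` for a scalar matrix `A` and a square matrix `X` over a complex vector space. -/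
def scalarConj {S ι κ : Type*} [AddCommGroup S] [Module ℂ S] [Fintype κ]
    (A : Matrix ι κ ℂ) (X : Matrix κ κ S) : Matrix ι ι S :=
  .of fun i j => ∑ k, ∑ l, (A i k * star (A j l)) • X k l

/-- An abstract operator system structure on the complex `*`-vector space `S`: a matrix ordering
with an Archimedean matrix order unit. -/
structure OperatorSystem (S : Type*) [AddCommGroup S] [Module ℂ S] [StarAddMonoid S]
    [StarModule ℂ S] extends MatrixOrder S where
  isHermitian_of_mem : ∀ {n : ℕ} {X}, X ∈ cone n → X.IsHermitian
  add_mem : ∀ {n : ℕ} {X Y}, X ∈ cone n → Y ∈ cone n → X + Y ∈ cone n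
  smul_mem : ∀ {n : ℕ} {X} {t : ℝ}, 0 ≤ t → X ∈ cone n → (t : ℂ) • X ∈ cone n
  conj_mem : ∀ {n m : ℕ} {X} (A : Matrix (Fin m) (Fin n) ℂ), X ∈ cone n → scalarConj A X ∈ cone m
  eq_zero_of_mem_of_neg_mem : ∀ {n : ℕ} {X}, X ∈ cone n → -X ∈ cone n → X = 0
  star_unit : star unit = unit
  exists_add_mem : ∀ {n : ℕ} {X : Matrix (Fin n) (Fin n) S}, X.IsHermitian →
    ∃ r : ℝ, 0 < r ∧ X + (r : ℂ) • Matrix.diagonal (fun _ => unit) ∈ cone n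
  archimedean : ∀ {n : ℕ} {X : Matrix (Fin n) (Fin n) S}, X.IsHermitian →
    (∀ r : ℝ, 0 < r → X + (r : ℂ) • Matrix.diagonal (fun _ => unit) ∈ cone n) → X ∈ cone n

namespace MatrixOrder

/-- The matrix order of a unital `*`-ring such as `B(H)`, a matrix algebra or a `C*`-algebra: a
matrix is positive when it is of the form `Y* Y`. -/
def ofStarRing (A : Type*) [Ring A] [StarRing A] : MatrixOrder A where
  unit := 1
  cone n := {X | ∃ Y : Matrix (Fin n) (Fin n) A, X = Y.conjTranspose * Y}

/-- Unital completely positive maps. -/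
structure IsUCP {S T : Type*} [AddCommGroup S] [Module ℂ S] [AddCommGroup T] [Module ℂ T]
    (P : MatrixOrder S) (Q : MatrixOrder T) (φ : S →ₗ[ℂ] T) : Prop where
  map_unit : φ P.unit = Q.unit
  map_mem : ∀ {n : ℕ} {X}, X ∈ P.cone n → X.map φ ∈ Q.cone n

/-- Unital complete order embeddings: injective unital `*`-linear maps which are complete order
isomorphisms onto their range, ordered by the cones of the target. -/
structure IsCompleteOrderEmbedding {S T : Type*} [AddCommGroup S] [Module ℂ S] [Star S]
    [AddCommGroup T] [Module ℂ T] [Star T]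
    (P : MatrixOrder S) (Q : MatrixOrder T) (φ : S →ₗ[ℂ] T) : Prop where
  injective : Function.Injective φ
  map_unit : φ P.unit = Q.unit
  map_star : ∀ x, φ (star x) = star (φ x)
  map_mem_iff : ∀ {n : ℕ} {X : Matrix (Fin n) (Fin n) S}, X.map φ ∈ Q.cone n ↔ X ∈ P.cone n

section Tensor

universe u v

variable {S : Type u} {T : Type v} [AddCommGroup S] [Module ℂ S] [StarAddMonoid S] [StarModule ℂ S]
  [AddCommGroup T] [Module ℂ T] [StarAddMonoid T] [StarModule ℂ T]

/-- The map `φ ⊗ ψ : S ⊗ T → M_k ⊗ M_m = M_{km}`. -/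
def kronMap {k m : ℕ}
    (φ : S →ₗ[ℂ] Matrix (Fin k) (Fin k) ℂ) (ψ : T →ₗ[ℂ] Matrix (Fin m) (Fin m) ℂ) :
    S ⊗[ℂ] T →ₗ[ℂ] Matrix (Fin k × Fin m) (Fin k × Fin m) ℂ :=
  TensorProduct.lift ((Matrix.kroneckerBilinear (R := ℂ) (α := ℂ)).compl₁₂ φ ψ)

/-- The map `φ · ψ : S ⊗ T → A`, `s ⊗ t ↦ φ s * ψ t`. -/
def prodMap {A : Type*} [Ring A] [Algebra ℂ A] (φ : S →ₗ[ℂ] A) (ψ : T →ₗ[ℂ] A) :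
    S ⊗[ℂ] T →ₗ[ℂ] A :=
  TensorProduct.lift ((LinearMap.mul ℂ A).compl₁₂ φ ψ)

/-- The minimal tensor product. -/
def minTensor (P : MatrixOrder S) (Q : MatrixOrder T) : MatrixOrder (S ⊗[ℂ] T) where
  unit := P.unit ⊗ₜ Q.unit
  cone n := {X | X.IsHermitian ∧
    ∀ (k m : ℕ) (φ : S →ₗ[ℂ] Matrix (Fin k) (Fin k) ℂ) (ψ : T →ₗ[ℂ] Matrix (Fin m) (Fin m) ℂ),
      IsUCP P (ofStarRing _) φ → IsUCP Q (ofStarRing _) ψ →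
        X.map (kronMap φ ψ) ∈ (ofStarRing (Matrix (Fin k × Fin m) (Fin k × Fin m) ℂ)).cone n}

/-- The commuting tensor product. Hilbert spaces are taken in the universe of `S ⊗ T`, which is no
restriction: positivity is tested on vectors, hence on the closed subspaces which finitely many
vectors generate under the `*`-algebra generated by the ranges of the two maps. -/
def commTensor (P : MatrixOrder S) (Q : MatrixOrder T) : MatrixOrder (S ⊗[ℂ] T) where
  unit := P.unit ⊗ₜ Q.unit
  cone n := {X | X.IsHermitian ∧
    ∀ (H : Type (max u v)) [NormedAddCommGroup H] [InnerProductSpace ℂ H] [CompleteSpace H]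
      (φ : S →ₗ[ℂ] (H →L[ℂ] H)) (ψ : T →ₗ[ℂ] (H →L[ℂ] H)),
      IsUCP P (ofStarRing _) φ → IsUCP Q (ofStarRing _) ψ → (∀ s t, Commute (φ s) (ψ t)) →
        X.map (prodMap φ ψ) ∈ (ofStarRing (H →L[ℂ] H)).cone n}

/-- The elements `A (X ⊗ Y) A*` with `X` and `Y` positive and `A` a scalar matrix. -/
def maxGen (P : MatrixOrder S) (Q : MatrixOrder T) (n : ℕ) :
    Set (Matrix (Fin n) (Fin n) (S ⊗[ℂ] T)) :=
  {Z | ∃ (k m : ℕ) (X : Matrix (Fin k) (Fin k) S) (Y : Matrix (Fin m) (Fin m) T)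
    (A : Matrix (Fin n) (Fin k × Fin m) ℂ), X ∈ P.cone k ∧ Y ∈ Q.cone m ∧
      Z = scalarConj A (Matrix.kroneckerMap (fun s t => s ⊗ₜ[ℂ] t) X Y)}

/-- The maximal tensor product. -/
def maxTensor (P : MatrixOrder S) (Q : MatrixOrder T) : MatrixOrder (S ⊗[ℂ] T) where
  unit := P.unit ⊗ₜ Q.unit
  cone n := {X | X.IsHermitian ∧ ∀ ε : ℝ, 0 < ε →
    X + (ε : ℂ) • Matrix.diagonal (fun _ => P.unit ⊗ₜ[ℂ] Q.unit) ∈ maxGen P Q n}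

end Tensor

end MatrixOrder

namespace OperatorSystem

section CStarAlgebra

variable {A : Type*} [CStarAlgebra A] {n : ℕ}

lemma nonneg_iff_exists [PartialOrder A] [StarOrderedRing A] {a : A} :
    0 ≤ a ↔ ∃ b, a = star b * b := CStarAlgebra.nonneg_iff_eq_star_mul_self

lemma mem_cone_iff [PartialOrder A] [StarOrderedRing A] {X : Matrix (Fin n) (Fin n) A} :
    X ∈ (MatrixOrder.ofStarRing A).cone n ↔ 0 ≤ CStarMatrix.ofMatrix X :=
  (nonneg_iff_exists (a := CStarMatrix.ofMatrix X)).symm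

lemma sum_mem_cone [PartialOrder A] [StarOrderedRing A] {ι : Type*} (s : Finset ι)
    (X : ι → Matrix (Fin n) (Fin n) A) (h : ∀ i ∈ s, X i ∈ (MatrixOrder.ofStarRing A).cone n) :
    ∑ i ∈ s, X i ∈ (MatrixOrder.ofStarRing A).cone n := by
  rw [mem_cone_iff]
  have : CStarMatrix.ofMatrix (∑ i ∈ s, X i) = ∑ i ∈ s, CStarMatrix.ofMatrix (X i) :=
    map_sum (CStarMatrix.ofMatrixₗ (R := ℂ)) _ _
  rw [this]
  exact Finset.sum_nonneg fun i hi => mem_cone_iff.1 (h i hi)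

lemma conjTranspose_mul_self_mem_cone [PartialOrder A] [StarOrderedRing A] {ι : Type*} [Fintype ι]
    (Z : Matrix ι (Fin n) A) : Z.conjTranspose * Z ∈ (MatrixOrder.ofStarRing A).cone n := by
  have e : Z.conjTranspose * Z = ∑ k, Matrix.of fun i j => star (Z k i) * Z k j := by
    ext i j
    simp [Matrix.mul_apply, Matrix.sum_apply]
  rw [e]
  refine sum_mem_cone _ _ fun k _ => ?_
  rcases n with _ | n
  · exact ⟨0, Subsingleton.elim _ _⟩
  · refine ⟨.of fun i j => if i = 0 then Z k j else 0, ?_⟩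
    ext i j
    simp [Matrix.mul_apply, apply_ite star]

lemma ofMatrix_add_smul [PartialOrder A] [StarOrderedRing A] (X : Matrix (Fin n) (Fin n) A)
    (r : ℝ) : CStarMatrix.ofMatrix (X + (r : ℂ) • Matrix.diagonal (fun _ => (1 : A))) =
      CStarMatrix.ofMatrix X + algebraMap ℝ (CStarMatrix (Fin n) (Fin n) A) r := by
  rw [Algebra.algebraMap_eq_smul_one]
  ext i j
  simp only [CStarMatrix.ofMatrix_apply, Matrix.add_apply, CStarMatrix.add_apply,
    Matrix.smul_apply, CStarMatrix.smul_apply, Matrix.diagonal_apply, CStarMatrix.one_apply]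
  by_cases hij : i = j <;> simp [hij]

end CStarAlgebra

/-- The operator system structure of a unital `C*`-algebra. -/
def ofCStarAlgebra (A : Type*) [CStarAlgebra A] : OperatorSystem A :=
  letI := CStarAlgebra.spectralOrder A
  letI := CStarAlgebra.spectralOrderedRing A
  { toMatrixOrder := .ofStarRing A
    isHermitian_of_mem := by
      rintro n _ ⟨Y, rfl⟩
      exact Matrix.isHermitian_conjTranspose_mul_self Y
    add_mem := by
      intro n X Y hX hY
      rw [mem_cone_iff] at *
      exact add_nonneg hX hY
    smul_mem := by
      rintro n _ t ht ⟨Y, rfl⟩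
      refine ⟨((√t : ℝ) : ℂ) • Y, ?_⟩
      rw [Matrix.conjTranspose_smul, Matrix.smul_mul, Matrix.mul_smul, smul_smul]
      simp [← Complex.ofReal_mul, Real.mul_self_sqrt ht]
    conj_mem := by
      rintro n m _ B ⟨Y, rfl⟩
      have e : scalarConj B (Y.conjTranspose * Y) =
          (Matrix.of fun (k : Fin n) (j : Fin m) => ∑ l, star (B j l) • Y k l).conjTranspose *
            (Matrix.of fun (k : Fin n) (j : Fin m) => ∑ l, star (B j l) • Y k l) := by
        ext i j
        simp only [scalarConj, Matrix.of_apply, Matrix.mul_apply, Matrix.conjTranspose_apply,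
          star_sum, star_smul, star_star, Finset.sum_mul_sum, smul_mul_smul_comm, Finset.smul_sum]
        symm
        rw [Finset.sum_comm]
        exact Finset.sum_congr rfl fun k _ => Finset.sum_comm
      rw [e]
      exact conjTranspose_mul_self_mem_cone _
    eq_zero_of_mem_of_neg_mem := by
      intro n X hX hX'
      rw [mem_cone_iff] at hX hX'
      exact le_antisymm (α := CStarMatrix (Fin n) (Fin n) A) (neg_nonneg.1 hX') hX
    star_unit := star_one A
    exists_add_mem := by
      intro n X hX
      have hX' : IsSelfAdjoint (CStarMatrix.ofMatrix X) := hX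
      refine ⟨‖CStarMatrix.ofMatrix X‖ + 1, by positivity, ?_⟩
      refine mem_cone_iff.2 ?_
      refine (ofMatrix_add_smul X _).symm ▸ ?_
      rw [map_add, ← add_assoc]
      refine add_nonneg (neg_le_iff_add_nonneg'.1 ?_) ?_
      · rw [neg_le]
        exact hX'.neg_algebraMap_norm_le_self
      · rw [map_one]
        exact zero_le_one
    archimedean := by
      intro n X hX h
      refine mem_cone_iff.2 ?_
      have h' : ∀ r : ℝ, 0 < r →
          0 ≤ CStarMatrix.ofMatrix X + algebraMap ℝ (CStarMatrix (Fin n) (Fin n) A) r :=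
        fun r hr => (ofMatrix_add_smul X r) ▸ mem_cone_iff.1 (h r hr)
      have ht : Filter.Tendsto
          (fun r : ℝ => CStarMatrix.ofMatrix X + algebraMap ℝ (CStarMatrix (Fin n) (Fin n) A) r)
          (nhdsWithin 0 (Set.Ioi 0)) (nhds (CStarMatrix.ofMatrix X + algebraMap ℝ _ 0)) :=
        (Continuous.tendsto (by fun_prop) 0).mono_left nhdsWithin_le_nhds
      rw [map_zero, add_zero] at ht
      exact ge_of_tendsto ht (Filter.eventually_of_mem self_mem_nhdsWithin h') }

/-- The operator subsystem carried by a self-adjoint subspace containing the unit. -/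
def subsystem {S : Type*} [AddCommGroup S] [Module ℂ S] [StarAddMonoid S] [StarModule ℂ S]
    (P : OperatorSystem S) (W : Submodule ℂ S) [StarAddMonoid W] [StarModule ℂ W]
    (hW : ∀ x : W, ((star x : W) : S) = star (x : S)) (h1 : P.unit ∈ W) : OperatorSystem W where
  unit := ⟨P.unit, h1⟩
  cone n := {X | X.map W.subtype ∈ P.cone n}
  isHermitian_of_mem {n X} hX := by
    ext i j
    have h := congrFun (congrFun (P.isHermitian_of_mem hX) i) j
    simpa [hW] using h
  add_mem {n X Y} hX hY := by
    have h := P.add_mem hX hY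
    rwa [← Matrix.map_add _ (map_add _)] at h
  smul_mem {n X t} ht hX := by
    have h := P.smul_mem ht hX
    rwa [← Matrix.map_smul _ _ (fun _ => map_smul _ _ _)] at h
  conj_mem {n m X} A hX := by
    have h := P.conj_mem A hX
    have e : (scalarConj A X).map W.subtype = scalarConj A (X.map W.subtype) := by
      ext i j; simp [scalarConj]
    rw [← e] at h
    exact h
  eq_zero_of_mem_of_neg_mem {n X} hX hX' := by
    have e : (-X).map W.subtype = -(X.map W.subtype) := by ext i j; simp
    have h := P.eq_zero_of_mem_of_neg_mem hX (e ▸ hX')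
    ext i j
    exact congrFun (congrFun h i) j
  star_unit := Subtype.ext ((hW _).trans P.star_unit)
  exists_add_mem {n X} hX := by
    have hX' : (X.map W.subtype).IsHermitian := by
      ext i j
      have h := congrArg (Subtype.val) (congrFun (congrFun hX i) j)
      simpa [hW] using h
    obtain ⟨r, hr, h⟩ := P.exists_add_mem hX'
    refine ⟨r, hr, ?_⟩
    have e : (X + (r : ℂ) • Matrix.diagonal (fun _ => (⟨P.unit, h1⟩ : W))).map W.subtype =
        X.map W.subtype + (r : ℂ) • Matrix.diagonal (fun _ => P.unit) := by
      ext i j; by_cases hij : i = j <;> simp [hij]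
    rw [← e] at h
    exact h
  archimedean {n X} hX h := by
    have hX' : (X.map W.subtype).IsHermitian := by
      ext i j
      have h := congrArg (Subtype.val) (congrFun (congrFun hX i) j)
      simpa [hW] using h
    refine P.archimedean hX' fun r hr => ?_
    have e : (X + (r : ℂ) • Matrix.diagonal (fun _ => (⟨P.unit, h1⟩ : W))).map W.subtype =
        X.map W.subtype + (r : ℂ) • Matrix.diagonal (fun _ => P.unit) := by
      ext i j; by_cases hij : i = j <;> simp [hij]
    rw [← e]
    exact h r hr

end OperatorSystem

/-- The subspace `V_n` of `U_nc(n)` spanned by `1`, the generators and their adjoints. -/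
def Vn (n : ℕ) : Submodule ℂ (Unc n) :=
  Submodule.span ℂ ({1} ∪ Set.range (fun p : Fin n × Fin n => Unc.u p.1 p.2) ∪
    Set.range (fun p : Fin n × Fin n => star (Unc.u p.1 p.2)))

namespace Vn

variable {n : ℕ}

lemma one_mem : (1 : Unc n) ∈ Vn n := Submodule.subset_span (.inl (.inl rfl))

lemma star_mem {x : Unc n} (hx : x ∈ Vn n) : star x ∈ Vn n := by
  induction hx using Submodule.span_induction with
  | mem x hx =>
    refine Submodule.subset_span ?_
    rcases hx with (rfl | ⟨p, rfl⟩) | ⟨p, rfl⟩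
    · exact .inl (.inl (star_one _))
    · exact .inr ⟨p, rfl⟩
    · exact .inl (.inr ⟨p, (star_star _).symm⟩)
  | zero => rw [star_zero]; exact zero_mem _
  | add x y _ _ hx hy => rw [star_add]; exact add_mem hx hy
  | smul c x _ hx => rw [star_smul]; exact Submodule.smul_mem _ _ hx

instance : StarAddMonoid (Vn n) where
  star x := ⟨star x.1, star_mem x.2⟩
  star_involutive x := Subtype.ext (star_star x.1)
  star_add x y := Subtype.ext (star_add x.1 y.1)

instance : StarModule ℂ (Vn n) where
  star_smul c x := Subtype.ext (star_smul c x.1)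

end Vn

/-- The operator system structure of `V_n` as an operator subsystem of `U_nc(n)`. -/
def Vn.operatorSystem (n : ℕ) : OperatorSystem (Vn n) :=
  (OperatorSystem.ofCStarAlgebra (Unc n)).subsystem (Vn n) (fun _ => rfl) Vn.one_mem

/-- The operator system structure of the `C*`-algebra `U_nc(n)`. -/
def Unc.operatorSystem (n : ℕ) : OperatorSystem (Unc n) := .ofCStarAlgebra (Unc n)

end

set_option linter.unusedSectionVars false

/-! Two properties of $\mathcal V_n$ carry both statements: its ucp maps extend to $\mathcal
U_{nc}(n)$ inside a bicommutant, and it is rigid, because it contains the entries of a unitary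
generating the algebra.

Extension (`Unc.exists_ucp_extension`). The matrix $[1,u^*;u,1]=[u,1]^*[u,1]$ is positive, so a ucp
map $\varphi:\mathcal V_n\to B$ makes $T=(\varphi(u_{ij}))$ a contraction. A Halmos dilation of $T$
is a unitary matrix over $M_2(B)$ with corner $T$; the universal property turns it into a
$*$-homomorphism $\mathcal U_{nc}(n)\to M_2(B)$, whose corner extends $\varphi$. The dilation is
made by functional calculus, so its entries commute with whatever commutes with the entries of $T$
and $T^*$. Hence, if $\psi$ commutes with $\varphi$, the extension takes positive matrices to $Y^*Y$
with $Y$ commuting with the range of $\psi$, and the product with $\psi$ is positive on the maximal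
cone (`map_prodMap_mem_of_mem_maxTensor`). So maximal positivity implies commuting positivity on
$\mathcal V_n\otimes\mathcal S$.

For the converse, a self-adjoint element outside the maximal cone of $A\otimes\mathcal S$ is
separated from it by a functional, and a GNS construction on columns over $A$ produces a
representation of $A$ and a commuting ucp map of $\mathcal S$ that detect the failure of positivity
(`mem_maxTensor_of_forall_representation`). Restricting the representation to $\mathcal V_n$ gives
the first statement. Since ucp maps into matrices extend as well, the minimal cones of $\mathcal
V_n\otimes\mathcal S$ are also induced from $\mathcal U_{nc}(n)\otimes\mathcal S$, and one
implication of the second statement follows.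

Rigidity gives the other implication. Let min and c agree on $\mathcal V_n\otimes\mathcal S$, and
let $\pi$ and $\psi$ commute. Then $\pi\cdot\psi$ is completely positive on $\mathcal
V_n\otimes_{\min}\mathcal S$, so its family of matrix coefficients extends to a positive kernel on
$\mathcal U_{nc}(n)\otimes_{\min}\mathcal S$ (`exists_kernel_extension`, an Arveson theorem at the
level of forms). The kernel agrees with $\pi$ on the entries of a unitary, so a multiplicative
domain argument makes it a module map over the generators (`IsKernel.map_sandwich_star`), and by
density it is given by $\pi\cdot\psi$ everywhere (`IsKernel.map_tmul_eq`). So $\pi\cdot\psi$ is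
positive on the minimal cones, which therefore lie in the maximal ones. -/

/-! ### Extension of positive functionals -/

/-- A complex version of the M. Riesz extension theorem: a functional which is positive on the
self-adjoint positive elements of a cofinal subspace agrees there with a positive functional. -/
theorem exists_positive_extension {E : Type*} [AddCommGroup E] [Module ℂ E]
    (J : E →ₛₗ[starRingEnd ℂ] E) (hJ : ∀ x, J (J x) = x) (K : Set E) (hK0 : (0 : E) ∈ K)
    (hKadd : ∀ x ∈ K, ∀ y ∈ K, x + y ∈ K)
    (hKsmul : ∀ t : ℝ, 0 ≤ t → ∀ x ∈ K, (t : ℂ) • x ∈ K)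
    (hKJ : ∀ x ∈ K, J x = x) (E₀ : Submodule ℂ E) (hE₀ : ∀ x ∈ E₀, J x ∈ E₀) (F : E →ₗ[ℂ] ℂ)
    (hF : ∀ x ∈ E₀, F (J x) = conj (F x)) (hpos : ∀ x ∈ E₀, x ∈ K → 0 ≤ (F x).re)
    (hcof : ∀ y, J y = y → ∃ x ∈ E₀, J x = x ∧ x + y ∈ K) :
    ∃ G : E →ₗ[ℂ] ℂ, (∀ x ∈ E₀, G x = F x) ∧ (∀ x, G (J x) = conj (G x)) ∧
      ∀ x ∈ K, 0 ≤ (G x).re := by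
  have hreal : ∀ (t : ℝ) (x : E), t • x = (t : ℂ) • x := fun t x => (Complex.coe_smul t x).symm
  -- Testing $x+Jx$ instead of $x$ makes the cone insensitive to the skew part, so that cofinality
  -- for self-adjoint vectors gives the cofinality in all of $E$ which the real extension theorem
  -- needs.
  let K' : PointedCone ℝ E :=
    { carrier := {x | x + J x ∈ K}
      zero_mem' := by simpa using hK0
      add_mem' := fun {x y} hx hy => by
        have h := hKadd _ hx _ hy
        simp only [Set.mem_ofPred_eq, map_add]
        convert h using 1
        abel
      smul_mem' := fun c x hx => by
        have h := hKsmul c.1 c.2 _ hx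
        have e : c • x = ((c.1 : ℝ) : ℂ) • x := hreal c.1 x
        simp only [Set.mem_ofPred_eq]
        rw [e, LinearMap.map_smulₛₗ, Complex.conj_ofReal, ← smul_add]
        exact h }
  have memK' : ∀ x, x ∈ K' ↔ x + J x ∈ K := fun _ => Iff.rfl
  let f : E →ₗ.[ℝ] ℝ :=
    { domain := E₀.restrictScalars ℝ
      toFun := (Complex.reLm ∘ₗ F.restrictScalars ℝ) ∘ₗ (E₀.restrictScalars ℝ).subtype }
  have hf : ∀ x : f.domain, f x = (F x).re := fun _ => rfl
  obtain ⟨g, hg, hgpos⟩ := riesz_extension K' f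
    (fun x hx => by
      have h1 := hpos (x + J x) (add_mem x.2 (hE₀ x x.2)) hx
      rw [map_add, hF x x.2, Complex.add_re, Complex.conj_re] at h1
      rw [hf]; linarith)
    (fun y => by
      obtain ⟨x, hx, hxJ, h⟩ := hcof (y + J y) (by rw [map_add, hJ, add_comm])
      refine ⟨⟨((1 / 2 : ℝ) : ℂ) • x, E₀.smul_mem _ hx⟩, ?_⟩
      rw [memK', map_add, LinearMap.map_smulₛₗ, Complex.conj_ofReal, hxJ]
      convert h using 1
      have : x = ((1 / 2 : ℝ) : ℂ) • x + ((1 / 2 : ℝ) : ℂ) • x := by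
        rw [← add_smul, ← Complex.ofReal_add]; norm_num
      calc _ = ((1 / 2 : ℝ) : ℂ) • x + ((1 / 2 : ℝ) : ℂ) • x + (y + J y) := by abel
        _ = _ := by rw [← this])
  -- Both $x-Jx$ and its negative lie in `K'`, since their symmetrizations vanish.
  have hanti : ∀ x, g (J x) = g x := by
    have key : ∀ x, 0 ≤ g (x - J x) := fun x => hgpos _ (by
      rw [memK', map_sub, hJ]; simpa using hK0)
    intro x
    have h1 := key x
    have h2 := key (J x)
    rw [hJ] at h2
    rw [map_sub] at h1 h2
    linarith
  have happ : ∀ x, Module.Dual.extendRCLike (𝕜 := ℂ) g x =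
      (g x : ℂ) - Complex.I * (g (Complex.I • x) : ℂ) :=
    fun x => Module.Dual.extendRCLike_apply g x
  refine ⟨Module.Dual.extendRCLike g, fun x hx => ?_, fun x => ?_, fun x hx => ?_⟩
  · have h1 : g x = (F x).re := hg ⟨x, hx⟩
    have h2 : g (Complex.I • x) = (F (Complex.I • x)).re := hg ⟨_, E₀.smul_mem _ hx⟩
    rw [happ, h1, h2, map_smul]
    apply Complex.ext <;> simp
  · have h : Complex.I • J x = -J (Complex.I • x) := by
      rw [LinearMap.map_smulₛₗ, Complex.conj_I, neg_smul, neg_neg]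
    rw [happ, happ, h, map_neg, hanti, hanti]
    apply Complex.ext <;> simp
  · have h1 : 0 ≤ g x := by
      refine hgpos x ?_
      rw [memK', hKJ x hx]
      exact hKadd _ hx _ hx
    rw [happ]
    simpa using h1

/-! ### Matrix orders -/

section ScalarConj

variable {S : Type*} [AddCommGroup S] [Module ℂ S]

lemma scalarConj_apply {ι κ : Type*} [Fintype κ] (A : Matrix ι κ ℂ) (X : Matrix κ κ S) (i j : ι) :
    scalarConj A X i j = ∑ k, ∑ l, (A i k * star (A j l)) • X k l := rfl

lemma scalarConj_submatrix {ι ι' κ : Type*} [Fintype κ] (A : Matrix ι κ ℂ) (X : Matrix κ κ S)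
    (f : ι' → ι) : (scalarConj A X).submatrix f f = scalarConj (A.submatrix f id) X := rfl

lemma scalarConj_reindex {ι κ κ' : Type*} [Fintype κ] [Fintype κ'] (A : Matrix ι κ ℂ)
    (X : Matrix κ κ S) (e : κ' ≃ κ) :
    scalarConj (A.submatrix id e) (X.submatrix e e) = scalarConj A X := by
  ext i j
  simp only [scalarConj_apply, Matrix.submatrix_apply, id]
  rw [← e.sum_comp]
  exact Finset.sum_congr rfl fun k _ => e.sum_comp (fun l => (A i (e k) * star (A j l)) • X (e k) l)

/-- Conjugation by a 0-1 matrix selects rows and columns, possibly with repetitions; closure of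
cones under scalar conjugation therefore includes passage to submatrices and reindexing. -/
lemma scalarConj_select {ι κ : Type*} [Fintype κ] [DecidableEq κ] (f : ι → κ) (X : Matrix κ κ S) :
    scalarConj (.of fun i k => if f i = k then 1 else 0) X = X.submatrix f f := by
  ext i j
  simp only [scalarConj_apply, Matrix.of_apply, Matrix.submatrix_apply]
  rw [Finset.sum_eq_single (f i), Finset.sum_eq_single (f j)] <;>
    simp +contextual [apply_ite, eq_comm]

lemma scalarConj_diagonal {ι : Type*} [Fintype ι] [DecidableEq ι] (d : ι → ℂ) (X : Matrix ι ι S) :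
    scalarConj (Matrix.diagonal d) X = .of fun i j => (d i * star (d j)) • X i j := by
  ext i j
  simp only [scalarConj_apply, Matrix.of_apply]
  rw [Finset.sum_eq_single i, Finset.sum_eq_single j] <;>
    simp +contextual [Matrix.diagonal_apply, eq_comm]

lemma scalarConj_map {T : Type*} [AddCommGroup T] [Module ℂ T] {ι κ : Type*} [Fintype κ]
    (A : Matrix ι κ ℂ) (X : Matrix κ κ S) (φ : S →ₗ[ℂ] T) :
    (scalarConj A X).map φ = scalarConj A (X.map φ) := by
  ext i j
  simp [scalarConj_apply]

end ScalarConj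

namespace MatrixOrder

section

/-- Positivity of a matrix with arbitrary index set: all finite submatrices are positive. -/
def IsPos {S : Type*} (P : MatrixOrder S) {ι : Type*} (X : Matrix ι ι S) : Prop :=
  ∀ (n : ℕ) (f : Fin n → ι), X.submatrix f f ∈ P.cone n

lemma IsPos.submatrix {S ι κ : Type*} {P : MatrixOrder S} {X : Matrix ι ι S} (hX : P.IsPos X)
    (f : κ → ι) : P.IsPos (X.submatrix f f) := fun n g => hX n (f ∘ g)

lemma IsPos.mem {S : Type*} {P : MatrixOrder S} {n : ℕ} {X : Matrix (Fin n) (Fin n) S}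
    (hX : P.IsPos X) : X ∈ P.cone n := hX n id

variable {S : Type*} [AddCommGroup S] [Module ℂ S] [StarAddMonoid S]

/-- A matrix ordering with a matrix order unit. -/
structure IsOrdered (P : MatrixOrder S) : Prop where
  isHermitian_of_mem : ∀ {n : ℕ} {X}, X ∈ P.cone n → X.IsHermitian
  add_mem : ∀ {n : ℕ} {X Y}, X ∈ P.cone n → Y ∈ P.cone n → X + Y ∈ P.cone n
  conj_mem : ∀ {n m : ℕ} {X} (A : Matrix (Fin m) (Fin n) ℂ), X ∈ P.cone n →
    scalarConj A X ∈ P.cone m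
  star_unit : star P.unit = P.unit
  exists_add_mem : ∀ {n : ℕ} {X : Matrix (Fin n) (Fin n) S}, X.IsHermitian →
    ∃ r : ℝ, 0 < r ∧ X + (r : ℂ) • Matrix.diagonal (fun _ => P.unit) ∈ P.cone n

variable {P : MatrixOrder S} {ι κ : Type*}

namespace IsOrdered

lemma isPos_of_mem (hP : P.IsOrdered) {n : ℕ} {X : Matrix (Fin n) (Fin n) S}
    (hX : X ∈ P.cone n) : P.IsPos X := fun m f => by
  rw [← scalarConj_select]
  exact hP.conj_mem _ hX

lemma isPos_of_equiv (hP : P.IsOrdered) {n : ℕ} (e : Fin n ≃ ι) {X : Matrix ι ι S}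
    (hX : X.submatrix e e ∈ P.cone n) : P.IsPos X := by
  have h := (hP.isPos_of_mem hX).submatrix e.symm
  simpa using h

lemma isPos_add (hP : P.IsOrdered) {X Y : Matrix ι ι S} (hX : P.IsPos X) (hY : P.IsPos Y) :
    P.IsPos (X + Y) := fun n f => hP.add_mem (hX n f) (hY n f)

lemma isPos_scalarConj (hP : P.IsOrdered) [Fintype κ] {X : Matrix κ κ S} (hX : P.IsPos X)
    (A : Matrix ι κ ℂ) : P.IsPos (scalarConj A X) := fun n f => by
  rw [scalarConj_submatrix, ← scalarConj_reindex _ _ (Fintype.equivFin κ).symm]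
  exact hP.conj_mem _ (hX _ _)

/-- Any positive matrix conjugated by the zero matrix gives zero; the order unit supplies one to
start from. -/
lemma isPos_zero (hP : P.IsOrdered) : P.IsPos (0 : Matrix ι ι S) := fun n f => by
  obtain ⟨r, -, h⟩ := hP.exists_add_mem (X := (0 : Matrix (Fin n) (Fin n) S)) (by simp)
  have h := hP.conj_mem (0 : Matrix (Fin n) (Fin n) ℂ) h
  convert h using 1
  ext i j
  simp [scalarConj_apply]

lemma isPos_smul (hP : P.IsOrdered) {t : ℝ} (ht : 0 ≤ t) {X : Matrix ι ι S} (hX : P.IsPos X) :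
    P.IsPos ((t : ℂ) • X) := fun n f => by
  have h := hP.conj_mem (Matrix.diagonal fun _ => ((√t : ℝ) : ℂ)) (hX n f)
  rw [scalarConj_diagonal] at h
  convert h using 1
  ext i j
  simp [← Complex.ofReal_mul, Real.mul_self_sqrt ht]

lemma isHermitian (hP : P.IsOrdered) {X : Matrix ι ι S} (hX : P.IsPos X) : X.IsHermitian := by
  ext i j
  exact congrFun (congrFun (hP.isHermitian_of_mem (hX 2 ![i, j])) 0) 1

lemma exists_isPos_add (hP : P.IsOrdered) [Finite ι] [DecidableEq ι] {X : Matrix ι ι S}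
    (hX : X.IsHermitian) :
    ∃ r : ℝ, 0 < r ∧ P.IsPos (X + (r : ℂ) • Matrix.diagonal fun _ => P.unit) := by
  obtain ⟨n, ⟨e⟩⟩ := Finite.exists_equiv_fin ι
  obtain ⟨r, hr, h⟩ := hP.exists_add_mem (hX.submatrix e.symm)
  refine ⟨r, hr, hP.isPos_of_equiv e.symm ?_⟩
  convert h using 1
  ext i j
  simp [Matrix.diagonal_apply]

lemma isPos_unit (hP : P.IsOrdered) [Finite ι] [DecidableEq ι] :
    P.IsPos (Matrix.diagonal fun _ : ι => P.unit) := by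
  obtain ⟨r, hr, h⟩ := hP.exists_isPos_add (ι := ι) (X := 0) (by simp)
  have h' := hP.isPos_smul (inv_nonneg.2 hr.le) h
  rw [zero_add, smul_smul, ← Complex.ofReal_mul, inv_mul_cancel₀ hr.ne', Complex.ofReal_one,
    one_smul] at h'
  exact h'

/-- Every element is an off-diagonal entry of a positive `2 × 2` matrix. -/
lemma exists_two_isPos (hP : P.IsOrdered) (s : S) :
    ∃ r : ℝ, 0 < r ∧ P.IsPos !![(r : ℂ) • P.unit, s; star s, (r : ℂ) • P.unit] := by
  obtain ⟨r, hr, h⟩ := hP.exists_isPos_add (X := !![0, s; star s, 0]) (by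
    ext i j; fin_cases i <;> fin_cases j <;> simp)
  refine ⟨r, hr, ?_⟩
  convert h using 1
  ext i j; fin_cases i <;> fin_cases j <;> simp

end IsOrdered

end

end MatrixOrder

/-- Dropping properness and the Archimedean axiom leaves a notion that also covers `maxGenOrder`,
where neither is available. -/
lemma OperatorSystem.isOrdered {S : Type*} [AddCommGroup S] [Module ℂ S] [StarAddMonoid S]
    [StarModule ℂ S] (P : OperatorSystem S) : P.toMatrixOrder.IsOrdered where
  isHermitian_of_mem := P.isHermitian_of_mem
  add_mem := P.add_mem
  conj_mem := P.conj_mem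
  star_unit := P.star_unit
  exists_add_mem := P.exists_add_mem

/-! ### Arveson-type extension of positive kernels -/

namespace MatrixOrder

/-- Extension of positive kernels: a kernel of functionals indexed by `I`, which is positive on
the positive matrices over a subspace `T₀` containing the unit, agrees on `T₀` with a positive
kernel. -/
theorem exists_kernel_extension {T : Type*} [AddCommGroup T] [Module ℂ T] [StarAddMonoid T]
    [StarModule ℂ T] {P : MatrixOrder T} (hP : P.IsOrdered) {I : Type*} (T₀ : Submodule ℂ T)
    (hstar : ∀ t ∈ T₀, star t ∈ T₀) (hunit : P.unit ∈ T₀) (F : I → I → T →ₗ[ℂ] ℂ)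
    (hF : ∀ i j, ∀ t ∈ T₀, F j i (star t) = conj (F i j t))
    (hpos : ∀ (n : ℕ) (f : Fin n → I) (X : Matrix (Fin n) (Fin n) T), (∀ i j, X i j ∈ T₀) →
      X ∈ P.cone n → 0 ≤ (∑ i, ∑ j, F (f i) (f j) (X i j)).re) :
    ∃ G : I → I → T →ₗ[ℂ] ℂ, (∀ i j, ∀ t ∈ T₀, G i j t = F i j t) ∧
      (∀ i j t, G j i (star t) = conj (G i j t)) ∧
      ∀ (n : ℕ) (f : Fin n → I) (X : Matrix (Fin n) (Fin n) T), X ∈ P.cone n →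
        0 ≤ (∑ i, ∑ j, G (f i) (f j) (X i j)).re := by
  classical
  -- The whole kernel is one functional on finitely supported $I\times I$ arrays, with conjugate
  -- transposition as involution. A single extension then treats all pairs of indices at once,
  -- whatever the size of $I$.
  let J : ((I × I) →₀ T) →ₛₗ[starRingEnd ℂ] ((I × I) →₀ T) :=
    { toFun := fun x => (x.mapRange star (star_zero T)).equivMapDomain (Equiv.prodComm I I)
      map_add' := fun x y => by ext ⟨i, j⟩; simp
      map_smul' := fun c x => by ext ⟨i, j⟩; simp }
  have hJ : ∀ x i j, J x (i, j) = star (x (j, i)) := fun x i j => by simp [J]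
  let M : ((I × I) →₀ T) → Matrix I I T := fun x => .of fun i j => x (i, j)
  let K : Set ((I × I) →₀ T) := {x | P.IsPos (M x)}
  let E₀ : Submodule ℂ ((I × I) →₀ T) :=
    { carrier := {x | ∀ p, x p ∈ T₀}
      zero_mem' := fun p => T₀.zero_mem
      add_mem' := fun hx hy p => T₀.add_mem (hx p) (hy p)
      smul_mem' := fun c x hx p => T₀.smul_mem c (hx p) }
  let Φ : ((I × I) →₀ T) →ₗ[ℂ] ℂ := Finsupp.lsum ℂ fun p => F p.1 p.2
  have hΦ : ∀ (Ψ : I → I → T →ₗ[ℂ] ℂ) (x : (I × I) →₀ T) (s : Finset I),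
      (∀ i j, x (i, j) ≠ 0 → i ∈ s ∧ j ∈ s) →
      Finsupp.lsum ℂ (fun p : I × I => Ψ p.1 p.2) x = ∑ i : s, ∑ j : s, Ψ i j (x (i, j)) := by
    intro Ψ x s hs
    have h1 : x.support ⊆ s ×ˢ s := fun p hp => by
      have := hs p.1 p.2 (Finsupp.mem_support_iff.1 hp)
      simpa using this
    rw [Finsupp.lsum_apply, Finsupp.sum_of_support_subset _ h1 _ (by simp), Finset.sum_product]
    rw [← Finset.sum_coe_sort s]
    exact Finset.sum_congr rfl fun i _ => by rw [← Finset.sum_coe_sort s]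
  have hsupp : ∀ x : (I × I) →₀ T, ∃ s : Finset I, ∀ i j, x (i, j) ≠ 0 → i ∈ s ∧ j ∈ s := by
    intro x
    refine ⟨x.support.image Prod.fst ∪ x.support.image Prod.snd, fun i j h => ?_⟩
    have h' : (i, j) ∈ x.support := Finsupp.mem_support_iff.2 h
    exact ⟨Finset.mem_union_left _ (Finset.mem_image_of_mem Prod.fst h'),
      Finset.mem_union_right _ (Finset.mem_image_of_mem Prod.snd h')⟩
  have hpos' : ∀ (ι : Type _) [Fintype ι] (f : ι → I) (X : Matrix ι ι T), (∀ i j, X i j ∈ T₀) →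
      P.IsPos X → 0 ≤ (∑ i, ∑ j, F (f i) (f j) (X i j)).re := by
    intro ι _ f X hX hXP
    let e := (Fintype.equivFin ι).symm
    have h := hpos _ (f ∘ e) (X.submatrix e e) (fun i j => hX _ _) (hXP _ e)
    simp only [Matrix.submatrix_apply, Function.comp] at h
    rw [← e.sum_comp]
    simp_rw [← e.sum_comp (fun j => F _ (f j) (X _ j))]
    exact h
  -- a finitely supported matrix is positive as soon as the block carrying it is
  have hblock : ∀ (x : (I × I) →₀ T) (s : Finset I), (∀ i j, x (i, j) ≠ 0 → i ∈ s ∧ j ∈ s) →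
      P.IsPos ((M x).submatrix ((↑) : s → I) (↑)) → x ∈ K := by
    intro x s hs h
    have h2 := hP.isPos_scalarConj h (.of fun (i : I) (k : s) => if i = k then 1 else 0)
    change P.IsPos (M x)
    convert h2 using 1
    ext i j
    simp only [scalarConj_apply, Matrix.of_apply, Matrix.submatrix_apply, M]
    by_cases hij : i ∈ s ∧ j ∈ s
    · rw [Finset.sum_eq_single ⟨i, hij.1⟩, Finset.sum_eq_single ⟨j, hij.2⟩]
      · simp
      · rintro ⟨k, hk⟩ - hne
        have : j ≠ k := fun h => hne (by simp [h])
        simp [this]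
      · simp
      · rintro ⟨k, hk⟩ - hne
        have : i ≠ k := fun h => hne (by simp [h])
        simp [this]
      · simp
    · have h0 : x (i, j) = 0 := by
        by_contra h; exact hij (hs i j h)
      rw [h0]
      symm
      refine Finset.sum_eq_zero fun k _ => Finset.sum_eq_zero fun l _ => ?_
      by_cases hi : i = k
      · by_cases hj : j = l
        · exact absurd ⟨hi ▸ k.2, hj ▸ l.2⟩ hij
        · simp [hj]
      · simp [hi]
  obtain ⟨G, hG, hGJ, hGpos⟩ := exists_positive_extension J
    (fun x => by ext ⟨i, j⟩; rw [hJ, hJ, star_star]) K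
    (by simpa [K, M] using! hP.isPos_zero)
    (fun x hx y hy => hP.isPos_add hx hy) (fun t ht x hx => hP.isPos_smul ht hx)
    (fun x hx => by
      ext ⟨i, j⟩
      rw [hJ]
      exact congrFun (congrFun (hP.isHermitian hx) i) j) E₀
    (fun x hx => by
      rintro ⟨i, j⟩
      rw [hJ]
      exact hstar _ (hx _)) Φ
    (fun x hx => by
      obtain ⟨s, hs⟩ := hsupp x
      have hs' : ∀ i j, J x (i, j) ≠ 0 → i ∈ s ∧ j ∈ s := fun i j h => by
        rw [hJ, star_ne_zero] at h
        exact (hs j i h).symm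
      rw [hΦ F _ s hs, hΦ F _ s hs', Finset.sum_comm, map_sum]
      refine Finset.sum_congr rfl fun i _ => ?_
      rw [map_sum]
      refine Finset.sum_congr rfl fun j _ => ?_
      rw [hJ]
      exact hF _ _ _ (hx _))
    (fun x hx hxK => by
      obtain ⟨s, hs⟩ := hsupp x
      rw [hΦ F _ s hs]
      exact hpos' s (↑) ((M x).submatrix (↑) (↑)) (fun i j => hx _) (hxK.submatrix _))
    (fun y hy => by
      obtain ⟨s, hs⟩ := hsupp y
      have hH : ((M y).submatrix ((↑) : s → I) (↑)).IsHermitian := by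
        ext i j
        have := DFunLike.congr_fun hy ((i : I), (j : I))
        rw [hJ] at this
        exact this
      obtain ⟨r, hr, h⟩ := hP.exists_isPos_add hH
      -- Cofinality: $y$ lives on a finite block, and a multiple of the unit on the diagonal of that
      -- block compensates it. This array has its entries in $T_0$.
      let x : (I × I) →₀ T := ∑ i : s, Finsupp.single ((i : I), (i : I)) ((r : ℂ) • P.unit)
      have hx : ∀ i j, x (i, j) = if i = j ∧ i ∈ s then (r : ℂ) • P.unit else 0 := by
        intro i j
        simp only [x, Finsupp.finsetSum_apply, Finsupp.single_apply]
        rw [Finset.sum_coe_sort s (fun k => if (k, k) = (i, j) then (r : ℂ) • P.unit else 0)]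
        by_cases hij : i = j
        · subst hij; simp
        · rw [Finset.sum_eq_zero, if_neg (fun h => hij h.1)]
          intro k _
          rw [if_neg]
          rintro h
          simp only [Prod.mk.injEq] at h
          exact hij (h.1.symm.trans h.2)
      refine ⟨x, ?_, ?_, hblock _ s ?_ ?_⟩
      · rintro ⟨i, j⟩
        rw [hx]
        split_ifs
        · exact T₀.smul_mem _ hunit
        · exact T₀.zero_mem
      · ext ⟨i, j⟩
        rw [hJ, hx, hx]
        by_cases hij : i = j
        · subst hij
          split_ifs <;> simp [hP.star_unit]
        · simp [hij, Ne.symm hij]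
      · intro i j h
        by_contra hc
        refine h ?_
        rw [Finsupp.add_apply, hx]
        have h0 : y (i, j) = 0 := by
          by_contra h; exact hc (hs i j h)
        rw [h0, if_neg, add_zero]
        rintro ⟨hij, hi⟩
        exact hc ⟨hi, hij ▸ hi⟩
      · convert h using 1
        ext i j
        simp only [M, Matrix.submatrix_apply, Matrix.of_apply, Finsupp.add_apply, hx,
          Matrix.add_apply, Matrix.smul_apply, Matrix.diagonal_apply]
        rw [add_comm]
        by_cases hij : i = j
        · subst hij; simp
        · have : (i : I) ≠ j := fun h => hij (Subtype.ext h)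
          simp [hij, this])
  refine ⟨fun i j => G ∘ₗ Finsupp.lsingle (i, j), fun i j t ht => ?_, fun i j t => ?_,
    fun n f X hX => ?_⟩
  · have h := hG (Finsupp.single (i, j) t) (fun p => by
      rw [Finsupp.single_apply]
      split_ifs
      · exact ht
      · exact T₀.zero_mem)
    simpa [Φ] using h
  · have h := hGJ (Finsupp.single (i, j) t)
    have e : J (Finsupp.single (i, j) t) = Finsupp.single (j, i) (star t) := by
      ext ⟨k, l⟩
      rw [hJ, Finsupp.single_apply, Finsupp.single_apply]
      by_cases h : i = l ∧ j = k <;> simp [h, and_comm]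
    rw [e] at h
    exact h
  · have h := hGpos (∑ i, ∑ j, Finsupp.single (f i, f j) (X i j)) (by
      have h2 := hP.isPos_scalarConj (hP.isPos_of_mem hX)
        (.of fun (i : I) (k : Fin n) => if i = f k then 1 else 0)
      change P.IsPos (M _)
      convert h2 using 1
      ext i j
      simp only [M, scalarConj_apply, Matrix.of_apply, Finsupp.finsetSum_apply,
        Finsupp.single_apply]
      refine Finset.sum_congr rfl fun k _ => Finset.sum_congr rfl fun l _ => ?_
      by_cases h1 : i = f k <;> by_cases h2 : j = f l <;>
        simp [h1, h2, eq_comm])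
    simpa using h

end MatrixOrder

lemma scalarConj_scalarConj {S : Type*} [AddCommGroup S] [Module ℂ S] {ι κ μ : Type*} [Fintype κ]
    [Fintype μ] (B : Matrix ι κ ℂ) (A : Matrix κ μ ℂ) (X : Matrix μ μ S) :
    scalarConj B (scalarConj A X) = scalarConj (B * A) X := by
  ext i j
  simp only [scalarConj_apply, Matrix.mul_apply, star_sum, star_mul', Finset.sum_mul_sum,
    Finset.smul_sum, Finset.sum_smul, smul_smul]
  calc _ = ∑ k, ∑ l, ∑ p, ∑ q, (B i k * star (B j l) * (A k p * star (A l q))) • X p q := rfl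
    _ = ∑ p, ∑ q, ∑ k, ∑ l, (B i k * star (B j l) * (A k p * star (A l q))) • X p q := by
        simp_rw [Finset.sum_comm (s := Finset.univ (α := κ)) (t := Finset.univ (α := μ))]
    _ = _ := by
        refine Finset.sum_congr rfl fun p _ => Finset.sum_congr rfl fun q _ =>
          Finset.sum_congr rfl fun k _ => Finset.sum_congr rfl fun l _ => ?_
        congr 1
        ring

lemma scalarConj_conjTranspose {S : Type*} [AddCommGroup S] [Module ℂ S] [StarAddMonoid S]
    [StarModule ℂ S] {ι κ : Type*} [Fintype κ] (A : Matrix ι κ ℂ) (X : Matrix κ κ S) :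
    (scalarConj A X).conjTranspose = scalarConj A X.conjTranspose := by
  ext i j
  simp only [Matrix.conjTranspose_apply, scalarConj_apply, star_sum, star_smul, star_mul',
    star_star]
  rw [Finset.sum_comm]
  refine Finset.sum_congr rfl fun k _ => Finset.sum_congr rfl fun l _ => ?_
  rw [mul_comm]

namespace MatrixOrder

namespace IsOrdered

variable {S : Type*} [AddCommGroup S] [Module ℂ S] [StarAddMonoid S] {P : MatrixOrder S}

lemma isPos_fromBlocks (hP : P.IsOrdered) {ι κ : Type*} [Fintype ι] [Fintype κ]
    {X : Matrix ι ι S} {Y : Matrix κ κ S} (hX : P.IsPos X) (hY : P.IsPos Y) :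
    P.IsPos (Matrix.fromBlocks X 0 0 Y) := by
  classical
  have h1 := hP.isPos_scalarConj hX (Matrix.fromRows (1 : Matrix ι ι ℂ) (0 : Matrix κ ι ℂ))
  have h2 := hP.isPos_scalarConj hY (Matrix.fromRows (0 : Matrix ι κ ℂ) (1 : Matrix κ κ ℂ))
  convert hP.isPos_add h1 h2 using 1
  ext (i | i) (j | j) <;>
    simp [scalarConj_apply, Matrix.one_apply, apply_ite star, ite_smul]

lemma exists_isPos_add_sub [StarModule ℂ S] (hP : P.IsOrdered) {ι : Type*} [Finite ι]
    [DecidableEq ι] {X : Matrix ι ι S} (hX : X.IsHermitian) :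
    ∃ r : ℝ, 0 < r ∧ P.IsPos ((r : ℂ) • Matrix.diagonal (fun _ => P.unit) + X) ∧
      P.IsPos ((r : ℂ) • Matrix.diagonal (fun _ => P.unit) - X) := by
  obtain ⟨r, hr, h⟩ := hP.exists_isPos_add hX
  obtain ⟨r', hr', h'⟩ := hP.exists_isPos_add hX.neg
  refine ⟨r + r', by positivity, ?_, ?_⟩
  · convert hP.isPos_add h (hP.isPos_smul hr'.le hP.isPos_unit) using 1
    rw [Complex.ofReal_add, add_smul]; abel
  · convert hP.isPos_add h' (hP.isPos_smul hr.le hP.isPos_unit) using 1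
    rw [Complex.ofReal_add, add_smul]; abel

end IsOrdered

-- The generators of the maximal tensor product

universe u v

variable {S : Type u} {T : Type v} [AddCommGroup S] [Module ℂ S] [StarAddMonoid S] [StarModule ℂ S]
  [AddCommGroup T] [Module ℂ T] [StarAddMonoid T] [StarModule ℂ T]
  {P : MatrixOrder S} {Q : MatrixOrder T}

/-- Arbitrary finite index sets are reduced to `Fin` by reindexing; the later constructions have
sums and products of index types. -/
lemma scalarConj_kronecker_mem_maxGen {κ μ : Type*} [Fintype κ] [Fintype μ]
    {X : Matrix κ κ S} {Y : Matrix μ μ T} (hX : P.IsPos X) (hY : Q.IsPos Y) {n : ℕ}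
    (A : Matrix (Fin n) (κ × μ) ℂ) :
    scalarConj A (Matrix.kroneckerMap (fun s t => s ⊗ₜ[ℂ] t) X Y) ∈ maxGen P Q n := by
  let e := (Fintype.equivFin κ).symm
  let e' := (Fintype.equivFin μ).symm
  refine ⟨_, _, X.submatrix e e, Y.submatrix e' e', A.submatrix id (e.prodCongr e'), hX _ _,
    hY _ _, ?_⟩
  rw [← scalarConj_reindex A _ (e.prodCongr e')]
  rfl

lemma tmul_mem_maxGen {n : ℕ} {X : Matrix (Fin n) (Fin n) S} {t : T} (hX : P.IsPos X)
    (ht : Q.IsPos (.of fun _ _ : Unit => t)) :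
    (.of fun i j => X i j ⊗ₜ[ℂ] t) ∈ maxGen P Q n := by
  have h := scalarConj_kronecker_mem_maxGen hX ht
    (.of fun (i : Fin n) (p : Fin n × Unit) => if i = p.1 then 1 else 0)
  convert h using 1
  ext i j
  simp [scalarConj_apply, Fintype.sum_prod_type, apply_ite star, ite_smul]

/-- The generators of the maximal tensor product, as a matrix order. -/
def maxGenOrder (P : MatrixOrder S) (Q : MatrixOrder T) : MatrixOrder (S ⊗[ℂ] T) where
  unit := P.unit ⊗ₜ Q.unit
  cone := maxGen P Q

/-- Take the direct sums $X\oplus X'$ and $Y\oplus Y'$. Of the four blocks of their tensor product,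
the scalar matrix keeps $X\otimes Y$ and $X'\otimes Y'$ and kills the mixed ones. -/
lemma add_mem_maxGen (hP : P.IsOrdered) (hQ : Q.IsOrdered) {n : ℕ}
    {Z Z' : Matrix (Fin n) (Fin n) (S ⊗[ℂ] T)} (hZ : Z ∈ maxGen P Q n) (hZ' : Z' ∈ maxGen P Q n) :
    Z + Z' ∈ maxGen P Q n := by
  obtain ⟨k, m, X, Y, A, hX, hY, rfl⟩ := hZ
  obtain ⟨k', m', X', Y', A', hX', hY', rfl⟩ := hZ'
  have h := scalarConj_kronecker_mem_maxGen
    (hP.isPos_fromBlocks (hP.isPos_of_mem hX) (hP.isPos_of_mem hX'))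
    (hQ.isPos_fromBlocks (hQ.isPos_of_mem hY) (hQ.isPos_of_mem hY'))
    (.of fun (i : Fin n) (p : (Fin k ⊕ Fin k') × (Fin m ⊕ Fin m')) => match p with
      | (.inl a, .inl b) => A i (a, b)
      | (.inr a, .inr b) => A' i (a, b)
      | _ => 0)
  convert h using 1
  ext i j
  simp [scalarConj_apply, Fintype.sum_prod_type]

lemma unit_mem_maxGen (hP : P.IsOrdered) (hQ : Q.IsOrdered) {r : ℝ} (hr : 0 ≤ r) {n : ℕ} :
    (r : ℂ) • Matrix.diagonal (fun _ => P.unit ⊗ₜ[ℂ] Q.unit) ∈ maxGen P Q n := by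
  have h := tmul_mem_maxGen (n := n) (t := Q.unit) (hP.isPos_smul hr hP.isPos_unit)
    (by convert hQ.isPos_unit (ι := Unit) using 1; ext; simp)
  convert h using 1
  ext i j
  by_cases hij : i = j <;> simp [hij, TensorProduct.smul_tmul']

/-- With $h$ the self-adjoint matrix built from $s$, the identity is $h\otimes
t+rR\,(1\otimes1)=\tfrac12(r+h)\otimes(R+t)+\tfrac12(r-h)\otimes(R-t)$, where $r$ and $R$ are large
enough to make all four factors positive. -/
lemma exists_add_single_mem_maxGen (hP : P.IsOrdered) (hQ : Q.IsOrdered) {n : ℕ} (i j : Fin n)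
    (s : S) {t : T} (ht : star t = t) :
    ∃ r : ℝ, 0 < r ∧ Matrix.single i j (s ⊗ₜ[ℂ] t) + (Matrix.single i j (s ⊗ₜ[ℂ] t)).conjTranspose +
      (r : ℂ) • Matrix.diagonal (fun _ => P.unit ⊗ₜ[ℂ] Q.unit) ∈ maxGen P Q n := by
  obtain ⟨r, hr, h1, h2⟩ := hP.exists_isPos_add_sub
    (Matrix.isHermitian_add_transpose_self (Matrix.single i j s))
  obtain ⟨R, hR, h3, h4⟩ := hQ.exists_isPos_add_sub (X := .of fun _ _ : Unit => t)
    (by ext; simpa using ht)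
  have hh : (0 : ℝ) ≤ 1 / 2 := by norm_num
  have e1 := tmul_mem_maxGen (t := (R : ℂ) • Q.unit + t) (hP.isPos_smul hh h1)
    (by convert h3 using 1; ext; simp)
  have e2 := tmul_mem_maxGen (t := (R : ℂ) • Q.unit - t) (hP.isPos_smul hh h2)
    (by convert h4 using 1; ext; simp)
  refine ⟨r * R, by positivity, ?_⟩
  convert add_mem_maxGen hP hQ e1 e2 using 1
  ext a b
  have key : ∀ h d : S, (h ⊗ₜ[ℂ] t + ((r * R : ℝ) : ℂ) • (d ⊗ₜ[ℂ] Q.unit)) =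
      (((1 / 2 : ℝ) : ℂ) • ((r : ℂ) • d + h)) ⊗ₜ[ℂ] ((R : ℂ) • Q.unit + t) +
      (((1 / 2 : ℝ) : ℂ) • ((r : ℂ) • d - h)) ⊗ₜ[ℂ] ((R : ℂ) • Q.unit - t) := by
    intro h d
    simp only [TensorProduct.add_tmul, TensorProduct.tmul_add, TensorProduct.sub_tmul,
      TensorProduct.tmul_sub, ← TensorProduct.smul_tmul', TensorProduct.tmul_smul, smul_add,
      smul_sub]
    push_cast
    module
  have hd : (Matrix.diagonal fun _ : Fin n => P.unit ⊗ₜ[ℂ] Q.unit) a b =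
      (Matrix.diagonal fun _ : Fin n => P.unit) a b ⊗ₜ[ℂ] Q.unit := by
    by_cases hab : a = b <;> simp [hab]
  have hs : (Matrix.single i j (s ⊗ₜ[ℂ] t)) a b + star (Matrix.single i j (s ⊗ₜ[ℂ] t) b a) =
      ((Matrix.single i j s) a b + star (Matrix.single i j s b a)) ⊗ₜ[ℂ] t := by
    simp only [Matrix.single_apply, TensorProduct.add_tmul]
    split_ifs <;> simp [TensorProduct.star_tmul, ht]
  simp only [Matrix.add_apply, Matrix.smul_apply, Matrix.of_apply, Matrix.sub_apply,
    Matrix.conjTranspose_apply, hd, hs]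
  exact key _ _

lemma exists_add_conjTranspose_mem_maxGen (hP : P.IsOrdered) (hQ : Q.IsOrdered) {n : ℕ}
    (Z : Matrix (Fin n) (Fin n) (S ⊗[ℂ] T)) :
    ∃ r : ℝ, 0 < r ∧ Z + Z.conjTranspose +
      (r : ℂ) • Matrix.diagonal (fun _ => P.unit ⊗ₜ[ℂ] Q.unit) ∈ maxGen P Q n := by
  have hadd : ∀ Z Z' : Matrix (Fin n) (Fin n) (S ⊗[ℂ] T),
      (∃ r : ℝ, 0 < r ∧ Z + Z.conjTranspose +
        (r : ℂ) • Matrix.diagonal (fun _ => P.unit ⊗ₜ[ℂ] Q.unit) ∈ maxGen P Q n) →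
      (∃ r : ℝ, 0 < r ∧ Z' + Z'.conjTranspose +
        (r : ℂ) • Matrix.diagonal (fun _ => P.unit ⊗ₜ[ℂ] Q.unit) ∈ maxGen P Q n) →
      ∃ r : ℝ, 0 < r ∧ (Z + Z') + (Z + Z').conjTranspose +
        (r : ℂ) • Matrix.diagonal (fun _ => P.unit ⊗ₜ[ℂ] Q.unit) ∈ maxGen P Q n := by
    rintro Z Z' ⟨r, hr, h⟩ ⟨r', hr', h'⟩
    refine ⟨r + r', by positivity, ?_⟩
    convert add_mem_maxGen hP hQ h h' using 1
    rw [Matrix.conjTranspose_add, Complex.ofReal_add, add_smul]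
    abel
  have hzero : ∃ r : ℝ, 0 < r ∧ (0 : Matrix (Fin n) (Fin n) (S ⊗[ℂ] T)) +
      (0 : Matrix (Fin n) (Fin n) (S ⊗[ℂ] T)).conjTranspose +
        (r : ℂ) • Matrix.diagonal (fun _ => P.unit ⊗ₜ[ℂ] Q.unit) ∈ maxGen P Q n :=
    ⟨1, one_pos, by simpa using! unit_mem_maxGen hP hQ (r := 1) zero_le_one⟩
  induction Z using Matrix.induction_on' with
  | h_zero => exact hzero
  | h_add Z Z' h h' => exact hadd Z Z' h h'
  | h_std_basis i j z =>
    induction z using TensorProduct.induction_on with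
    | zero => simpa using hzero
    | add z z' h h' => rw [Matrix.single_add]; exact hadd _ _ h h'
    | tmul s t =>
      -- The second leg is made self-adjoint by splitting $t$ and moving the factor $i$ to the first
      -- leg.
      have e : s ⊗ₜ[ℂ] t = s ⊗ₜ[ℂ] (realPart t : T) + (Complex.I • s) ⊗ₜ[ℂ] (imaginaryPart t : T) := by
        conv_lhs => rw [← realPart_add_I_smul_imaginaryPart t]
        rw [TensorProduct.tmul_add, TensorProduct.smul_tmul]
      rw [e, Matrix.single_add]
      exact hadd _ _ (exists_add_single_mem_maxGen hP hQ i j s (realPart t).2)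
        (exists_add_single_mem_maxGen hP hQ i j _ (imaginaryPart t).2)

lemma isOrdered_maxGenOrder (hP : P.IsOrdered) (hQ : Q.IsOrdered) :
    (maxGenOrder P Q).IsOrdered where
  isHermitian_of_mem := by
    rintro n _ ⟨k, m, X, Y, A, hX, hY, rfl⟩
    rw [Matrix.IsHermitian, scalarConj_conjTranspose]
    congr 1
    ext i j
    have h1 := congrFun (congrFun (hP.isHermitian_of_mem hX) i.1) j.1
    have h2 := congrFun (congrFun (hQ.isHermitian_of_mem hY) i.2) j.2
    rw [Matrix.conjTranspose_apply] at h1 h2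
    simp [TensorProduct.star_tmul, h1, h2]
  add_mem := add_mem_maxGen hP hQ
  conj_mem := by
    rintro n m _ B ⟨k, m', X, Y, A, hX, hY, rfl⟩
    exact ⟨k, m', X, Y, B * A, hX, hY, scalarConj_scalarConj _ _ _⟩
  star_unit := by
    change star (P.unit ⊗ₜ[ℂ] Q.unit) = _
    rw [TensorProduct.star_tmul, hP.star_unit, hQ.star_unit]
    rfl
  exists_add_mem := by
    intro n X hX
    -- For Hermitian $X$, the matrix $\tfrac12X$ plus its adjoint is $X$ itself.
    obtain ⟨r, hr, h⟩ := exists_add_conjTranspose_mem_maxGen hP hQ (((1 / 2 : ℝ) : ℂ) • X)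
    refine ⟨r, hr, ?_⟩
    change _ ∈ maxGen P Q n
    convert h using 1
    rw [Matrix.conjTranspose_smul, hX.eq, ← add_smul, Complex.star_def, Complex.conj_ofReal,
      ← Complex.ofReal_add, add_halves, Complex.ofReal_one, one_smul]
    rfl

end MatrixOrder

/-! ### Separation from the Archimedean closure of a matrix ordering -/

namespace MatrixOrder

lemma IsOrdered.cone_smul_mem {T : Type*} [AddCommGroup T] [Module ℂ T] [StarAddMonoid T]
    {R : MatrixOrder T} (hR : R.IsOrdered) {p : ℕ} {X : Matrix (Fin p) (Fin p) T}
    (hX : X ∈ R.cone p) {t : ℝ} (ht : 0 ≤ t) : (t : ℂ) • X ∈ R.cone p :=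
  (hR.isPos_smul ht (hR.isPos_of_mem hX)).mem

/-- A self-adjoint matrix which is not in the Archimedean closure of a matrix ordering is separated
from it by a positive functional. -/
theorem IsOrdered.exists_separating {T : Type*} [AddCommGroup T] [Module ℂ T] [StarAddMonoid T]
    [StarModule ℂ T] {R : MatrixOrder T} (hR : R.IsOrdered) {p : ℕ}
    {X : Matrix (Fin p) (Fin p) T} (hX : X.IsHermitian) {ε : ℝ} (hε : 0 < ε)
    (hXε : X + (ε : ℂ) • Matrix.diagonal (fun _ => R.unit) ∉ R.cone p) :
    ∃ f : Matrix (Fin p) (Fin p) T →ₗ[ℂ] ℂ, (∀ Z, f Z.conjTranspose = conj (f Z)) ∧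
      (∀ Z ∈ R.cone p, 0 ≤ (f Z).re) ∧ (f X).re < 0 := by
  set D : Matrix (Fin p) (Fin p) T := Matrix.diagonal (fun _ => R.unit) with hD
  have hDpos : D ∈ R.cone p := hR.isPos_unit.mem
  have hDH : D.conjTranspose = D := hR.isHermitian_of_mem hDpos
  have hzero : (0 : Matrix (Fin p) (Fin p) T) ∈ R.cone p := hR.isPos_zero.mem
  obtain ⟨r, hr, hXr⟩ := hR.exists_add_mem hX
  rw [← hD] at hXr
  have hD0 : D ≠ 0 := by
    intro h
    rw [h, smul_zero, add_zero] at hXr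
    rw [h, smul_zero, add_zero] at hXε
    exact hXε hXr
  obtain ⟨F, hF⟩ : ∃ F : Matrix (Fin p) (Fin p) T →ₗ[ℂ] ℂ, F D = 1 := by
    have h := (Module.forall_dual_apply_eq_zero_iff ℂ D).not.2 hD0
    push Not at h
    obtain ⟨φ, hφ⟩ := h
    exact ⟨(φ D)⁻¹ • φ, by simp [hφ]⟩
  -- The cone is enlarged by the ray through $-W$. A functional positive on the larger cone with
  -- value 1 at $D$ satisfies $f(W)\le0$, that is $f(X)\le-\varepsilon/2$. Half of $\varepsilon$ is
  -- spent here to make the inequality strict.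
  set W := X + ((ε / 2 : ℝ) : ℂ) • D with hW
  have hWH : W.conjTranspose = W := by
    rw [hW, Matrix.conjTranspose_add, Matrix.conjTranspose_smul, hX.eq, hDH, Complex.star_def,
      Complex.conj_ofReal]
  let J : Matrix (Fin p) (Fin p) T →ₛₗ[starRingEnd ℂ] Matrix (Fin p) (Fin p) T :=
    { toFun := Matrix.conjTranspose
      map_add' := Matrix.conjTranspose_add
      map_smul' := fun c Z => Matrix.conjTranspose_smul c Z }
  have hJ : ∀ Z, J Z = Z.conjTranspose := fun _ => rfl
  obtain ⟨G, hG, hGJ, hGpos⟩ := exists_positive_extension J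
    (fun Z => Matrix.conjTranspose_conjTranspose Z)
    {Z | ∃ t : ℝ, 0 ≤ t ∧ Z + (t : ℂ) • W ∈ R.cone p}
    ⟨0, le_rfl, by simpa using hzero⟩
    (by
      rintro Z ⟨t, ht, hZ⟩ Z' ⟨t', ht', hZ'⟩
      refine ⟨t + t', by positivity, ?_⟩
      convert hR.add_mem hZ hZ' using 1
      rw [Complex.ofReal_add, add_smul]; abel)
    (by
      rintro c hc Z ⟨t, ht, hZ⟩
      refine ⟨c * t, by positivity, ?_⟩
      convert hR.cone_smul_mem hZ hc using 1
      rw [smul_add (c : ℂ) Z, Complex.ofReal_mul, mul_smul])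
    (by
      rintro Z ⟨t, ht, hZ⟩
      have h := hR.isHermitian_of_mem hZ
      rw [Matrix.IsHermitian, Matrix.conjTranspose_add, Matrix.conjTranspose_smul, hWH,
        Complex.star_def, Complex.conj_ofReal] at h
      exact add_right_cancel h)
    (Submodule.span ℂ {D})
    (by
      intro Z hZ
      obtain ⟨c, rfl⟩ := Submodule.mem_span_singleton.1 hZ
      rw [LinearMap.map_smulₛₗ, hJ, hDH]
      exact Submodule.smul_mem _ _ (Submodule.mem_span_singleton_self D)) F
    (by
      intro Z hZ
      obtain ⟨c, rfl⟩ := Submodule.mem_span_singleton.1 hZ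
      rw [LinearMap.map_smulₛₗ, hJ, hDH]
      simp [hF])
    (by
      rintro Z hZ ⟨t, ht, h⟩
      obtain ⟨c, rfl⟩ := Submodule.mem_span_singleton.1 hZ
      have hc : conj c = c := by
        have h1 := hR.isHermitian_of_mem h
        rw [Matrix.IsHermitian, Matrix.conjTranspose_add, Matrix.conjTranspose_smul,
          Matrix.conjTranspose_smul, hWH, hDH, Complex.star_def,
          Complex.conj_ofReal] at h1
        exact smul_left_injective ℂ hD0 (add_right_cancel h1)
      obtain ⟨d, rfl⟩ := Complex.conj_eq_iff_real.1 hc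
      rw [map_smul, hF, smul_eq_mul, mul_one, Complex.ofReal_re]
      by_contra hd
      push Not at hd
      -- If $dD$ with $d<0$ were in the enlarged cone, so $dD+tW$ in the original one, then $M=-r/d$
      -- cancels the $rD$ in $X+rD$. Adding the multiple $\varepsilon+Mt\varepsilon/2$ of $D$ yields
      -- $(1+Mt)(X+\varepsilon D)$ in the cone, a contradiction.
      have hM : 0 < -(r / d) := by
        rw [neg_pos]; exact div_neg_of_pos_of_neg hr hd
      set M := -(r / d) with hMd
      have hMt : 0 < 1 + M * t := by positivity
      have hMne : (1 + M * t) ≠ 0 := hMt.ne'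
      have h2 := hR.cone_smul_mem (hR.add_mem (hR.add_mem hXr (hR.cone_smul_mem h hM.le))
        (hR.cone_smul_mem hDpos (show 0 ≤ ε + M * t * (ε / 2) by positivity)))
        (inv_nonneg.2 hMt.le)
      refine hXε ?_
      convert h2 using 1
      rw [hW]
      have e1 : M * d = -r := by rw [hMd, neg_mul, div_mul_cancel₀ _ hd.ne]
      have e2 : ((M : ℝ) : ℂ) * (d : ℂ) = -r := by exact_mod_cast e1
      have e3 : X + (ε : ℂ) • D = (((1 + M * t)⁻¹ : ℝ) : ℂ) • (((1 + M * t : ℝ) : ℂ) •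
          (X + (ε : ℂ) • D)) := by
        rw [smul_smul, ← Complex.ofReal_mul, inv_mul_cancel₀ hMne, Complex.ofReal_one, one_smul]
      rw [e3]
      congr 1
      simp only [smul_add, smul_smul, e2]
      push_cast
      module)
    (by
      intro Y hY
      obtain ⟨s, hs, h⟩ := hR.exists_add_mem (X := Y) hY
      refine ⟨(s : ℂ) • D, Submodule.smul_mem _ _ (Submodule.mem_span_singleton_self D), ?_,
        0, le_rfl, ?_⟩
      · rw [LinearMap.map_smulₛₗ, hJ, hDH, Complex.conj_ofReal]
      · rw [Complex.ofReal_zero, zero_smul, add_zero, add_comm]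
        exact h)
  refine ⟨G, hGJ, fun Z hZ => hGpos Z ⟨0, le_rfl, by simpa using hZ⟩, ?_⟩
  have h1 := hGpos (-W) ⟨1, zero_le_one, by simpa using hzero⟩
  have h2 := hG D (Submodule.mem_span_singleton_self D)
  rw [hW, map_neg, map_add, map_smul, h2, hF] at h1
  simp at h1
  linarith

end MatrixOrder

/-! ### Hilbert spaces from positive families of forms -/

/-- The determinant inequality for a positive `2 × 2` form. -/
lemma norm_sq_le_of_form_nonneg {a b : ℝ} {z : ℂ}
    (h : ∀ (t : ℝ) (d : ℂ), ‖d‖ ≤ 1 → 0 ≤ a * (t * t) + 2 * t * (d * z).re + b) :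
    ‖z‖ ^ 2 ≤ a * b := by
  have h1 : ∃ d : ℂ, ‖d‖ ≤ 1 ∧ (d * z).re = ‖z‖ := by
    -- The phase that rotates $z$ to $|z|$. For $z=0$ division by zero makes it $0$, which is still
    -- admissible.
    refine ⟨conj z / ‖z‖, ?_, ?_⟩
    · rw [norm_div, Complex.norm_conj, Complex.norm_real, norm_norm]
      exact div_self_le_one _
    · rw [div_mul_eq_mul_div, mul_comm, Complex.mul_conj, Complex.normSq_eq_norm_sq,
        ← Complex.ofReal_div, Complex.ofReal_re, pow_two, mul_self_div_self]
  obtain ⟨d, hd, hdz⟩ := h1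
  have h2 : discrim a (2 * ‖z‖) b ≤ 0 := discrim_le_zero fun t => by
    have := h t d hd
    rw [hdz] at this
    linarith
  rw [discrim] at h2
  nlinarith

section Completion

open UniformSpace

open scoped InnerProductSpace

variable {E : Type*} [SeminormedAddCommGroup E] [InnerProductSpace ℂ E]

lemma Completion.eq_of_inner {h h' : Completion E}
    (H : ∀ x : E, ⟪(x : Completion E), h⟫_ℂ = ⟪(x : Completion E), h'⟫_ℂ) :
    h = h' := by
  refine ext_inner_left ℂ fun v => ?_
  induction v using Completion.induction_on with
  | hp => exact isClosed_eq (by fun_prop) (by fun_prop)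
  | ih x => exact H x

lemma Completion.clm_ext {T T' : Completion E →L[ℂ] Completion E}
    (H : ∀ x y : E, ⟪(x : Completion E), T y⟫_ℂ = ⟪(x : Completion E), T' y⟫_ℂ) : T = T' := by
  ext v
  induction v using Completion.induction_on with
  | hp => exact isClosed_eq (by fun_prop) (by fun_prop)
  | ih y => exact Completion.eq_of_inner fun x => H x y

/-- A bounded form on a pre-Hilbert space is given by an operator on the completion. -/
lemma Completion.exists_operator (β : E →ₗ⋆[ℂ] E →ₗ[ℂ] ℂ) (C : ℝ) (hC : 0 ≤ C)
    (h : ∀ x y, ‖β x y‖ ≤ C * ‖x‖ * ‖y‖) :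
    ∃ T : Completion E →L[ℂ] Completion E, ∀ x y : E, ⟪(x : Completion E), T y⟫_ℂ = β x y := by
  have hd : DenseRange (Completion.toComplL : E →L[ℂ] Completion E) := Completion.denseRange_coe
  have hu : IsUniformInducing (Completion.toComplL : E →L[ℂ] Completion E) :=
    Completion.isUniformInducing_coe E
  -- Riesz representation in the first variable for each fixed $y$; the resulting bounded linear map
  -- of $y$ is then extended by density.
  have h1 : ∀ y : E, ∃ v : Completion E, ‖v‖ ≤ C * ‖y‖ ∧
      ∀ x : E, ⟪(x : Completion E), v⟫_ℂ = β x y := by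
    intro y
    let l : E →L[ℂ] ℂ := LinearMap.mkContinuous
      { toFun := fun x => conj (β x y)
        map_add' := by simp
        map_smul' := by simp } (C * ‖y‖) (fun x => by
          have := h x y
          simp only [LinearMap.coe_mk, AddHom.coe_mk, Complex.norm_conj]
          linarith)
    let L : Completion E →L[ℂ] ℂ := l.extend Completion.toComplL
    have hL : ∀ x : E, L x = conj (β x y) := fun x => l.extend_eq hd hu x
    have hv : ∀ x : E, ⟪(x : Completion E), (InnerProductSpace.toDual ℂ _).symm L⟫_ℂ = β x y := by
      intro x
      rw [← inner_conj_symm, InnerProductSpace.toDual_symm_apply, hL, Complex.conj_conj]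
    refine ⟨(InnerProductSpace.toDual ℂ _).symm L, ?_, hv⟩
    rw [LinearIsometryEquiv.norm_map]
    refine ContinuousLinearMap.opNorm_le_bound _ (by positivity) fun x => ?_
    induction x using Completion.induction_on with
    | hp => exact isClosed_le (by fun_prop) (by fun_prop)
    | ih x =>
      rw [hL, Complex.norm_conj, Completion.norm_coe]
      have := h x y
      linarith
  choose v hv hv' using h1
  let t : E →L[ℂ] Completion E := LinearMap.mkContinuous
    { toFun := v
      map_add' := fun y y' => Completion.eq_of_inner fun x => by
        rw [inner_add_right, hv', hv', hv', map_add]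
      map_smul' := fun c y => Completion.eq_of_inner fun x => by
        rw [inner_smul_right, hv', hv', map_smul]; rfl } C hv
  exact ⟨t.extend Completion.toComplL, fun x y => by
    rw [show t.extend Completion.toComplL (y : Completion E) = t y from t.extend_eq hd hu y]
    exact hv' y x⟩

end Completion

/-- The inequality $a^*a\le\|a\|^2$ becomes an algebraic identity, which can be carried through maps
known only to be positive on squares; boundedness results from it. -/
lemma CStarAlgebra.exists_star_mul_self_add {A : Type*} [CStarAlgebra A] (a : A) :
    ∃ d : A, star a * a + star d * d = algebraMap ℂ A ((‖a‖ ^ 2 : ℝ) : ℂ) := by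
  let _ := CStarAlgebra.spectralOrder A
  let _ := CStarAlgebra.spectralOrderedRing A
  have h : star a * a ≤ algebraMap ℝ A (‖a‖ ^ 2) := CStarAlgebra.star_mul_le_algebraMap_norm_sq
  obtain ⟨d, hd⟩ := CStarAlgebra.nonneg_iff_eq_star_mul_self.1 (sub_nonneg.2 h)
  refine ⟨d, ?_⟩
  rw [← hd, add_sub_cancel]
  rw [Algebra.algebraMap_eq_smul_one, Algebra.algebraMap_eq_smul_one, Complex.coe_smul]

section Representation

open UniformSpace

open scoped InnerProductSpace

variable {A : Type*} [CStarAlgebra A] {S : Type*} [AddCommGroup S] [Module ℂ S] [StarAddMonoid S]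
  [StarModule ℂ S] {Q : MatrixOrder S} {E : Type*} [SeminormedAddCommGroup E]
  [InnerProductSpace ℂ E]

/-- Evaluate the positive matrix $[r,s;s^*,r]$ at the vectors $tx$ and $dy$ with $t$ real and
$|d|\le1$: the determinant inequality gives $|\beta_s(x,y)|\le r\|x\|\|y\|$, with $r$ depending on
$s$ only. -/
lemma norm_form_le (hQ : Q.IsOrdered) (β : S →ₗ[ℂ] E →ₗ⋆[ℂ] E →ₗ[ℂ] ℂ)
    (hunit : ∀ x y, β Q.unit x y = ⟪x, y⟫_ℂ) (hstar : ∀ s x y, β (star s) y x = conj (β s x y))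
    (hpos : ∀ (n : ℕ) (X : Matrix (Fin n) (Fin n) S) (x : Fin n → E), X ∈ Q.cone n →
      0 ≤ (∑ i, ∑ j, β (X i j) (x i) (x j)).re) (s : S) :
    ∃ C : ℝ, 0 ≤ C ∧ ∀ x y, ‖β s x y‖ ≤ C * ‖x‖ * ‖y‖ := by
  obtain ⟨r, hr, h⟩ := hQ.exists_two_isPos s
  refine ⟨r, hr.le, fun x y => ?_⟩
  have key : ‖β s x y‖ ^ 2 ≤ (r * ‖x‖ ^ 2) * (r * ‖y‖ ^ 2) := by
    refine norm_sq_le_of_form_nonneg fun t d hd => ?_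
    have h1 := hpos 2 _ ![(t : ℂ) • x, d • y] h.mem
    have e1 : ∀ z : E, β Q.unit z z = ((‖z‖ ^ 2 : ℝ) : ℂ) := fun z => by
      rw [hunit, inner_self_eq_norm_sq_to_K]; simp
    simp only [Fin.sum_univ_two, Matrix.of_apply, Matrix.cons_val_zero, Matrix.cons_val_one,
      Matrix.cons_val', map_smul, LinearMap.smul_apply, e1, LinearMap.map_smulₛₗ, hstar,
      Matrix.cons_val_fin_one, smul_eq_mul, Complex.conj_ofReal] at h1
    have e2 : (↑r * (↑t * (↑t * ((‖x‖ ^ 2 : ℝ) : ℂ))) + d * (↑t * β s x y) +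
        (↑t * (conj d * conj (β s x y)) + ↑r * (d * (conj d * ((‖y‖ ^ 2 : ℝ) : ℂ)))) : ℂ).re =
        r * ‖x‖ ^ 2 * (t * t) + 2 * t * (d * β s x y).re + ‖d‖ ^ 2 * (r * ‖y‖ ^ 2) := by
      have e3 : d * conj d = ((‖d‖ ^ 2 : ℝ) : ℂ) := by
        rw [Complex.mul_conj, Complex.normSq_eq_norm_sq]
      have e4 : conj d * conj (β s x y) = conj (d * β s x y) := by rw [map_mul]
      have e5 : (↑r * (↑t * (↑t * ((‖x‖ ^ 2 : ℝ) : ℂ))) + d * (↑t * β s x y) +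
        (↑t * (conj d * conj (β s x y)) + ↑r * (d * (conj d * ((‖y‖ ^ 2 : ℝ) : ℂ)))) : ℂ) =
        ((r * t * t * ‖x‖ ^ 2 : ℝ) : ℂ) + (t : ℂ) * (d * β s x y) +
        ((t : ℂ) * conj (d * β s x y) + ((‖d‖ ^ 2 * (r * ‖y‖ ^ 2) : ℝ) : ℂ)) := by
        rw [e4, ← mul_assoc d (conj d), e3]; push_cast; ring
      rw [e5]
      simp only [Complex.add_re, Complex.ofReal_re, Complex.re_ofReal_mul, Complex.conj_re]
      ring
    have e6 : ‖d‖ ^ 2 * (r * ‖y‖ ^ 2) ≤ r * ‖y‖ ^ 2 :=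
      mul_le_of_le_one_left (by positivity) (pow_le_one₀ (norm_nonneg d) hd)
    have e7 : r * ‖x‖ ^ 2 * (t * t) + 2 * t * (d * β s x y).re + ‖d‖ ^ 2 * (r * ‖y‖ ^ 2) ≥ 0 := by
      rw [← e2]
      convert h1 using 2
      ring
    linarith
  have h2 : ‖β s x y‖ ^ 2 ≤ (r * ‖x‖ * ‖y‖) ^ 2 := by
    calc _ ≤ _ := key
      _ = _ := by ring
  exact (sq_le_sq₀ (norm_nonneg _) (by positivity)).1 h2

/-- A pre-Hilbert space with an action of a `C*`-algebra `A` and a completely positive family of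
forms over an ordered space `S`, compatible with the action, gives commuting representations of
`A` and `S` on the completion. -/
theorem exists_commuting_representation (hQ : Q.IsOrdered) (ρ : A →ₐ[ℂ] Module.End ℂ E)
    (β : S →ₗ[ℂ] E →ₗ⋆[ℂ] E →ₗ[ℂ] ℂ)
    (hunit : ∀ x y, β Q.unit x y = ⟪x, y⟫_ℂ) (hstar : ∀ s x y, β (star s) y x = conj (β s x y))
    (hρ : ∀ s a x y, β s (ρ a x) y = β s x (ρ (star a) y))
    (hpos : ∀ (n : ℕ) (X : Matrix (Fin n) (Fin n) S) (x : Fin n → E), X ∈ Q.cone n →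
      0 ≤ (∑ i, ∑ j, β (X i j) (x i) (x j)).re) :
    ∃ (π : A →⋆ₐ[ℂ] (Completion E →L[ℂ] Completion E))
      (ψ : S →ₗ[ℂ] (Completion E →L[ℂ] Completion E)),
      (∀ a (x : E), π a x = (ρ a x : E)) ∧ (∀ s (x y : E), ⟪(x : Completion E), ψ s y⟫_ℂ = β s x y) ∧
      ψ Q.unit = 1 ∧ (∀ s, ψ (star s) = star (ψ s)) ∧ (∀ a s, Commute (π a) (ψ s)) ∧
      ∀ (n : ℕ) (X : Matrix (Fin n) (Fin n) S) (x : Fin n → Completion E), X ∈ Q.cone n →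
        0 ≤ (∑ i, ∑ j, ⟪x i, ψ (X i j) (x j)⟫_ℂ).re := by
  have hρ' : ∀ a (x y : E), ⟪ρ a x, y⟫_ℂ = ⟪x, ρ (star a) y⟫_ℂ := fun a x y => by
    rw [← hunit, ← hunit, hρ]
  -- From $a^*a+d^*d=\|a\|^2$ one gets $\|\rho(a)x\|^2+\|\rho(d)x\|^2=\|a\|^2\|x\|^2$.
  have hbd : ∀ a x, ‖ρ a x‖ ≤ ‖a‖ * ‖x‖ := by
    intro a x
    obtain ⟨d, hd⟩ := CStarAlgebra.exists_star_mul_self_add a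
    have h1 : ∀ b, ⟪ρ b x, ρ b x⟫_ℂ = ⟪x, ρ (star b * b) x⟫_ℂ := fun b => by
      rw [hρ', map_mul]; rfl
    have h2 : ⟪ρ a x, ρ a x⟫_ℂ + ⟪ρ d x, ρ d x⟫_ℂ = ((‖a‖ ^ 2 : ℝ) : ℂ) * ⟪x, x⟫_ℂ := by
      rw [h1, h1, ← inner_add_right, ← LinearMap.add_apply, ← map_add, hd, AlgHom.commutes,
        Module.algebraMap_end_apply, inner_smul_right]
    simp only [inner_self_eq_norm_sq_to_K] at h2
    have h3 : ‖ρ a x‖ ^ 2 + ‖ρ d x‖ ^ 2 = ‖a‖ ^ 2 * ‖x‖ ^ 2 :=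
      Complex.ofReal_injective (by push_cast; simpa using h2)
    refine (sq_le_sq₀ (norm_nonneg _) (by positivity)).1 ?_
    nlinarith [sq_nonneg ‖ρ d x‖]
  let R : A → E →L[ℂ] E := fun a => (ρ a).mkContinuous ‖a‖ (hbd a)
  have hR : ∀ a x, R a x = ρ a x := fun _ _ => rfl
  have hRc : ∀ a (x : E), (R a).completion (x : Completion E) = (ρ a x : E) := fun a x => by
    rw [ContinuousLinearMap.completion_apply_coe, hR]
  let π : A →⋆ₐ[ℂ] (Completion E →L[ℂ] Completion E) :=
    { toFun := fun a => (R a).completion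
      map_one' := Completion.clm_ext fun x y => by simp [hRc]
      map_mul' := fun a b => Completion.clm_ext fun x y => by simp [hRc]
      map_zero' := Completion.clm_ext fun x y => by simp [hRc]
      map_add' := fun a b => Completion.clm_ext fun x y => by
        simp [hRc, Completion.coe_add]
      commutes' := fun c => Completion.clm_ext fun x y => by
        simp [hRc, Algebra.algebraMap_eq_smul_one,
          Completion.coe_smul]
      map_star' := fun a => Completion.clm_ext fun x y => by
        rw [ContinuousLinearMap.star_eq_adjoint, ContinuousLinearMap.adjoint_inner_right, hRc, hRc,
          Completion.inner_coe, Completion.inner_coe, hρ'] }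
  have hπ : ∀ a (x : E), π a x = (ρ a x : E) := hRc
  have hex : ∀ s, ∃ T : Completion E →L[ℂ] Completion E,
      ∀ x y : E, ⟪(x : Completion E), T y⟫_ℂ = β s x y := fun s => by
    obtain ⟨C, hC, h⟩ := norm_form_le hQ β hunit hstar hpos s
    exact Completion.exists_operator (β s) C hC h
  choose T hT using hex
  let ψ : S →ₗ[ℂ] (Completion E →L[ℂ] Completion E) :=
    { toFun := T
      map_add' := fun s t => Completion.clm_ext fun x y => by
        simp [inner_add_right, hT]
      map_smul' := fun c s => Completion.clm_ext fun x y => by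
        simp [inner_smul_right, hT] }
  have hψ : ∀ s (x y : E), ⟪(x : Completion E), ψ s y⟫_ℂ = β s x y := hT
  refine ⟨π, ψ, hπ, hψ, Completion.clm_ext fun x y => ?_,
    fun s => Completion.clm_ext fun x y => ?_, fun a s => Completion.clm_ext fun x y => ?_,
    fun n X x hX => ?_⟩
  · rw [hψ, hunit]; simp
  · rw [ContinuousLinearMap.star_eq_adjoint, ContinuousLinearMap.adjoint_inner_right,
      ← inner_conj_symm (ψ s x : Completion E), hψ, hψ, hstar]
  · have h1 : ⟪(x : Completion E), π a (ψ s y)⟫_ℂ = ⟪π (star a) x, ψ s y⟫_ℂ := by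
      rw [map_star, ContinuousLinearMap.star_eq_adjoint, ContinuousLinearMap.adjoint_inner_left]
    calc ⟪(x : Completion E), (π a * ψ s) y⟫_ℂ = ⟪π (star a) x, ψ s y⟫_ℂ := h1
      _ = β s (ρ (star a) x) y := by rw [hπ, hψ]
      _ = β s x (ρ a y) := by rw [hρ, star_star]
      _ = ⟪(x : Completion E), ψ s (π a y)⟫_ℂ := by rw [hπ, hψ]
  · have hcl : IsClosed {x : Fin n → Completion E | 0 ≤ (∑ i, ∑ j, ⟪x i, ψ (X i j) (x j)⟫_ℂ).re} :=
      isClosed_le continuous_const (Complex.continuous_re.comp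
        (continuous_finsetSum _ fun i _ => continuous_finsetSum _ fun j _ => by fun_prop))
    have hdense : DenseRange (fun (x : Fin n → E) (i : Fin n) => (x i : Completion E)) :=
      DenseRange.piMap fun _ => Completion.denseRange_coe
    refine hdense.induction_on (p := fun x => 0 ≤ (∑ i, ∑ j, ⟪x i, ψ (X i j) (x j)⟫_ℂ).re) x hcl
      fun x => ?_
    simp only [hψ]
    exact hpos n X x hX

end Representation

/-- The negative part of a self-adjoint element, as a witness for the failure of positivity. -/
lemma CStarAlgebra.exists_compression_eq_neg {A : Type*} [CStarAlgebra A] [PartialOrder A]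
    [StarOrderedRing A] {a : A} (ha : IsSelfAdjoint a) :
    ∃ b c : A, star b = b ∧ b * a * b = -(star c * c) ∧ (c = 0 → 0 ≤ a) := by
  have hN0 : 0 ≤ a⁻ := CFC.negPart_nonneg a
  have hNs : star a⁻ = a⁻ := (IsSelfAdjoint.of_nonneg hN0).star_eq
  obtain ⟨y, hy⟩ := CStarAlgebra.nonneg_iff_eq_star_mul_self.1 hN0
  -- Compressing by the negative part gives $a^-aa^-=-(a^-)^3$, and $c=ya^-$ with $y^*y=a^-$ is a
  -- root of the cube. If $c=0$ then $(a^-)^2=y^*c=0$.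
  refine ⟨a⁻, y * a⁻, hNs, ?_, fun h => ?_⟩
  · have e : star (y * a⁻) * (y * a⁻) = a⁻ * (star y * y) * a⁻ := by
      rw [star_mul, hNs]; simp only [mul_assoc]
    rw [e, ← hy]
    conv_lhs => enter [1, 2]; rw [← CFC.posPart_sub_negPart a ha]
    rw [mul_sub, CFC.negPart_mul_posPart, zero_sub, neg_mul]
  · have h1 : a⁻ * a⁻ = 0 := by
      calc a⁻ * a⁻ = star y * (y * a⁻) := by rw [← mul_assoc, ← hy]
        _ = 0 := by rw [h, mul_zero]
    have h2 : a⁻ = 0 := by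
      rw [← CStarRing.star_mul_self_eq_zero_iff, hNs, h1]
    rw [← CFC.posPart_sub_negPart a ha, h2, sub_zero]
    exact CFC.posPart_nonneg a

/-! ### Matrices of operators and their quadratic forms -/

section OperatorMatrix

open scoped InnerProductSpace

variable {H : Type*} [NormedAddCommGroup H] [InnerProductSpace ℂ H] [CompleteSpace H]

/-- A matrix of operators acting on a vector. -/
def opVec {ι κ : Type*} [Fintype κ] (Y : Matrix ι κ (H →L[ℂ] H)) (x : κ → H) : ι → H :=
  fun i => ∑ j, Y i j (x j)

lemma opVec_mul {ι κ μ : Type*} [Fintype κ] [Fintype μ] (Y : Matrix ι κ (H →L[ℂ] H))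
    (Z : Matrix κ μ (H →L[ℂ] H)) (x : μ → H) : opVec (Y * Z) x = opVec Y (opVec Z x) := by
  ext i
  simp only [opVec, Matrix.mul_apply, _root_.sum_apply, map_sum]
  exact Finset.sum_comm

lemma sum_inner_opVec_conjTranspose {ι κ : Type*} [Fintype κ] [Fintype ι]
    (Y : Matrix ι κ (H →L[ℂ] H)) (x : κ → H) (y : ι → H) :
    ∑ i, ⟪x i, opVec Y.conjTranspose y i⟫_ℂ = ∑ i, ⟪opVec Y x i, y i⟫_ℂ := by
  simp only [opVec, Matrix.conjTranspose_apply, ContinuousLinearMap.star_eq_adjoint, sum_inner,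
    inner_sum, ContinuousLinearMap.adjoint_inner_right]
  exact Finset.sum_comm

lemma sum_inner_opVec_star_mul_self {ι κ : Type*} [Fintype κ] [Fintype ι]
    (Y : Matrix ι κ (H →L[ℂ] H)) (x : κ → H) :
    ∑ i, ⟪x i, opVec (Y.conjTranspose * Y) x i⟫_ℂ = ((∑ i, ‖opVec Y x i‖ ^ 2 : ℝ) : ℂ) := by
  rw [opVec_mul, sum_inner_opVec_conjTranspose]
  push_cast
  exact Finset.sum_congr rfl fun i _ => by rw [inner_self_eq_norm_sq_to_K]; rfl

lemma eq_zero_of_opVec_eq_zero {ι κ : Type*} [Fintype κ] {Y : Matrix ι κ (H →L[ℂ] H)}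
    (h : ∀ x, opVec Y x = 0) : Y = 0 := by
  classical
  ext i j v
  have := congrFun (h (Pi.single j v)) i
  rw [opVec, Finset.sum_eq_single j] at this
  · simpa using this
  · intro k _ hk
    rw [Pi.single_eq_of_ne hk, map_zero]
  · simp

lemma form_nonneg_of_mem_cone {n : ℕ} {X : Matrix (Fin n) (Fin n) (H →L[ℂ] H)}
    (hX : X ∈ (MatrixOrder.ofStarRing (H →L[ℂ] H)).cone n) (x : Fin n → H) :
    0 ≤ (∑ i, ∑ j, ⟪x i, X i j (x j)⟫_ℂ).re := by
  obtain ⟨Y, rfl⟩ := hX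
  have h := sum_inner_opVec_star_mul_self Y x
  simp only [opVec, inner_sum] at h
  rw [h, Complex.ofReal_re]
  positivity

/-- A self-adjoint matrix of operators with positive quadratic form is positive. -/
lemma mem_cone_of_form_nonneg {n : ℕ} {X : Matrix (Fin n) (Fin n) (H →L[ℂ] H)}
    (hX : X.IsHermitian) (h : ∀ x : Fin n → H, 0 ≤ (∑ i, ∑ j, ⟪x i, X i j (x j)⟫_ℂ).re) :
    X ∈ (MatrixOrder.ofStarRing (H →L[ℂ] H)).cone n := by
  let _ := CStarAlgebra.spectralOrder (H →L[ℂ] H)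
  let _ := CStarAlgebra.spectralOrderedRing (H →L[ℂ] H)
  let M : CStarMatrix (Fin n) (Fin n) (H →L[ℂ] H) := CStarMatrix.ofMatrix X
  have hM : IsSelfAdjoint M := hX
  refine OperatorSystem.mem_cone_iff.2 ?_
  change 0 ≤ M
  -- The negative part is taken inside the $C^*$-algebra of matrices over $B(H)$, so no
  -- identification with $B(H^n)$ is needed. The form of $X$ at $Bx$ is $-\|Cx\|^2$, which
  -- positivity forces to vanish.
  obtain ⟨B, C, hB', hBC', hC⟩ : ∃ B C : Matrix (Fin n) (Fin n) (H →L[ℂ] H),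
      B.conjTranspose = B ∧ B * X * B = -(C.conjTranspose * C) ∧ (C = 0 → 0 ≤ M) :=
    CStarAlgebra.exists_compression_eq_neg hM
  refine hC ?_
  refine eq_zero_of_opVec_eq_zero fun x => ?_
  have h3 := h (opVec B x)
  have h5 : ∑ i, ∑ j, ⟪opVec B x i, X i j (opVec B x j)⟫_ℂ =
      -((∑ i, ‖opVec C x i‖ ^ 2 : ℝ) : ℂ) := by
    calc _ = ∑ i, ⟪opVec B x i, opVec X (opVec B x) i⟫_ℂ := by simp only [opVec, inner_sum]
      _ = ∑ i, ⟪x i, opVec (B * X * B) x i⟫_ℂ := by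
        rw [← sum_inner_opVec_conjTranspose, hB', ← opVec_mul, ← opVec_mul, Matrix.mul_assoc]
      _ = _ := by
        rw [hBC', ← sum_inner_opVec_star_mul_self]
        simp [opVec, inner_sum]
  rw [h5, Complex.neg_re, Complex.ofReal_re] at h3
  have h6 : ∑ i, ‖opVec C x i‖ ^ 2 = 0 :=
    le_antisymm (by linarith) (Finset.sum_nonneg fun i _ => by positivity)
  ext i
  have := (Finset.sum_eq_zero_iff_of_nonneg fun i _ => by positivity).1 h6 i (Finset.mem_univ i)
  simpa using this

end OperatorMatrix

/-! ### GNS construction for the maximal tensor product with a $C^*$-algebra -/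

noncomputable section

universe u v

lemma OperatorSystem.isPos_conjTranspose_mul_self {A : Type*} [CStarAlgebra A] {ι κ : Type*}
    [Fintype κ] (Z : Matrix κ ι A) :
    (OperatorSystem.ofCStarAlgebra A).IsPos (Z.conjTranspose * Z) := fun n f => by
  let _ := CStarAlgebra.spectralOrder A
  let _ := CStarAlgebra.spectralOrderedRing A
  exact OperatorSystem.conjTranspose_mul_self_mem_cone (Z.submatrix id f)

/-- Columns of length `p` over `A`, in a universe large enough for tensor products with `S`. -/
def ColumnSpace (A : Type u) (p : ℕ) : Type (max u v) := ULift.{v} (Fin p) → A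

namespace ColumnSpace

variable {A : Type u} [CStarAlgebra A] {S : Type v} [AddCommGroup S] [Module ℂ S]
  [StarAddMonoid S] [StarModule ℂ S] {p : ℕ}

instance : AddCommGroup (ColumnSpace.{u, v} A p) :=
  inferInstanceAs (AddCommGroup (ULift.{v} (Fin p) → A))

instance : Module ℂ (ColumnSpace.{u, v} A p) :=
  inferInstanceAs (Module ℂ (ULift.{v} (Fin p) → A))

/-- Left multiplication on columns. -/
def leftMul : A →ₐ[ℂ] Module.End ℂ (ColumnSpace.{u, v} A p) :=
  AlgHom.ofLinearMap
    (LinearMap.mk₂ ℂ (fun a (x : ULift.{v} (Fin p) → A) => (fun i => a * x i : ULift.{v} (Fin p) → A))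
      (fun _ _ _ => funext fun _ => add_mul _ _ _) (fun _ _ _ => funext fun _ => smul_mul_assoc _ _ _)
      (fun _ _ _ => funext fun _ => mul_add _ _ _)
      (fun _ _ _ => funext fun _ => mul_smul_comm _ _ _))
    (LinearMap.ext fun _ => funext fun _ => one_mul _)
    (fun _ _ => LinearMap.ext fun _ => funext fun _ => mul_assoc _ _ _)

lemma leftMul_apply (a : A) (x : ColumnSpace.{u, v} A p) (i : ULift.{v} (Fin p)) :
    leftMul a x i = a * x i := rfl

/-- The matrix `(x i)* (y j) ⊗ s`. -/
def gram (s : S) (x y : ColumnSpace.{u, v} A p) : Matrix (Fin p) (Fin p) (A ⊗[ℂ] S) :=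
  .of fun i j => (star (x ⟨i⟩) * y ⟨j⟩) ⊗ₜ[ℂ] s

/-- The family of forms of a functional on matrices over a tensor product. -/
def form (f : Matrix (Fin p) (Fin p) (A ⊗[ℂ] S) →ₗ[ℂ] ℂ) :
    S →ₗ[ℂ] ColumnSpace.{u, v} A p →ₗ⋆[ℂ] ColumnSpace.{u, v} A p →ₗ[ℂ] ℂ where
  toFun s := LinearMap.mk₂'ₛₗ (starRingEnd ℂ) (RingHom.id ℂ) (fun x y => f (gram s x y))
    (fun x x' y => by
      rw [← map_add]; congr 1; ext i j
      change (star (x ⟨i⟩ + x' ⟨i⟩) * y ⟨j⟩) ⊗ₜ[ℂ] s = _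
      rw [star_add, add_mul, TensorProduct.add_tmul]; rfl)
    (fun c x y => by
      rw [← map_smul]; congr 1; ext i j
      change (star (c • x ⟨i⟩) * y ⟨j⟩) ⊗ₜ[ℂ] s = _
      rw [star_smul, smul_mul_assoc, ← TensorProduct.smul_tmul']; rfl)
    (fun x y y' => by
      rw [← map_add]; congr 1; ext i j
      change (star (x ⟨i⟩) * (y ⟨j⟩ + y' ⟨j⟩)) ⊗ₜ[ℂ] s = _
      rw [mul_add, TensorProduct.add_tmul]; rfl)
    (fun c x y => by
      rw [RingHom.id_apply, ← map_smul]; congr 1; ext i j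
      change (star (x ⟨i⟩) * (c • y ⟨j⟩)) ⊗ₜ[ℂ] s = _
      rw [mul_smul_comm, ← TensorProduct.smul_tmul']; rfl)
  map_add' s t := by
    ext x y
    change f (gram (s + t) x y) = f (gram s x y) + f (gram t x y)
    rw [← map_add]; congr 1; ext i j
    exact TensorProduct.tmul_add _ _ _
  map_smul' c s := by
    ext x y
    change f (gram (c • s) x y) = c • f (gram s x y)
    rw [← map_smul]; congr 1; ext i j
    exact TensorProduct.tmul_smul _ _ _

lemma form_apply (f : Matrix (Fin p) (Fin p) (A ⊗[ℂ] S) →ₗ[ℂ] ℂ) (s : S)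
    (x y : ColumnSpace.{u, v} A p) : form f s x y = f (gram s x y) := rfl

lemma gram_conjTranspose (s : S) (x y : ColumnSpace.{u, v} A p) :
    (gram s x y).conjTranspose = gram (star s) y x := by
  ext i j
  simp [gram, TensorProduct.star_tmul]

/-- The matrix of all products $x_k(i)^*x_l(j)$, indexed by pairs $(i,k)$, is positive over $A$. Its
tensor product with $X$, compressed to the diagonal where the two copies of $k$ agree and summed
over $k$, is the required sum. This is what makes the GNS forms completely positive in the $\mathcal
S$ variable. -/
lemma sum_gram_mem_maxGen {Q : MatrixOrder S} (hQ : Q.IsOrdered) {m : ℕ}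
    {X : Matrix (Fin m) (Fin m) S} (hX : X ∈ Q.cone m) (x : Fin m → ColumnSpace.{u, v} A p) :
    ∑ k, ∑ l, gram (X k l) (x k) (x l) ∈
      MatrixOrder.maxGen (OperatorSystem.ofCStarAlgebra A).toMatrixOrder Q p := by
  have h := MatrixOrder.scalarConj_kronecker_mem_maxGen
    (OperatorSystem.isPos_conjTranspose_mul_self
      (.of fun (_ : Unit) (q : Fin p × Fin m) => x q.2 ⟨q.1⟩))
    (hQ.isPos_of_mem hX)
    (.of fun (i : Fin p) (q : (Fin p × Fin m) × Fin m) => if i = q.1.1 ∧ q.1.2 = q.2 then 1 else 0)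
  convert h using 1
  ext i j
  simp only [gram, Matrix.sum_apply, Matrix.of_apply, scalarConj_apply, Fintype.sum_prod_type,
    Matrix.kroneckerMap_apply, Matrix.mul_apply, Matrix.conjTranspose_apply, apply_ite star,
    star_one, star_zero, Finset.univ_unique, Finset.sum_singleton]
  symm
  rw [Finset.sum_eq_single i]
  · refine Finset.sum_congr rfl fun k _ => ?_
    rw [Finset.sum_eq_single k]
    · rw [Finset.sum_eq_single j]
      · refine Finset.sum_congr rfl fun l _ => ?_
        rw [Finset.sum_eq_single l]
        · simp
        · intro b _ hb; simp [Ne.symm hb]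
        · simp
      · intro b _ hb; simp [Ne.symm hb]
      · simp
    · intro b _ hb; simp [Ne.symm hb]
    · simp
  · intro b _ hb; simp [Ne.symm hb]
  · simp

end ColumnSpace

namespace MatrixOrder

open ColumnSpace in
open scoped InnerProductSpace in
/-- In the maximal tensor product of a `C*`-algebra with an operator system, positivity is detected
by representations of the `C*`-algebra commuting with ucp maps of the operator system. -/
theorem mem_maxTensor_of_forall_representation {A : Type u} [CStarAlgebra A] {S : Type v}
    [AddCommGroup S] [Module ℂ S] [StarAddMonoid S] [StarModule ℂ S] {Q : MatrixOrder S}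
    (hQ : Q.IsOrdered) {p : ℕ} {X : Matrix (Fin p) (Fin p) (A ⊗[ℂ] S)} (hX : X.IsHermitian)
    (h : ∀ (H : Type (max u v)) [NormedAddCommGroup H] [InnerProductSpace ℂ H] [CompleteSpace H]
      (π : A →⋆ₐ[ℂ] (H →L[ℂ] H)) (ψ : S →ₗ[ℂ] (H →L[ℂ] H)), IsUCP Q (ofStarRing _) ψ →
      (∀ a s, Commute (π a) (ψ s)) →
        X.map (prodMap π.toAlgHom.toLinearMap ψ) ∈ (ofStarRing (H →L[ℂ] H)).cone p) :
    X ∈ (maxTensor (OperatorSystem.ofCStarAlgebra A).toMatrixOrder Q).cone p := by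
  refine ⟨hX, fun ε hε => ?_⟩
  by_contra hXε
  have hR := isOrdered_maxGenOrder (OperatorSystem.ofCStarAlgebra A).isOrdered hQ
  obtain ⟨f, hfstar, hfpos, hfX⟩ := hR.exists_separating hX hε hXε
  let E := ColumnSpace.{u, v} A p
  have hstar : ∀ s (x y : E), form f (star s) y x = conj (form f s x y) := fun s x y => by
    rw [form_apply, form_apply, ← hfstar, gram_conjTranspose]
  have hpos : ∀ (n : ℕ) (X : Matrix (Fin n) (Fin n) S) (x : Fin n → E), X ∈ Q.cone n →
      0 ≤ (∑ i, ∑ j, form f (X i j) (x i) (x j)).re := fun n X x hX => by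
    have := hfpos _ (sum_gram_mem_maxGen hQ hX x)
    simpa only [map_sum] using! this
  -- The form at the unit of $\mathcal S$ may be degenerate; passing to the completion also divides
  -- out its null vectors.
  let core : PreInnerProductSpace.Core ℂ E :=
    { inner := fun x y => form f Q.unit x y
      conj_inner_symm := fun x y => by rw [← hstar, hQ.star_unit]
      re_inner_nonneg := fun x => by
        have := hpos 1 (Matrix.diagonal fun _ => Q.unit) (fun _ => x) hQ.isPos_unit.mem
        simpa using! this
      add_left := fun x y z => by rw [map_add, LinearMap.add_apply]
      smul_left := fun x y c => by rw [LinearMap.map_smulₛₗ]; rfl }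
  let _ : SeminormedAddCommGroup E := InnerProductSpace.Core.toSeminormedAddCommGroup (c := core)
  let _ : InnerProductSpace ℂ E := InnerProductSpace.ofCore core
  obtain ⟨π, ψ, hπ, hψ, hψ1, hψstar, hcomm, hψpos⟩ := exists_commuting_representation hQ leftMul
    (form f) (fun x y => rfl) hstar (fun s a x y => by
      rw [form_apply, form_apply]
      congr 1; ext i j
      simp [gram, leftMul_apply, mul_assoc]) hpos
  have hucp : IsUCP Q (ofStarRing (UniformSpace.Completion E →L[ℂ] UniformSpace.Completion E)) ψ :=
    { map_unit := hψ1
      map_mem := fun {n X} hX => by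
        refine mem_cone_of_form_nonneg ?_ fun x => hψpos n X x hX
        ext i j : 2
        have := congrFun (congrFun (hQ.isHermitian_of_mem hX) i) j
        rw [Matrix.conjTranspose_apply] at this
        rw [Matrix.conjTranspose_apply, Matrix.map_apply, Matrix.map_apply, ← hψstar, this] }
  -- The standard columns play the role of the cyclic vector: the coefficient of $\pi\cdot\psi$ at
  -- $e_i,e_j$ is $f$ on the $(i,j)$ entry, so the quadratic form of the image of $X$ at $(e_i)$ is
  -- $f(X)$, whose real part is negative.
  let e : Fin p → E := fun i => (fun k => if k = ⟨i⟩ then 1 else 0 : ULift.{v} (Fin p) → A)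
  have hX' := form_nonneg_of_mem_cone (h _ π ψ hucp hcomm) fun i => (e i : UniformSpace.Completion E)
  have key : ∀ i j (t : A ⊗[ℂ] S), ⟪(e i : UniformSpace.Completion E),
      prodMap π.toAlgHom.toLinearMap ψ t (e j : UniformSpace.Completion E)⟫_ℂ =
        f (Matrix.single i j t) := by
    intro i j t
    induction t using TensorProduct.induction_on with
    | zero => simp
    | add t t' ht ht' =>
      rw [map_add, _root_.add_apply, inner_add_right, ht, ht', Matrix.single_add,
        map_add]
    | tmul a s =>
      have e1 : prodMap π.toAlgHom.toLinearMap ψ (a ⊗ₜ[ℂ] s) = ψ s * π a := (hcomm a s).eq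
      rw [e1]
      change ⟪(e i : UniformSpace.Completion E), ψ s (π a (e j : UniformSpace.Completion E))⟫_ℂ = _
      rw [hπ, hψ, form_apply]
      congr 1
      ext k l
      have e2 : ∀ i k : Fin p, e i ⟨k⟩ = if i = k then 1 else 0 := fun i k => by
        simp only [e, ULift.up_inj, eq_comm]
      simp only [gram, Matrix.of_apply, Matrix.single_apply]
      rw [leftMul_apply, e2, e2]
      by_cases h1 : i = k <;> by_cases h2 : j = l <;> simp [h1, h2]
  simp only [Matrix.map_apply, key, ← map_sum] at hX'
  rw [← Matrix.matrix_eq_sum_single] at hX'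
  linarith

end MatrixOrder

end

/-! ### Products of commuting completely positive maps -/

noncomputable section

open scoped Matrix.Norms.L2Operator in
/-- Complex matrices as a `C*`-algebra, with the operator norm. -/
abbrev Matrix.cstarAlgebra (ι : Type*) [Fintype ι] [DecidableEq ι] : CStarAlgebra (Matrix ι ι ℂ) :=
  { (inferInstance : NormedRing (Matrix ι ι ℂ)), (inferInstance : StarRing (Matrix ι ι ℂ)),
    (inferInstance : NormedAlgebra ℂ (Matrix ι ι ℂ)) with
    toCompleteSpace := FiniteDimensional.complete ℂ _
    norm_mul_self_le := CStarRing.norm_mul_self_le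
    star_smul := star_smul }

namespace MatrixOrder

lemma IsUCP.of_starAlgHom {A B : Type*} [CStarAlgebra A] [CStarAlgebra B] (π : A →⋆ₐ[ℂ] B) :
    IsUCP (ofStarRing A) (ofStarRing B) π.toAlgHom.toLinearMap where
  map_unit := map_one π
  map_mem := by
    rintro n _ ⟨Y, rfl⟩
    refine ⟨Y.map π, ?_⟩
    ext i j
    simp only [Matrix.mul_apply, Matrix.map_apply, Matrix.conjTranspose_apply, map_sum]
    refine Finset.sum_congr rfl fun x _ => (map_mul π _ _).trans ?_
    rw [map_star]

section Product

variable {S T : Type*} [AddCommGroup S] [Module ℂ S] [StarAddMonoid S] [StarModule ℂ S]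
  [AddCommGroup T] [Module ℂ T] [StarAddMonoid T] [StarModule ℂ T]
  {P : MatrixOrder S} {Q : MatrixOrder T} {B : Type*} [CStarAlgebra B]

/-- The map `φ` sends positive matrices to matrices `Y* Y` with the entries of `Y` commuting with
a given set. -/
def FactorsCommuting (P : MatrixOrder S) (φ : S →ₗ[ℂ] B) (C : Set B) : Prop :=
  ∀ ⦃n : ℕ⦄ ⦃X : Matrix (Fin n) (Fin n) S⦄, X ∈ P.cone n →
    ∃ (κ : Type) (_ : Fintype κ) (Y : Matrix κ (Fin n) B), X.map φ = Y.conjTranspose * Y ∧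
      ∀ a i, ∀ c ∈ C, Commute (Y a i) c

/-- Products of commuting completely positive maps are positive on the maximal tensor product. -/
lemma map_prodMap_mem_of_mem_maxTensor {φ : S →ₗ[ℂ] B} {ψ : T →ₗ[ℂ] B}
    (hφ1 : φ P.unit = 1) (hφ : FactorsCommuting P φ (Set.range ψ))
    (hψ : IsUCP Q (ofStarRing B) ψ) {p : ℕ} {X : Matrix (Fin p) (Fin p) (S ⊗[ℂ] T)}
    (hX : X ∈ (maxTensor P Q).cone p) : X.map (prodMap φ ψ) ∈ (ofStarRing B).cone p := by
  have hB := (OperatorSystem.ofCStarAlgebra B).isOrdered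
  have hgen : ∀ Z ∈ maxGen P Q p, Z.map (prodMap φ ψ) ∈ (ofStarRing B).cone p := by
    rintro _ ⟨k, m, X, Y, A, hX, hY, rfl⟩
    rw [scalarConj_map]
    obtain ⟨κ, _, V, hV, hVc⟩ := hφ hX
    obtain ⟨Z, hZ⟩ := hψ.map_mem hY
    refine (hB.isPos_scalarConj (P := (OperatorSystem.ofCStarAlgebra B).toMatrixOrder) ?_ A).mem
    -- With $\varphi(X)=V^*V$, $\psi(Y)=Z^*Z$ and $V$ commuting with the range of $\psi$, one has
    -- $(ZV)^*(ZV)=V^*\psi(Y)V=\varphi(X)\psi(Y)$ entrywise. Only one of the two factors has to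
    -- commute with the other map.
    have h := OperatorSystem.isPos_conjTranspose_mul_self
      (.of fun (q : κ × Fin m) (r : Fin k × Fin m) => Z q.2 r.2 * V q.1 r.1)
    convert h using 1
    ext ⟨i, i'⟩ ⟨j, j'⟩
    have e1 : φ (X i j) = ∑ a, star (V a i) * V a j := by
      simpa [Matrix.mul_apply] using congrFun (congrFun hV i) j
    have e2 : ψ (Y i' j') = ∑ b, star (Z b i') * Z b j' := by
      simpa [Matrix.mul_apply] using congrFun (congrFun hZ i') j'
    have e3 : prodMap φ ψ (X i j ⊗ₜ[ℂ] Y i' j') = φ (X i j) * ψ (Y i' j') := rfl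
    simp only [Matrix.map_apply, Matrix.kroneckerMap_apply, Matrix.mul_apply,
      Matrix.conjTranspose_apply, Matrix.of_apply, Fintype.sum_prod_type]
    rw [e3, e1, Finset.sum_mul]
    refine Finset.sum_congr rfl fun a _ => ?_
    rw [mul_assoc, (hVc a j _ ⟨_, rfl⟩).eq, e2, Finset.sum_mul, Finset.mul_sum]
    refine Finset.sum_congr rfl fun b _ => ?_
    rw [star_mul]; simp only [mul_assoc]
  have hε : ∀ ε : ℝ, 0 < ε → X.map (prodMap φ ψ) +
      (ε : ℂ) • Matrix.diagonal (fun _ => (1 : B)) ∈ (ofStarRing B).cone p := fun ε hε => by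
    convert hgen _ (hX.2 ε hε) using 1
    have e : prodMap φ ψ (P.unit ⊗ₜ[ℂ] Q.unit) = 1 := by
      change φ P.unit * ψ Q.unit = 1
      rw [hφ1, hψ.map_unit]; exact one_mul _
    ext i j
    by_cases hij : i = j <;> simp [hij, e]
  refine (OperatorSystem.ofCStarAlgebra B).archimedean ?_ hε
  have h1 := hB.isHermitian_of_mem (hε 1 one_pos)
  have h2 := hB.isHermitian (hB.isPos_unit (ι := Fin p))
  have h3 := h1.sub h2
  rw [Complex.ofReal_one, one_smul] at h3
  exact (add_sub_cancel_right (X.map (prodMap φ ψ)) (Matrix.diagonal fun _ => (1 : B))) ▸ h3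

end Product

section Kron

variable {S T : Type*} [AddCommGroup S] [Module ℂ S] [StarAddMonoid S] [StarModule ℂ S]
  [AddCommGroup T] [Module ℂ T] [StarAddMonoid T] [StarModule ℂ T]
  {P : MatrixOrder S} {Q : MatrixOrder T}

-- The map $\varphi\otimes\psi$ is the product of the commuting maps $\varphi\otimes1$ and
-- $1\otimes\psi$, and a root $Y$ of $\varphi(X)$ becomes $Y\otimes1$, which commutes with
-- $1\otimes\psi$.
open Kronecker in
lemma maxTensor_cone_subset_minTensor_cone (p : ℕ) :
    (maxTensor P Q).cone p ⊆ (minTensor P Q).cone p := by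
  intro X hX
  refine ⟨hX.1, fun k m φ ψ hφ hψ => ?_⟩
  let _ := Matrix.cstarAlgebra (Fin k × Fin m)
  let φ' : S →ₗ[ℂ] Matrix (Fin k × Fin m) (Fin k × Fin m) ℂ :=
    (Matrix.kroneckerBilinear (R := ℂ) (α := ℂ)).flip 1 ∘ₗ φ
  let ψ' : T →ₗ[ℂ] Matrix (Fin k × Fin m) (Fin k × Fin m) ℂ :=
    Matrix.kroneckerBilinear (R := ℂ) (α := ℂ) 1 ∘ₗ ψ
  have hφ' : ∀ s, φ' s = φ s ⊗ₖ (1 : Matrix (Fin m) (Fin m) ℂ) := fun _ => rfl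
  have hψ' : ∀ t, ψ' t = (1 : Matrix (Fin k) (Fin k) ℂ) ⊗ₖ ψ t := fun _ => rfl
  have e : kronMap φ ψ = prodMap φ' ψ' := by
    refine TensorProduct.ext' fun s t => ?_
    change φ s ⊗ₖ ψ t = φ' s * ψ' t
    rw [hφ', hψ', ← Matrix.mul_kronecker_mul, Matrix.mul_one, Matrix.one_mul]
  rw [e]
  refine map_prodMap_mem_of_mem_maxTensor (P := P) (Q := Q) ?_ ?_ ⟨?_, ?_⟩ hX
  · rw [hφ', hφ.map_unit]
    exact Matrix.one_kronecker_one
  · intro n X hX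
    obtain ⟨Y, hY⟩ := hφ.map_mem hX
    refine ⟨Fin n, inferInstance, .of fun a i => Y a i ⊗ₖ (1 : Matrix (Fin m) (Fin m) ℂ), ?_, ?_⟩
    · ext i j : 1
      have h1 : φ (X i j) = ∑ a, star (Y a i) * Y a j := by
        simpa [Matrix.mul_apply] using congrFun (congrFun hY i) j
      rw [Matrix.map_apply, hφ', h1]
      refine (map_sum ((Matrix.kroneckerBilinear (R := ℂ) (α := ℂ)).flip 1) _ _).trans
        (Finset.sum_congr rfl fun a _ => ?_)
      change (star (Y a i) * Y a j) ⊗ₖ (1 : Matrix (Fin m) (Fin m) ℂ) =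
        (Y a i ⊗ₖ (1 : Matrix (Fin m) (Fin m) ℂ)).conjTranspose *
        (Y a j ⊗ₖ (1 : Matrix (Fin m) (Fin m) ℂ))
      rw [Matrix.conjTranspose_kronecker, ← Matrix.mul_kronecker_mul, Matrix.conjTranspose_one,
        Matrix.one_mul]
      rfl
    · rintro a i _ ⟨t, rfl⟩
      rw [hψ', Matrix.of_apply, Commute, SemiconjBy]
      rw [← Matrix.mul_kronecker_mul, ← Matrix.mul_kronecker_mul]
      simp
  · rw [hψ', hψ.map_unit]
    exact Matrix.one_kronecker_one
  · intro n X hX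
    obtain ⟨Y, hY⟩ := hψ.map_mem hX
    refine ⟨.of fun a i => (1 : Matrix (Fin k) (Fin k) ℂ) ⊗ₖ Y a i, ?_⟩
    ext i j : 1
    have h1 : ψ (X i j) = ∑ a, star (Y a i) * Y a j := by
      simpa [Matrix.mul_apply] using congrFun (congrFun hY i) j
    rw [Matrix.map_apply, hψ', h1]
    refine (map_sum (Matrix.kroneckerBilinear (R := ℂ) (α := ℂ) 1) _ _).trans
      (Finset.sum_congr rfl fun a _ => ?_)
    change (1 : Matrix (Fin k) (Fin k) ℂ) ⊗ₖ (star (Y a i) * Y a j) =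
      ((1 : Matrix (Fin k) (Fin k) ℂ) ⊗ₖ Y a i).conjTranspose *
      ((1 : Matrix (Fin k) (Fin k) ℂ) ⊗ₖ Y a j)
    rw [Matrix.conjTranspose_kronecker, ← Matrix.mul_kronecker_mul, Matrix.conjTranspose_one,
      Matrix.one_mul]
    rfl

end Kron

end MatrixOrder

end

/-! ### Unitary dilation and extension of ucp maps to $\mathcal U_{nc}(n)$ -/

noncomputable section

/-- Positive matrices go to Hermitian ones, and every element is an off-diagonal entry of a positive
$2\times2$ matrix. -/
lemma MatrixOrder.map_star_of_map_mem {S : Type*} [AddCommGroup S] [Module ℂ S] [StarAddMonoid S]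
    [StarModule ℂ S] {P : MatrixOrder S} (hP : P.IsOrdered) {B : Type*} [Ring B] [StarRing B]
    [Algebra ℂ B] {φ : S →ₗ[ℂ] B}
    (hφ : ∀ {n : ℕ} {X}, X ∈ P.cone n → X.map φ ∈ (ofStarRing B).cone n) (s : S) :
    φ (star s) = star (φ s) := by
  obtain ⟨r, -, h⟩ := hP.exists_two_isPos s
  obtain ⟨Y, hY⟩ := hφ h.mem
  have h2 := Matrix.isHermitian_conjTranspose_mul_self Y
  rw [← hY] at h2
  simpa using (congrFun (congrFun h2 1) 0).symm

/-- A self-adjoint contraction is the self-adjoint part of a unitary in its bicommutant. -/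
lemma CStarAlgebra.exists_unitary_dilation {L : Type*} [CStarAlgebra L] [PartialOrder L]
    [StarOrderedRing L] {s : L} (hs : star s = s) (h1 : 0 ≤ 1 + s) (h2 : 0 ≤ 1 - s) :
    ∃ q w : L, w = s + Complex.I • q ∧ star w * w = 1 ∧ w * star w = 1 ∧
      ∀ b, Commute b (s * s) → Commute b q := by
  have hpos : 0 ≤ 1 - s * s := by
    have e1 : star (1 - s) = 1 - s := by rw [star_sub, hs, star_one]
    have e2 : star (1 + s) = 1 + s := by rw [star_add, hs, star_one]
    -- Each summand is a positive element conjugated by a self-adjoint one, and together they equal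
    -- $2(1-s^2)$. The unitary is then $s+i\sqrt{1-s^2}$.
    have h3 : 0 ≤ (1 - s) * (1 + s) * (1 - s) + (1 + s) * (1 - s) * (1 + s) :=
      add_nonneg (IsSelfAdjoint.conjugate_nonneg h1 e1) (IsSelfAdjoint.conjugate_nonneg h2 e2)
    have e3 : (1 - s) * (1 + s) * (1 - s) + (1 + s) * (1 - s) * (1 + s) = (2 : ℝ) • (1 - s * s) := by
      rw [two_smul]; noncomm_ring
    rw [e3] at h3
    have h4 := smul_nonneg (show (0 : ℝ) ≤ 2⁻¹ by norm_num) h3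
    rwa [smul_smul, inv_mul_cancel₀ two_ne_zero, one_smul] at h4
  set q := CFC.sqrt (1 - s * s) with hq
  have hqs : star q = q := (IsSelfAdjoint.of_nonneg (CFC.sqrt_nonneg _)).star_eq
  have hqq : q * q = 1 - s * s := CFC.sqrt_mul_sqrt_self _ hpos
  have hcomm : ∀ b, Commute b (s * s) → Commute b q := fun b hb =>
    (Commute.cfcₙ_nnreal ((Commute.one_left b).sub_left hb.symm) NNReal.sqrt).symm
  have hsq : s * q = q * s := hcomm s (by simp [Commute, SemiconjBy, mul_assoc])
  refine ⟨q, _, rfl, ?_, ?_, hcomm⟩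
  · rw [star_add, star_smul, hs, hqs, Complex.star_def, Complex.conj_I, add_mul, mul_add, mul_add,
      smul_mul_smul_comm, hqq, mul_smul_comm, smul_mul_assoc, hsq, neg_mul, Complex.I_mul_I]
    module
  · rw [star_add, star_smul, hs, hqs, Complex.star_def, Complex.conj_I, add_mul, mul_add, mul_add,
      smul_mul_smul_comm, hqq, mul_smul_comm, smul_mul_assoc, hsq, mul_neg, Complex.I_mul_I]
    module

lemma OperatorSystem.ofMatrix_nonneg_of_isPos {B : Type*} [CStarAlgebra B] [PartialOrder B]
    [StarOrderedRing B] {ι : Type*} [Fintype ι] [DecidableEq ι] {X : Matrix ι ι B}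
    (hX : (OperatorSystem.ofCStarAlgebra B).IsPos X) : 0 ≤ CStarMatrix.ofMatrix X := by
  let e := Fintype.equivFin ι
  obtain ⟨Y, hY⟩ := hX _ e.symm
  refine OperatorSystem.nonneg_iff_exists.2 ⟨CStarMatrix.ofMatrix (Y.submatrix e e), ?_⟩
  have h : X = (Y.submatrix e e).conjTranspose * Y.submatrix e e := by
    rw [Matrix.conjTranspose_submatrix, Matrix.submatrix_mul_equiv, ← hY]
    simp
  exact h

section Dilation

variable {B : Type*} [CStarAlgebra B] {n : ℕ}

open Matrix in
/-- A matrix `T` which is a contraction, in the sense that `[1, T*; T, 1]` is positive, is the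
corner of a unitary with entries commuting with everything `T` and `T*` commute with. -/
lemma Matrix.exists_unitary_dilation (T : Matrix (Fin n) (Fin n) B)
    (hT : (OperatorSystem.ofCStarAlgebra B).IsPos (Matrix.fromBlocks 1 Tᴴ T 1)) :
    ∃ W : Matrix (Fin n) (Fin n) (Matrix (Fin 2) (Fin 2) B),
      (∀ i j, ∑ k, star (W k i) * W k j = if i = j then 1 else 0) ∧
      (∀ i j, ∑ k, W i k * star (W j k) = if i = j then 1 else 0) ∧
      (∀ i j, W i j 0 0 = T i j) ∧
      ∀ c, (∀ i j, Commute (T i j) c) → (∀ i j, Commute (star (T i j)) c) →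
        ∀ i j a b, Commute (W i j a b) c := by
  let _ := CStarAlgebra.spectralOrder B
  let _ := CStarAlgebra.spectralOrderedRing B
  set s : Matrix (Fin n ⊕ Fin n) (Fin n ⊕ Fin n) B := Matrix.fromBlocks 0 Tᴴ T 0 with hs
  have hT1 : (OperatorSystem.ofCStarAlgebra B).IsPos (1 + s) := by
    convert hT using 1
    rw [hs, ← Matrix.fromBlocks_one, Matrix.fromBlocks_add]; simp
  have hT2 : (OperatorSystem.ofCStarAlgebra B).IsPos (1 - s) := by
    have h := (OperatorSystem.ofCStarAlgebra B).isOrdered.isPos_scalarConj hT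
      (Matrix.diagonal (Sum.elim (fun _ => 1) fun _ => -1))
    convert h using 1
    rw [scalarConj_diagonal, hs, ← Matrix.fromBlocks_one]
    ext (i | i) (j | j) <;> simp [Matrix.one_apply]
  have hsH : sᴴ = s := by
    rw [hs, Matrix.fromBlocks_conjTranspose]; simp
  have hss : s * s = Matrix.fromBlocks (Tᴴ * T) 0 0 (T * Tᴴ) := by
    rw [hs, Matrix.fromBlocks_multiply]; simp
  obtain ⟨q, w, hw, hw1, hw2, hq⟩ : ∃ q w : Matrix (Fin n ⊕ Fin n) (Fin n ⊕ Fin n) B,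
      w = s + Complex.I • q ∧ wᴴ * w = 1 ∧ w * wᴴ = 1 ∧
      ∀ b : Matrix (Fin n ⊕ Fin n) (Fin n ⊕ Fin n) B, b * (s * s) = (s * s) * b → b * q = q * b :=
    CStarAlgebra.exists_unitary_dilation (L := CStarMatrix (Fin n ⊕ Fin n) (Fin n ⊕ Fin n) B)
      (s := CStarMatrix.ofMatrix s) hsH (OperatorSystem.ofMatrix_nonneg_of_isPos hT1)
      (OperatorSystem.ofMatrix_nonneg_of_isPos hT2)
  -- The square of the off-diagonal matrix $s$ is block diagonal, hence commutes with
  -- $\operatorname{diag}(1,-1)$; so does $q$, which must be block diagonal too.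
  have hq0 : ∀ i j, q (Sum.inr i) (Sum.inl j) = 0 := by
    intro i j
    have h := hq (Matrix.diagonal (Sum.elim (fun _ => 1) fun _ => -1)) (by
      rw [hss]
      ext (i | i) (j | j) <;> simp)
    have h' := congrFun (congrFun h (Sum.inr i)) (Sum.inl j)
    rw [Matrix.diagonal_mul, Matrix.mul_diagonal] at h'
    simp only [Sum.elim_inr, Sum.elim_inl, neg_mul, one_mul, mul_one] at h'
    have h2 : (2 : ℂ) • q (Sum.inr i) (Sum.inl j) = 0 := by
      rw [two_smul]; nth_rewrite 1 [← h']; exact neg_add_cancel _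
    exact (smul_eq_zero.1 h2).resolve_left two_ne_zero
  -- The row blocks are exchanged and the column blocks are not, so that the corner at position
  -- $(0,0)$ is the block of $w$ containing $T$, where $q$ does not contribute.
  let σ : Fin 2 → Fin n → Fin n ⊕ Fin n := ![Sum.inr, Sum.inl]
  let τ : Fin 2 → Fin n → Fin n ⊕ Fin n := ![Sum.inl, Sum.inr]
  have hσ : ∀ f : Fin n ⊕ Fin n → B, ∑ k, ∑ c, f (σ c k) = ∑ r, f r := fun f => by
    simp [σ, Fin.sum_univ_two, Fintype.sum_sum_type, Finset.sum_add_distrib, add_comm]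
  have hτ : ∀ f : Fin n ⊕ Fin n → B, ∑ k, ∑ c, f (τ c k) = ∑ r, f r := fun f => by
    simp [τ, Fin.sum_univ_two, Fintype.sum_sum_type, Finset.sum_add_distrib]
  refine ⟨fun i j => .of fun a b => w (σ a i) (τ b j), fun i j => ?_, fun i j => ?_, fun i j => ?_,
    fun c hc hc' i j a b => ?_⟩
  · ext a b
    have h := congrFun (congrFun hw1 (τ a i)) (τ b j)
    rw [Matrix.mul_apply, ← hσ] at h
    simp only [Matrix.sum_apply, Matrix.mul_apply, Matrix.star_apply, Matrix.of_apply]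
    refine h.trans ?_
    by_cases hij : i = j <;> fin_cases a <;> fin_cases b <;> simp [τ, hij, Matrix.one_apply]
  · ext a b
    have h := congrFun (congrFun hw2 (σ a i)) (σ b j)
    rw [Matrix.mul_apply, ← hτ] at h
    simp only [Matrix.sum_apply, Matrix.mul_apply, Matrix.star_apply, Matrix.of_apply]
    refine h.trans ?_
    by_cases hij : i = j <;> fin_cases a <;> fin_cases b <;> simp [σ, hij, Matrix.one_apply]
  · simp [hw, σ, τ, hq0, hs]
  · have hsc : ∀ x y, Commute (s x y) c := by
      rintro (i | i) (j | j)
      · exact Commute.zero_left c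
      · exact hc' j i
      · exact hc i j
      · exact Commute.zero_left c
    have hcs : Matrix.diagonal (fun _ => c) * s = s * Matrix.diagonal (fun _ => c) := by
      ext x y
      rw [Matrix.diagonal_mul, Matrix.mul_diagonal, (hsc x y).eq]
    have h := hq (Matrix.diagonal fun _ => c) (by
      rw [← Matrix.mul_assoc, hcs, Matrix.mul_assoc, hcs, Matrix.mul_assoc])
    have h' := congrFun (congrFun h (σ a i)) (τ b j)
    rw [Matrix.diagonal_mul, Matrix.mul_diagonal] at h'
    have h2 : Commute (q (σ a i) (τ b j)) c := h'.symm
    change Commute (w (σ a i) (τ b j)) c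
    rw [hw]
    exact (hsc _ _).add_left (h2.smul_left _)

end Dilation

namespace Unc

variable {B : Type*} [CStarAlgebra B] {n : ℕ}

/-- The generators of `V_n`. -/
def vgen (i j : Fin n) : Vn n := ⟨u i j, Submodule.subset_span (.inl (.inr ⟨(i, j), rfl⟩))⟩

lemma Vn_hom_ext {M : Type*} [AddCommGroup M] [Module ℂ M] {f g : Vn n →ₗ[ℂ] M}
    (h1 : f ⟨1, Vn.one_mem⟩ = g ⟨1, Vn.one_mem⟩) (hu : ∀ i j, f (vgen i j) = g (vgen i j))
    (hu' : ∀ i j, f (star (vgen i j)) = g (star (vgen i j))) : f = g := by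
  ext ⟨v, hv⟩
  induction hv using Submodule.span_induction with
  | mem x hx =>
    rcases hx with (rfl | ⟨p, rfl⟩) | ⟨p, rfl⟩
    · exact h1
    · exact hu p.1 p.2
    · exact hu' p.1 p.2
  | zero => exact (map_zero f).trans (map_zero g).symm
  | add x y hx hy ihx ihy =>
    have e : (⟨x + y, Submodule.add_mem _ hx hy⟩ : Vn n) = ⟨x, hx⟩ + ⟨y, hy⟩ := rfl
    rw [e, map_add, map_add, ihx, ihy]
  | smul c x hx ih =>
    have e : (⟨c • x, Submodule.smul_mem _ c hx⟩ : Vn n) = c • ⟨x, hx⟩ := rfl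
    rw [e, map_smul, map_smul, ih]

-- The commutant of a self-adjoint set is a closed $*$-subalgebra, so containing the images of the
-- generators it contains the image of the whole algebra.
open scoped CStarAlgebra in
lemma commute_of_generators (π : Unc n →⋆ₐ[ℂ] B) {C : Set B} (hC : ∀ c ∈ C, star c ∈ C)
    (h : ∀ i j, ∀ c ∈ C, Commute (π (u i j)) c) (x : Unc n) : ∀ c ∈ C, Commute (π x) c := by
  intro c hc
  have hπ : Continuous π := map_continuous π
  refine induction (P := fun x => π x * c = c * π x) x (isClosed_eq (by fun_prop) (by fun_prop))
    fun a => ?_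
  induction a using StarPoly.induction with
  | hc r =>
    rw [AlgHom.commutes, AlgHomClass.commutes]
    exact Algebra.commutes _ _
  | hl x =>
    obtain ⟨⟨i, j⟩, b⟩ := x
    cases b
    · exact h i j c hc
    · have h2 : StarPoly.letter ((i, j), true) = star (StarPoly.gen i j) := by
        rw [StarPoly.gen, StarPoly.star_letter]; rfl
      rw [h2, ← star_ofPoly, map_star]
      have h3 := (h i j (star c) (hC c hc)).star_star
      rw [star_star] at h3
      exact h3.eq
  | hm a b ha hb => rw [map_mul, map_mul, mul_assoc, hb, ← mul_assoc, ha, mul_assoc]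
  | ha a b ha hb => rw [map_add, map_add, add_mul, mul_add, ha, hb]

open MatrixOrder Matrix in
/-- A ucp map on `V_n` extends to a ucp map on `U_nc(n)`, and the extension stays in the
bicommutant of the range. -/
theorem exists_ucp_extension {φ : Vn n →ₗ[ℂ] B}
    (hφ : IsUCP (Vn.operatorSystem n).toMatrixOrder (ofStarRing B) φ) :
    ∃ φ' : Unc n →ₗ[ℂ] B, φ' ∘ₗ (Vn n).subtype = φ ∧
      IsUCP (Unc.operatorSystem n).toMatrixOrder (ofStarRing B) φ' ∧
      ∀ C : Set B, (∀ c ∈ C, star c ∈ C) → (∀ v, ∀ c ∈ C, Commute (φ v) c) →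
        FactorsCommuting (Unc.operatorSystem n).toMatrixOrder φ' C := by
  let _ := CStarAlgebra.spectralOrder B
  let _ := CStarAlgebra.spectralOrderedRing B
  have hstar : ∀ v, φ (star v) = star (φ v) :=
    map_star_of_map_mem (Vn.operatorSystem n).isOrdered hφ.map_mem
  -- By unitarity this is $[u,1]^*[u,1]$, and its entries lie in $\mathcal V_n$, so $\varphi$ may be
  -- applied to it.
  have hG : (Vn.operatorSystem n).IsPos (Matrix.fromBlocks
      (Matrix.diagonal fun _ => (Vn.operatorSystem n).unit) (.of fun i j => star (vgen j i))
      (.of fun i j : Fin n => vgen i j) (Matrix.diagonal fun _ => (Vn.operatorSystem n).unit)) := by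
    intro m f
    have h := OperatorSystem.isPos_conjTranspose_mul_self
      (Matrix.fromCols (u : Matrix (Fin n) (Fin n) (Unc n)) (1 : Matrix (Fin n) (Fin n) (Unc n)))
    have h2 := h m f
    change Matrix.map _ _ ∈ (OperatorSystem.ofCStarAlgebra (Unc n)).cone m
    convert h2 using 1
    rw [Matrix.conjTranspose_fromCols_eq_fromRows_conjTranspose, Matrix.fromRows_mul_fromCols,
      star_u_mul_u, ← Matrix.submatrix_map, Matrix.fromBlocks_map]
    congr 2
    · ext i j
      by_cases hij : i = j <;> simp [hij, Matrix.one_apply]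
      rfl
    · ext i j; simp; rfl
    · ext i j; simp; rfl
    · ext i j
      by_cases hij : i = j <;> simp [hij]
      rfl
  obtain ⟨W, hW1, hW2, hWT, hWc⟩ := Matrix.exists_unitary_dilation
    (.of fun i j => φ (vgen i j)) (by
      intro m f
      change _ ∈ (ofStarRing B).cone m
      convert hφ.map_mem (hG m f) using 1
      rw [← Matrix.submatrix_map, Matrix.fromBlocks_map]
      congr 2
      · ext i j
        by_cases hij : i = j <;> simp [hij, Matrix.one_apply]
        exact hφ.map_unit.symm
      · ext i j; simp [hstar]
      · ext i j
        by_cases hij : i = j <;> simp [hij, Matrix.one_apply]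
        exact hφ.map_unit.symm)
  obtain ⟨π, hπ, -⟩ := existsUnique_lift (B := CStarMatrix (Fin 2) (Fin 2) B)
    (.of fun i j => CStarMatrix.ofMatrix (W i j)) (by
      ext i j : 1
      rw [Matrix.mul_apply, Matrix.one_apply]
      exact hW1 i j) (by
      ext i j : 1
      rw [Matrix.mul_apply, Matrix.one_apply]
      exact hW2 i j)
  let φ' : Unc n →ₗ[ℂ] B :=
    { toFun := fun x => π x 0 0
      map_add' := fun x y => by rw [map_add]; rfl
      map_smul' := fun c x => by rw [map_smul]; rfl }
  have hfac : ∀ C : Set B, (∀ c ∈ C, star c ∈ C) → (∀ v, ∀ c ∈ C, Commute (φ v) c) →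
        FactorsCommuting (Unc.operatorSystem n).toMatrixOrder φ' C := by
    intro C hC hCφ m X hX
    obtain ⟨Y, rfl⟩ := hX
    -- The corner of $\pi(Y)^*\pi(Y)$ only involves the first column of each $2\times2$ block, and
    -- that column is the root.
    refine ⟨Fin m × Fin 2, inferInstance, .of fun a i => π (Y a.1 i) a.2 0, ?_, ?_⟩
    · ext i j
      simp only [Matrix.map_apply, Matrix.mul_apply, Matrix.conjTranspose_apply, Matrix.of_apply,
        Fintype.sum_prod_type, map_sum]
      refine Finset.sum_congr rfl fun a _ => ?_
      change (π (star (Y a i) * Y a j)) 0 0 = _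
      rw [map_mul, map_star]
      rfl
    · intro a i c hc
      -- Elements of $C$ act on $M_2(B)$ as constant diagonal matrices, and commuting with these
      -- means commuting entry by entry.
      have h := commute_of_generators π
        (C := (fun c : B => CStarMatrix.ofMatrix (Matrix.diagonal fun _ : Fin 2 => c)) '' C) (by
          rintro _ ⟨c, hc, rfl⟩
          refine ⟨star c, hC c hc, ?_⟩
          exact (Matrix.diagonal_conjTranspose _).symm) (by
          rintro i j _ ⟨c, hc, rfl⟩
          rw [hπ]
          have h1 : W i j * Matrix.diagonal (fun _ => c) = Matrix.diagonal (fun _ => c) * W i j := by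
            ext a b
            rw [Matrix.mul_diagonal, Matrix.diagonal_mul]
            exact hWc c (fun i j => hCφ _ c hc) (fun i j => by
              rw [Matrix.of_apply, ← hstar]; exact hCφ _ c hc) i j a b
          exact h1) (Y a.1 i) _ ⟨c, hc, rfl⟩
      let M : Matrix (Fin 2) (Fin 2) B := π (Y a.1 i)
      have h2 : M * Matrix.diagonal (fun _ => c) = Matrix.diagonal (fun _ => c) * M := h
      have h3 := congrFun (congrFun h2 a.2) 0
      rw [Matrix.mul_diagonal, Matrix.diagonal_mul] at h3
      exact h3
  refine ⟨φ', Vn_hom_ext ?_ ?_ ?_, ⟨?_, fun {m X} hX => ?_⟩, hfac⟩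
  · refine Eq.trans ?_ hφ.map_unit.symm
    change π 1 0 0 = 1
    rw [map_one]; rfl
  · intro i j
    change π (u i j) 0 0 = _
    rw [hπ]
    exact hWT i j
  · intro i j
    rw [hstar]
    change π (star (u i j)) 0 0 = _
    rw [map_star, hπ]
    exact congrArg star (hWT i j)
  · change π 1 0 0 = 1
    rw [map_one]; rfl
  · obtain ⟨κ, _, Y, hY, -⟩ := hfac ∅ (by simp) (by simp) hX
    rw [hY]
    exact OperatorSystem.conjTranspose_mul_self_mem_cone Y

end Unc

end

/-! ### Minimal tensor products and conjugation over the algebra -/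

noncomputable section

lemma Matrix.mem_cone_iff_comp {K : Type*} [Fintype K] [DecidableEq K] {n : ℕ}
    {X : Matrix (Fin n) (Fin n) (Matrix K K ℂ)} :
    X ∈ (MatrixOrder.ofStarRing (Matrix K K ℂ)).cone n ↔
      (OperatorSystem.ofCStarAlgebra ℂ).IsPos (Matrix.comp _ _ _ _ _ X) := by
  have hmul : ∀ Y : Matrix (Fin n) (Fin n) (Matrix K K ℂ), Matrix.comp _ _ _ _ _
      (Y.conjTranspose * Y) = (Matrix.comp _ _ _ _ _ Y).conjTranspose *
        Matrix.comp _ _ _ _ _ Y := fun Y =>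
    (Matrix.compRingEquiv (Fin n) K ℂ).map_mul Y.conjTranspose Y
  constructor
  · rintro ⟨Y, rfl⟩
    rw [hmul]
    exact OperatorSystem.isPos_conjTranspose_mul_self _
  · intro h
    let e := Fintype.equivFin (Fin n × K)
    obtain ⟨Y, hY⟩ := h _ e.symm
    refine ⟨(Matrix.comp _ _ _ _ _).symm (Y.submatrix e e), ?_⟩
    refine (Matrix.comp _ _ _ _ _).injective ?_
    rw [hmul, Equiv.apply_symm_apply, Matrix.conjTranspose_submatrix, Matrix.submatrix_mul_equiv,
      ← hY]
    simp

namespace MatrixOrder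

section Sum

variable {T : Type*} [AddCommGroup T] [Module ℂ T] [StarAddMonoid T] {P : MatrixOrder T}

/-- Summing all blocks is conjugation by a row of identity matrices. -/
lemma IsOrdered.isPos_sum_blocks (hP : P.IsOrdered) {ι κ : Type*} [Fintype ι] [Fintype κ]
    {X : Matrix (ι × κ) (ι × κ) T} (hX : P.IsPos X) :
    P.IsPos (.of fun a b => ∑ i, ∑ j, X (i, a) (j, b)) := by
  classical
  convert hP.isPos_scalarConj hX (.of fun (a : κ) (p : ι × κ) => if p.2 = a then 1 else 0) using 1
  ext a b
  simp [scalarConj_apply, Fintype.sum_prod_type, apply_ite star, ite_smul]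

end Sum

section CompletelyPositive

variable {B : Type*} [CStarAlgebra B] {S : Type*} [AddCommGroup S] [Module ℂ S] {P : MatrixOrder S}

/-- Completely positive maps. -/
def IsCP {S T : Type*} [AddCommGroup S] [Module ℂ S] [AddCommGroup T] [Module ℂ T]
    (P : MatrixOrder S) (Q : MatrixOrder T) (φ : S →ₗ[ℂ] T) : Prop :=
  ∀ ⦃n : ℕ⦄ ⦃X⦄, X ∈ P.cone n → X.map φ ∈ Q.cone n

lemma IsCP.add_smul {φ ψ : S →ₗ[ℂ] B} (hφ : IsCP P (ofStarRing B) φ) (hψ : IsCP P (ofStarRing B) ψ)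
    {r : ℝ} (hr : 0 ≤ r) : IsCP P (ofStarRing B) (φ + (r : ℂ) • ψ) := fun _ _ hX =>
  (OperatorSystem.ofCStarAlgebra B).add_mem (hφ hX)
    ((OperatorSystem.ofCStarAlgebra B).smul_mem hr (hψ hX))

lemma map_conj_mem_cone {R : Type*} [Ring R] [StarRing R] {n : ℕ} {X : Matrix (Fin n) (Fin n) R}
    (hX : X ∈ (ofStarRing R).cone n) (b : R) :
    X.map (fun x => star b * x * b) ∈ (ofStarRing R).cone n := by
  obtain ⟨Y, rfl⟩ := hX
  refine ⟨.of fun i j => Y i j * b, ?_⟩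
  ext i j
  simp [Matrix.mul_apply, Finset.mul_sum, Finset.sum_mul, mul_assoc]

end CompletelyPositive

section Min

open Kronecker

variable {S T : Type*} [AddCommGroup S] [Module ℂ S] [StarAddMonoid S] [StarModule ℂ S]
  [AddCommGroup T] [Module ℂ T] [StarAddMonoid T] [StarModule ℂ T]
  {P : MatrixOrder S} {Q : MatrixOrder T} {p : ℕ}

lemma kronMap_tmul {k m : ℕ} (φ : S →ₗ[ℂ] Matrix (Fin k) (Fin k) ℂ)
    (ψ : T →ₗ[ℂ] Matrix (Fin m) (Fin m) ℂ) (s : S) (t : T) :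
    kronMap φ ψ (s ⊗ₜ t) = φ s ⊗ₖ ψ t := rfl

lemma isOrdered_minTensor (hP : P.IsOrdered) (hQ : Q.IsOrdered) : (minTensor P Q).IsOrdered where
  isHermitian_of_mem h := h.1
  add_mem {n X Y} hX hY := ⟨hX.1.add hY.1, fun k m φ ψ hφ hψ => by
    let _ := Matrix.cstarAlgebra (Fin k × Fin m)
    rw [Matrix.map_add _ (map_add _)]
    exact (OperatorSystem.ofCStarAlgebra (Matrix (Fin k × Fin m) (Fin k × Fin m) ℂ)).add_mem
      (hX.2 k m φ ψ hφ hψ) (hY.2 k m φ ψ hφ hψ)⟩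
  conj_mem {n m' X} A hX := ⟨by rw [Matrix.IsHermitian, scalarConj_conjTranspose, hX.1.eq],
    fun k m φ ψ hφ hψ => by
    let _ := Matrix.cstarAlgebra (Fin k × Fin m)
    rw [scalarConj_map]
    exact (OperatorSystem.ofCStarAlgebra (Matrix (Fin k × Fin m) (Fin k × Fin m) ℂ)).conj_mem A
      (hX.2 k m φ ψ hφ hψ)⟩
  star_unit := (isOrdered_maxGenOrder hP hQ).star_unit
  exists_add_mem {n X} hX := by
    -- The order unit property is inherited from the smaller maximal cones.
    obtain ⟨r, hr, h⟩ := (isOrdered_maxGenOrder hP hQ).exists_add_mem hX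
    exact ⟨r, hr, maxTensor_cone_subset_minTensor_cone n
      ⟨(isOrdered_maxGenOrder hP hQ).isHermitian_of_mem h, fun ε hε =>
        add_mem_maxGen hP hQ h (unit_mem_maxGen hP hQ hε.le)⟩⟩

open scoped ComplexOrder in
/-- Minimal tensor products are detected by completely positive maps, not just by ucp ones. -/
theorem map_kronMap_mem_of_isCP {X : Matrix (Fin p) (Fin p) (S ⊗[ℂ] T)}
    (hP : ∃ Z : Matrix (Fin 1) (Fin 1) S, Z ∈ P.cone 1 ∧ Z 0 0 = P.unit)
    (hX : X ∈ (minTensor P Q).cone p) {k m : ℕ} {φ : S →ₗ[ℂ] Matrix (Fin k) (Fin k) ℂ}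
    {ψ : T →ₗ[ℂ] Matrix (Fin m) (Fin m) ℂ} (hφ : IsCP P (ofStarRing _) φ)
    (hψ : IsUCP Q (ofStarRing _) ψ)
    (hG : ∃ G : S →ₗ[ℂ] Matrix (Fin k) (Fin k) ℂ, IsUCP P (ofStarRing _) G) :
    X.map (kronMap φ ψ) ∈ (ofStarRing (Matrix (Fin k × Fin m) (Fin k × Fin m) ℂ)).cone p := by
  obtain ⟨G, hG⟩ := hG
  -- Adding a multiple of a ucp map makes the value at the unit positive definite, hence equal to
  -- $R^*R$ with $R$ invertible.
  have hreg : ∀ r : ℝ, 0 < r → X.map (kronMap (φ + (r : ℂ) • G) ψ) ∈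
      (ofStarRing (Matrix (Fin k × Fin m) (Fin k × Fin m) ℂ)).cone p := by
    intro r hr
    have hΦ : IsCP P (ofStarRing _) (φ + (r : ℂ) • G) := by
      let _ := Matrix.cstarAlgebra (Fin k)
      exact hφ.add_smul (fun _ _ h => hG.map_mem h) hr.le
    have hpos : ∀ φ : S →ₗ[ℂ] Matrix (Fin k) (Fin k) ℂ, IsCP P (ofStarRing _) φ →
        ∃ R : Matrix (Fin k) (Fin k) ℂ, φ P.unit = star R * R := by
      intro φ hφ
      obtain ⟨Z, hZ, hZ1⟩ := hP
      obtain ⟨Y, hY⟩ := hφ hZ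
      refine ⟨Y 0 0, ?_⟩
      have h := congrFun (congrFun hY 0) 0
      rw [Matrix.mul_apply, Fin.sum_univ_one, Matrix.map_apply, hZ1] at h
      exact h
    obtain ⟨C, hC⟩ := hpos _ hφ
    obtain ⟨R, hR⟩ := hpos _ hΦ
    have hRu : IsUnit R := by
      have h1 : (star R * R).PosDef := by
        rw [← hR, LinearMap.add_apply, LinearMap.smul_apply, hC, hG.map_unit]
        refine Matrix.PosDef.posSemidef_add (Matrix.posSemidef_conjTranspose_mul_self C) ?_
        exact Matrix.PosDef.one.smul (α := ℂ) (by simpa using hr)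
      have h2 := h1.isUnit
      rw [Matrix.isUnit_iff_isUnit_det, Matrix.det_mul] at h2
      exact (Matrix.isUnit_iff_isUnit_det _).2 (isUnit_of_mul_isUnit_right h2)
    obtain ⟨R, rfl⟩ := hRu
    set V : Matrix (Fin k) (Fin k) ℂ := ↑R⁻¹ with hV
    have hRV : (R : Matrix (Fin k) (Fin k) ℂ) * V = 1 := R.mul_inv
    have hVR : V * (R : Matrix (Fin k) (Fin k) ℂ) = 1 := R.inv_mul
    have hRV' : star V * star (R : Matrix (Fin k) (Fin k) ℂ) = 1 := by
      rw [← star_mul, hRV, star_one]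
    have hVR' : star (R : Matrix (Fin k) (Fin k) ℂ) * star V = 1 := by
      rw [← star_mul, hVR, star_one]
    set Φ := φ + (r : ℂ) • G with hΦd
    -- The normalization $R^{-*}\Phi R^{-1}$ is ucp, so minimal positivity applies to it;
    -- conjugating back by $R\otimes1$ recovers $\Phi\otimes\psi$.
    let θ : S →ₗ[ℂ] Matrix (Fin k) (Fin k) ℂ :=
      LinearMap.mulRight ℂ V ∘ₗ LinearMap.mulLeft ℂ (star V) ∘ₗ Φ
    have hθ : IsUCP P (ofStarRing _) θ := by
      refine ⟨?_, fun {n X} hX => ?_⟩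
      · change star V * Φ P.unit * V = 1
        rw [hR, ← mul_assoc, hRV', one_mul, hRV]
      · exact map_conj_mem_cone (hΦ hX) V
    have h := map_conj_mem_cone (hX.2 k m θ ψ hθ hψ) ((R : Matrix (Fin k) (Fin k) ℂ) ⊗ₖ 1)
    rw [Matrix.map_map] at h
    convert h using 2
    ext x : 1
    induction x using TensorProduct.induction_on with
    | zero => simp
    | add x y hx hy =>
      rw [map_add, hx, hy, Function.comp_apply, Function.comp_apply, Function.comp_apply, map_add,
        mul_add, add_mul]
    | tmul s t =>
      rw [Function.comp_apply, kronMap_tmul, kronMap_tmul, Matrix.star_eq_conjTranspose,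
        Matrix.conjTranspose_kronecker, ← Matrix.mul_kronecker_mul, ← Matrix.mul_kronecker_mul]
      rw [Matrix.conjTranspose_one, Matrix.one_mul, Matrix.mul_one]
      congr 1
      change Φ s = star _ * (star V * Φ s * V) * _
      rw [← mul_assoc, ← mul_assoc, hVR', one_mul, mul_assoc, hVR, mul_one]
  have hsplit : ∀ r : ℝ, X.map (kronMap (φ + (r : ℂ) • G) ψ) =
      X.map (kronMap φ ψ) + (r : ℂ) • X.map (kronMap G ψ) := by
    intro r
    have e : kronMap (φ + (r : ℂ) • G) ψ = kronMap φ ψ + (r : ℂ) • kronMap G ψ := by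
      refine TensorProduct.ext' fun s t => ?_
      simp only [LinearMap.add_apply, LinearMap.smul_apply, kronMap_tmul, Matrix.add_kronecker,
        Matrix.smul_kronecker]
    rw [e]; rfl
  let _ := Matrix.cstarAlgebra (Fin k × Fin m)
  let 𝓜 := OperatorSystem.ofCStarAlgebra (Matrix (Fin k × Fin m) (Fin k × Fin m) ℂ)
  have hGX : X.map (kronMap G ψ) ∈ 𝓜.cone p := hX.2 k m G ψ hG hψ
  have hGH := 𝓜.isHermitian_of_mem hGX
  obtain ⟨r₀, hr₀, -, h₀⟩ := 𝓜.isOrdered.exists_isPos_add_sub hGH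
  change _ ∈ 𝓜.cone p
  refine 𝓜.archimedean ?_ fun ε hε => ?_
  · have h1 := 𝓜.isHermitian_of_mem (hreg 1 one_pos)
    rw [hsplit, Complex.ofReal_one, one_smul] at h1
    have h2 := h1.sub hGH
    rwa [add_sub_cancel_right] at h2
  -- Since the image of $X$ under $G\otimes\psi$ is at most $r_0$, the perturbation with parameter
  -- $\varepsilon/r_0$ costs at most $\varepsilon$.
  · have h1 := hreg (ε / r₀) (by positivity)
    rw [hsplit] at h1
    have h2 := 𝓜.add_mem h1 (𝓜.smul_mem (t := ε / r₀) (by positivity) h₀.mem)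
    convert h2 using 1
    rw [smul_sub, smul_smul, ← Complex.ofReal_mul, div_mul_cancel₀ _ hr₀.ne']
    abel

end Min

section Sandwich

variable {A S : Type*} [CStarAlgebra A] [AddCommGroup S] [Module ℂ S] [StarAddMonoid S]
  [StarModule ℂ S] {Q : MatrixOrder S}

/-- The map `x ⊗ s ↦ b x c ⊗ s`. -/
def sandwich (S : Type*) [AddCommGroup S] [Module ℂ S] (b c : A) : A ⊗[ℂ] S →ₗ[ℂ] A ⊗[ℂ] S :=
  TensorProduct.map (LinearMap.mulLeft ℂ b ∘ₗ LinearMap.mulRight ℂ c) LinearMap.id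

lemma sandwich_tmul (b c a : A) (s : S) :
    sandwich S b c (a ⊗ₜ s) = (b * (a * c)) ⊗ₜ[ℂ] s := rfl

lemma star_sandwich (b c : A) (x : A ⊗[ℂ] S) :
    star (sandwich S b c x) = sandwich S (star c) (star b) (star x) := by
  induction x using TensorProduct.induction_on with
  | zero => simp
  | add x y hx hy => rw [map_add, star_add, star_add, hx, hy, map_add]
  | tmul a s =>
    rw [sandwich_tmul, TensorProduct.star_tmul, TensorProduct.star_tmul, sandwich_tmul, star_mul,
      star_mul, mul_assoc]

/-- The compression of `Φ` by a family of elements. -/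
def compressFamily {k : ℕ} (φ : A →ₗ[ℂ] Matrix (Fin k) (Fin k) ℂ) {ρ : Type*} (a : ρ → A) :
    A →ₗ[ℂ] Matrix (Fin k × ρ) (Fin k × ρ) ℂ where
  toFun c := .of fun x y => φ (a x.2 * c * star (a y.2)) x.1 y.1
  map_add' c d := by ext x y; simp [mul_add, add_mul]
  map_smul' r c := by ext x y; simp

/-- Write the argument as $Y^*Y$. The entries $a_x(Y^*Y)_{ij}a_y^*$ form a larger positive matrix,
the Gram matrix of the columns $Y_{\cdot j}a_y^*$, to which $\varphi$ is applied; the rest is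
reindexing. -/
lemma isPos_comp_compressFamily {k : ℕ} {φ : A →ₗ[ℂ] Matrix (Fin k) (Fin k) ℂ}
    (hφ : IsCP (ofStarRing A) (ofStarRing _) φ) {ρ : Type*} [Fintype ρ] (a : ρ → A) {n : ℕ}
    {X : Matrix (Fin n) (Fin n) A} (hX : X ∈ (ofStarRing A).cone n) :
    (OperatorSystem.ofCStarAlgebra ℂ).IsPos
      (Matrix.comp _ _ _ _ _ (X.map (compressFamily φ a))) := by
  obtain ⟨Y, rfl⟩ := hX
  have h := OperatorSystem.isPos_conjTranspose_mul_self
    (.of fun (l : Fin n) (x : Fin n × ρ) => Y l x.1 * star (a x.2))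
  let e := Fintype.equivFin (Fin n × ρ)
  have h2 := Matrix.mem_cone_iff_comp.1 (hφ (h _ e.symm))
  have h3 := h2.submatrix (fun x : Fin n × (Fin k × ρ) => (e (x.1, x.2.2), x.2.1))
  convert h3 using 1
  ext ⟨i, α, x⟩ ⟨j, β, y⟩
  simp [compressFamily, Matrix.mul_apply, Matrix.sum_apply, Finset.mul_sum, Finset.sum_mul,
    mul_assoc, e]

/-- The minimal tensor product with a `C*`-algebra is stable under conjugation by rectangular
matrices over the algebra. -/
theorem sandwich_mem_minTensor (hG : ∀ k, ∃ G : A →ₗ[ℂ] Matrix (Fin k) (Fin k) ℂ,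
      IsUCP (ofStarRing A) (ofStarRing _) G) {p q : ℕ} {X : Matrix (Fin p) (Fin p) (A ⊗[ℂ] S)}
    (hX : X ∈ (minTensor (ofStarRing A) Q).cone p) (a : Matrix (Fin q) (Fin p) A) :
    (.of fun r t => ∑ i, ∑ j, sandwich S (a r i) (star (a t j)) (X i j)) ∈
      (minTensor (ofStarRing A) Q).cone q := by
  refine ⟨?_, fun k m φ ψ hφ hψ => ?_⟩
  · ext r t
    simp only [Matrix.conjTranspose_apply, Matrix.of_apply, star_sum, star_sandwich, star_star]
    rw [Finset.sum_comm]
    refine Finset.sum_congr rfl fun i _ => Finset.sum_congr rfl fun j _ => ?_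
    rw [← congrFun (congrFun hX.1 i) j, Matrix.conjTranspose_apply]
  · let a' : Fin q × Fin p → A := fun x => a x.1 x.2
    let e := Fintype.equivFin (Fin k × (Fin q × Fin p))
    -- All compressions of $\varphi$ by the entries of $a$ are collected in one completely positive
    -- map, in general not unital. The image of the conjugated matrix under $\varphi\otimes\psi$ is
    -- then a sum of blocks of the image of $X$ under $\Phi\otimes\psi$.
    let Φ : A →ₗ[ℂ] Matrix (Fin _) (Fin _) ℂ :=
      (Matrix.reindexLinearEquiv ℂ ℂ e e).toLinearMap ∘ₗ compressFamily φ a'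
    have hΦ : IsCP (ofStarRing A) (ofStarRing _) Φ := fun n X hX =>
      Matrix.mem_cone_iff_comp.2
        ((isPos_comp_compressFamily (fun _ _ h => hφ.map_mem h) a' hX).submatrix
          fun x : Fin n × Fin _ => (x.1, e.symm x.2))
    have h := map_kronMap_mem_of_isCP (P := ofStarRing A)
      ⟨1, ⟨1, by simp⟩, rfl⟩ hX hΦ hψ (hG _)
    have h2 := (Matrix.mem_cone_iff_comp.1 h).submatrix
      (fun x : Fin p × (Fin q × (Fin k × Fin m)) => (x.1, (e (x.2.2.1, x.2.1, x.1), x.2.2.2)))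
    refine Matrix.mem_cone_iff_comp.2 ?_
    convert (OperatorSystem.ofCStarAlgebra ℂ).isOrdered.isPos_sum_blocks h2 using 1
    ext ⟨r, α, μ⟩ ⟨t, β, ν⟩
    have key : ∀ (i j : Fin p) (x : A ⊗[ℂ] S),
        kronMap φ ψ (sandwich S (a r i) (star (a t j)) x) (α, μ) (β, ν) =
          kronMap Φ ψ x (e (α, r, i), μ) (e (β, t, j), ν) := by
      intro i j x
      induction x using TensorProduct.induction_on with
      | zero => simp
      | add x y hx hy => simp only [map_add, Matrix.add_apply, hx, hy]
      | tmul c s =>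
        rw [sandwich_tmul, kronMap_tmul, kronMap_tmul, Matrix.kroneckerMap_apply,
          Matrix.kroneckerMap_apply]
        simp [Φ, compressFamily, a', mul_assoc]
    simp [Matrix.sum_apply, key]

end Sandwich

end MatrixOrder

end

/-! ### Multiplicativity of positive kernels -/

noncomputable section

open scoped InnerProductSpace

namespace MatrixOrder

section Kernel

variable {A S H : Type*} [CStarAlgebra A] [AddCommGroup S] [Module ℂ S] [StarAddMonoid S]
  [StarModule ℂ S] [NormedAddCommGroup H] [InnerProductSpace ℂ H] [CompleteSpace H]

lemma sandwich_one_one (x : A ⊗[ℂ] S) : sandwich S (1 : A) 1 x = x := by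
  induction x using TensorProduct.induction_on with
  | zero => simp
  | add x y hx hy => rw [map_add, hx, hy]
  | tmul a s => simp [sandwich_tmul]

lemma sandwich_algebraMap_left (r : ℂ) (c : A) (x : A ⊗[ℂ] S) :
    sandwich S (algebraMap ℂ A r) c x = r • sandwich S 1 c x := by
  induction x using TensorProduct.induction_on with
  | zero => simp
  | add x y hx hy => rw [map_add, map_add, smul_add, hx, hy]
  | tmul a s => simp [sandwich_tmul, Algebra.algebraMap_eq_smul_one, TensorProduct.smul_tmul']

lemma sandwich_algebraMap_right (r : ℂ) (b : A) (x : A ⊗[ℂ] S) :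
    sandwich S b (algebraMap ℂ A r) x = r • sandwich S b 1 x := by
  induction x using TensorProduct.induction_on with
  | zero => simp
  | add x y hx hy => rw [map_add, map_add, smul_add, hx, hy]
  | tmul a s => simp [sandwich_tmul, Algebra.algebraMap_eq_smul_one, TensorProduct.smul_tmul']

@[simp] lemma sandwich_zero_left (c : A) : sandwich S 0 c = 0 := by
  ext a s; simp [sandwich]

@[simp] lemma sandwich_zero_right (b : A) : sandwich S b 0 = 0 := by
  ext a s; simp [sandwich]

lemma sandwich_one_left_neg (c : A) (x : A ⊗[ℂ] S) : sandwich S (-1) c x = -sandwich S 1 c x := by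
  induction x using TensorProduct.induction_on with
  | zero => simp
  | add x y hx hy => rw [map_add, map_add, neg_add, hx, hy]
  | tmul a s => simp [sandwich_tmul, TensorProduct.neg_tmul]

lemma sandwich_one_right_neg (c : A) (x : A ⊗[ℂ] S) : sandwich S c (-1) x = -sandwich S c 1 x := by
  induction x using TensorProduct.induction_on with
  | zero => simp
  | add x y hx hy => rw [map_add, map_add, neg_add, hx, hy]
  | tmul a s => simp [sandwich_tmul, TensorProduct.neg_tmul]

/-- A matrix order on `A ⊗ S` which is stable under conjugation by rectangular matrices over `A`. -/
structure IsConjStable (P : MatrixOrder (A ⊗[ℂ] S)) : Prop extends P.IsOrdered where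
  sandwich_mem : ∀ {p q : ℕ} {X : Matrix (Fin p) (Fin p) (A ⊗[ℂ] S)}, X ∈ P.cone p →
    ∀ a : Matrix (Fin q) (Fin p) A,
      (.of fun r t => ∑ i, ∑ j, sandwich S (a r i) (star (a t j)) (X i j)) ∈ P.cone q

lemma IsConjStable.isPos_sandwich {P : MatrixOrder (A ⊗[ℂ] S)} (hP : P.IsConjStable)
    {ι κ : Type*} [Fintype ι] {X : Matrix ι ι (A ⊗[ℂ] S)} (hX : P.IsPos X) (a : Matrix κ ι A) :
    P.IsPos (.of fun r t => ∑ i, ∑ j, sandwich S (a r i) (star (a t j)) (X i j)) := fun n f => by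
  let e := Fintype.equivFin ι
  convert hP.sandwich_mem (hX _ e.symm) (a.submatrix f e.symm) using 1
  ext r t
  simp only [Matrix.submatrix_apply, Matrix.of_apply]
  rw [← e.symm.sum_comp]
  exact Finset.sum_congr rfl fun i _ => (e.symm.sum_comp _).symm

/-- A kernel of functionals, indexed by the vectors of a Hilbert space, which is positive on
`P` and has the values of a representation `π` on `v ⊗ e` for `v ∈ V`. -/
structure IsKernel (P : MatrixOrder (A ⊗[ℂ] S)) (e : S) (π : A →⋆ₐ[ℂ] (H →L[ℂ] H)) (V : Set A)
    (G : H → H → A ⊗[ℂ] S →ₗ[ℂ] ℂ) : Prop where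
  unit_eq : P.unit = 1 ⊗ₜ e
  apply_star : ∀ h k t, G k h (star t) = conj (G h k t)
  nonneg : ∀ (n : ℕ) (f : Fin n → H) (X : Matrix (Fin n) (Fin n) (A ⊗[ℂ] S)), X ∈ P.cone n →
    0 ≤ (∑ i, ∑ j, G (f i) (f j) (X i j)).re
  map_tmul : ∀ h k, ∀ v ∈ V, G h k (v ⊗ₜ e) = ⟪h, π v k⟫_ℂ

namespace IsKernel

variable {P : MatrixOrder (A ⊗[ℂ] S)} {e : S} {π : A →⋆ₐ[ℂ] (H →L[ℂ] H)} {V : Set A}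
  {G : H → H → A ⊗[ℂ] S →ₗ[ℂ] ℂ}

lemma sum_nonneg (hG : IsKernel P e π V G) {ι : Type*} [Fintype ι] (f : ι → H)
    {X : Matrix ι ι (A ⊗[ℂ] S)} (hX : P.IsPos X) :
    0 ≤ (∑ i, ∑ j, G (f i) (f j) (X i j)).re := by
  let e := Fintype.equivFin ι
  have h := hG.nonneg _ (f ∘ e.symm) _ (hX _ e.symm)
  convert h using 2
  rw [← e.symm.sum_comp]
  exact Finset.sum_congr rfl fun i _ => (e.symm.sum_comp _).symm

/-- A kernel takes multiplication by an entry of a unitary to the adjoint representing operator. -/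
lemma map_sandwich_star (hG : IsKernel P e π V G) (hP : P.IsConjStable) (h1 : 1 ∈ V) {n : ℕ}
    {w : Fin n → A} (hw : ∑ k, star (w k) * w k = 1) (hV : ∀ k, w k ∈ V)
    (hV' : ∀ k, star (w k) ∈ V) (k₀ : Fin n) (x : A ⊗[ℂ] S) (η ζ : H) :
    G η ζ (sandwich S (star (w k₀)) 1 x) = G (π (w k₀) η) ζ x := by
  -- A positive matrix with $c$ on the diagonal and $x$ linking the index $k_0$ to the extra index
  -- `none`.
  obtain ⟨c, hc, hB⟩ := hP.exists_isPos_add (ι := Option (Fin n))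
    (X := .of fun
      | some i, none => if i = k₀ then x else 0
      | none, some j => if j = k₀ then star x else 0
      | _, _ => 0) (by
    ext (_ | i) (_ | j) <;> simp [apply_ite star])
  have hsum' : ∑ k, ⟪η, π (star (w k)) (π (w k) η)⟫_ℂ = ⟪η, η⟫_ℂ := by
    have h2 := congrArg (fun T => ⟪η, π T η⟫_ℂ) hw
    simp only [map_sum, map_mul, map_one] at h2
    rw [← inner_sum]
    refine Eq.trans ?_ h2
    congr 1
    exact (_root_.sum_apply _ (fun k => π (star (w k)) * π (w k)) η).symm
  have hsum : ∑ k, ⟪π (w k) η, π (w k) η⟫_ℂ = ⟪η, η⟫_ℂ := by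
    rw [← hsum']
    refine Finset.sum_congr rfl fun k _ => ?_
    rw [map_star, ContinuousLinearMap.star_eq_adjoint]
    exact (ContinuousLinearMap.adjoint_inner_right _ _ _).symm
  set z := G η ζ (sandwich S (star (w k₀)) 1 x) - G (π (w k₀) η) ζ x with hz
  have hform : ∀ s : ℂ, 0 ≤ c * ‖s‖ ^ 2 * ‖ζ‖ ^ 2 + 2 * (conj s * z).re := by
    intro s
    -- The rows, paired with $\zeta$, $\eta$ and the vectors $\pi(w_l)\eta$, encode the formal
    -- differences $w_k^*\otimes\eta-1\otimes\pi(w_k)\eta$. Because $\sum_kw_k^*w_k=1$ and the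
    -- kernel agrees with $\pi$ on $w_k$, $w_k^*$ and $1$, the total weight of these differences is
    -- $\|\eta\|^2(1-1-1+1)=0$; only the $\zeta$ term and the cross term $z$ survive.
    let a : Matrix (Option (Option (Fin n))) (Option (Fin n)) A := .of fun
      | none, none => algebraMap ℂ A s
      | some none, some k => star (w k)
      | some (some l), some k => if l = k then -1 else 0
      | _, _ => 0
    have h := hG.sum_nonneg (fun
      | none => ζ
      | some none => η
      | some (some l) => π (w l) η) (hP.isPos_sandwich hB a)
    have hst : star (algebraMap ℂ A s) = algebraMap ℂ A (conj s) :=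
      (algebraMap_star_comm s).symm
    have hu : ∀ b d : A, sandwich S b d P.unit = (b * d) ⊗ₜ e := fun b d => by
      rw [hG.unit_eq, sandwich_tmul, one_mul]
    simp only [Fintype.sum_option, a, Matrix.of_apply, Matrix.add_apply, Matrix.smul_apply,
      Matrix.diagonal_apply, reduceCtorEq, if_false, if_true, smul_zero, add_zero, zero_add,
      Finset.sum_const_zero, star_star, sandwich_zero_left, sandwich_zero_right, apply_ite star,
      star_zero, star_neg, star_one, LinearMap.zero_apply, hst, Option.some.injEq, smul_ite,
      map_smul, hu] at h
    have hite : ∀ (q : Prop) [Decidable q] (f : A ⊗[ℂ] S →ₗ[ℂ] A ⊗[ℂ] S) (y : A ⊗[ℂ] S),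
        f (if q then y else 0) = if q then f y else 0 := fun q _ f y => by
      split_ifs <;> simp
    have hite2 : ∀ (q : Prop) [Decidable q] (f : A ⊗[ℂ] S →ₗ[ℂ] ℂ) (y : A ⊗[ℂ] S),
        f (if q then y else 0) = if q then f y else 0 := fun q _ f y => by
      split_ifs <;> simp
    simp only [hite, Finset.sum_ite_eq, Finset.sum_ite_eq', Finset.mem_univ, if_true,
      sandwich_algebraMap_left, sandwich_algebraMap_right, mul_zero, zero_mul,
      TensorProduct.zero_tmul, smul_zero, zero_add, map_smul, hu, map_sum] at h
    have hs1 : ∀ (q : Prop) [Decidable q] (y : A ⊗[ℂ] S),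
        sandwich S 1 (if q then -1 else 0) y = if q then -y else 0 := fun q _ y => by
      split_ifs <;> simp [sandwich_one_right_neg, sandwich_one_one]
    have hs2 : ∀ (q : Prop) [Decidable q] (y : A ⊗[ℂ] S),
        sandwich S (if q then -1 else 0) 1 y = if q then -y else 0 := fun q _ y => by
      split_ifs <;> simp [sandwich_one_left_neg, sandwich_one_one]
    have htm : ∀ (q : Prop) [Decidable q] (y : A),
        (if q then y else 0) ⊗ₜ[ℂ] e = if q then y ⊗ₜ[ℂ] e else 0 := fun q _ y => by
      split_ifs <;> simp
    simp only [hs1, hs2, mul_ite, ite_mul, zero_mul, mul_zero, mul_neg, mul_one, neg_mul, one_mul,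
      neg_neg, htm, hite2, TensorProduct.neg_tmul, map_neg, smul_ite, smul_neg, smul_zero,
      Finset.sum_ite_eq, Finset.sum_ite_eq', Finset.mem_univ, if_true,
      Algebra.algebraMap_eq_smul_one, smul_mul_smul_comm, ← TensorProduct.smul_tmul', map_smul,
      hG.map_tmul _ _ _ h1, hG.map_tmul _ _ _ (hV _), hG.map_tmul _ _ _ (hV' _), map_one,
      Finset.sum_add_distrib, Finset.sum_neg_distrib, ← Finset.smul_sum, ← map_sum,
      ← TensorProduct.sum_tmul, hw, one_apply_eq_self, hsum, hsum'] at h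
    have hc1 : G ζ η (sandwich S 1 (w k₀) (star x)) =
        conj (G η ζ (sandwich S (star (w k₀)) 1 x)) := by
      rw [← hG.apply_star, star_sandwich, star_star, star_one]
    rw [hc1, hG.apply_star, inner_self_eq_norm_sq_to_K, Complex.mul_conj,
      Complex.normSq_eq_norm_sq] at h
    convert h using 1
    have e : (conj s * z).re + (s * conj z).re = 2 * (conj s * z).re := by
      have : s * conj z = conj (conj s * z) := by simp
      rw [this, Complex.conj_re]; ring
    rw [← e, hz, map_sub, mul_sub, mul_sub]
    simp only [smul_eq_mul, Complex.add_re, Complex.sub_re, Complex.neg_re]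
    simp [← Complex.ofReal_pow]
    ring
  -- The quadratic inequality in $s$ has no constant term, so its linear coefficient vanishes.
  have hz0 : ‖z‖ ^ 2 ≤ (c * ‖ζ‖ ^ 2) * 0 := by
    refine norm_sq_le_of_form_nonneg fun t d hd => ?_
    have h := hform (t * conj d)
    have h1 : ‖(t : ℂ) * conj d‖ ^ 2 ≤ t * t := by
      rw [norm_mul, mul_pow, Complex.norm_conj, Complex.norm_real, Real.norm_eq_abs, sq_abs, ← pow_two]
      exact mul_le_of_le_one_right (sq_nonneg t) (pow_le_one₀ (norm_nonneg d) hd)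
    have h2 : conj ((t : ℂ) * conj d) * z = t * (d * z) := by simp [mul_assoc]
    rw [h2, Complex.re_ofReal_mul] at h
    have h3 := mul_le_mul_of_nonneg_left h1 (show 0 ≤ c * ‖ζ‖ ^ 2 by positivity)
    linarith
  have : z = 0 := by
    rw [mul_zero] at hz0
    exact norm_eq_zero.1 (pow_eq_zero_iff two_ne_zero |>.1 (le_antisymm hz0 (sq_nonneg _)))
  exact sub_eq_zero.1 this

/-- A kernel is continuous with respect to multiplication from the algebra. -/
lemma exists_norm_le (hG : IsKernel P e π V G) (hP : P.IsConjStable) (h1 : 1 ∈ V)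
    (x : A ⊗[ℂ] S) (η ζ : H) : ∃ C : ℝ, ∀ b : A, ‖G η ζ (sandwich S b 1 x)‖ ≤ C * ‖b‖ := by
  obtain ⟨c, hc, hB⟩ := hP.exists_two_isPos x
  refine ⟨c * ‖η‖ * ‖ζ‖, fun b => ?_⟩
  -- In general $bb^*\notin V$, so the value of the kernel at $bb^*\otimes e$ is unknown. It is
  -- bounded through $bb^*+d^*d=\|b\|^2$, the scalar on the right being a multiple of $1\in V$.
  obtain ⟨d, hd⟩ := CStarAlgebra.exists_star_mul_self_add (star b)
  rw [star_star, norm_star] at hd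
  have hu : ∀ b d : A, sandwich S b d P.unit = (b * d) ⊗ₜ e := fun b d => by
    rw [hG.unit_eq, sandwich_tmul, one_mul]
  have hsq : ‖G η ζ (sandwich S b 1 x)‖ ^ 2 ≤ (c * ‖ζ‖ ^ 2) * (c * ‖b‖ ^ 2 * ‖η‖ ^ 2) := by
    refine norm_sq_le_of_form_nonneg fun t r hr => ?_
    let s : ℂ := t * conj r
    have h := hG.sum_nonneg ![η, ζ] (hP.isPos_sandwich hB !![b, 0; 0, algebraMap ℂ A s])
    -- This second test gives positivity at $d^*d\otimes e$, so that this term can be discarded.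
    have h' := hG.sum_nonneg (fun _ : Fin 1 => η)
      (hP.isPos_sandwich hB (Matrix.of fun (_ : Fin 1) => ![star d, 0]))
    have hst : star (algebraMap ℂ A s) = algebraMap ℂ A (conj s) :=
      (algebraMap_star_comm s).symm
    simp only [Fin.sum_univ_two, Fin.sum_univ_one, Matrix.of_apply, Matrix.cons_val_zero,
      Matrix.cons_val_one, hst, star_zero, star_star, sandwich_zero_left, sandwich_zero_right,
      LinearMap.zero_apply, add_zero, zero_add, map_zero, map_smul, hu, sandwich_algebraMap_left,
      sandwich_algebraMap_right, Matrix.cons_val_fin_one, Matrix.cons_val', map_add,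
      mul_zero, zero_mul, TensorProduct.zero_tmul, smul_zero] at h h'
    simp only [Algebra.algebraMap_eq_smul_one, smul_mul_smul_comm, map_smul, mul_one,
      ← TensorProduct.smul_tmul', hG.map_tmul _ _ _ h1, map_one,
      one_apply_eq_self] at h h'
    have hc1 : G ζ η (sandwich S 1 (star b) (star x)) = conj (G η ζ (sandwich S b 1 x)) := by
      rw [← hG.apply_star, star_sandwich, star_one]
    have hdd : G η η ((b * star b) ⊗ₜ e) + G η η ((star d * d) ⊗ₜ e) =
        ((‖b‖ ^ 2 : ℝ) : ℂ) * ((‖η‖ ^ 2 : ℝ) : ℂ) := by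
      rw [← map_add, ← TensorProduct.add_tmul, hd, Algebra.algebraMap_eq_smul_one,
        ← TensorProduct.smul_tmul', map_smul, hG.map_tmul _ _ _ h1, map_one, one_apply_eq_self,
        inner_self_eq_norm_sq_to_K]
      simp
    have hdd' := congrArg Complex.re hdd
    rw [← Complex.ofReal_mul, Complex.ofReal_re, Complex.add_re] at hdd'
    rw [hc1, inner_self_eq_norm_sq_to_K, Complex.mul_conj, Complex.normSq_eq_norm_sq] at h
    have hs : ‖s‖ ^ 2 ≤ t * t := by
      rw [norm_mul, mul_pow, Complex.norm_conj, Complex.norm_real, Real.norm_eq_abs, sq_abs,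
        ← pow_two]
      exact mul_le_of_le_one_right (sq_nonneg t) (pow_le_one₀ (norm_nonneg r) hr)
    have hs' := mul_le_mul_of_nonneg_left hs (show 0 ≤ c * ‖ζ‖ ^ 2 by positivity)
    have e1 : (conj s * G η ζ (sandwich S b 1 x)).re = t * (r * G η ζ (sandwich S b 1 x)).re := by
      rw [← Complex.re_ofReal_mul]; simp [s, mul_assoc]
    have e2 : (s * conj (G η ζ (sandwich S b 1 x))).re =
        t * (r * G η ζ (sandwich S b 1 x)).re := by
      rw [← e1, ← Complex.conj_re]; simp
    simp only [smul_eq_mul, Complex.add_re, Complex.re_ofReal_mul, e1, e2] at h h'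
    have e3 : (((‖ζ‖ : ℝ) : ℂ) ^ 2).re = ‖ζ‖ ^ 2 := by
      rw [← Complex.ofReal_pow, Complex.ofReal_re]
    change 0 ≤ c * _ + _ + (_ + c * (‖s‖ ^ 2 * (((‖ζ‖ : ℝ) : ℂ) ^ 2).re)) at h
    rw [e3] at h
    have e4 := congrArg (c * ·) hdd'
    simp only [mul_add] at e4
    linarith
  have h0 : 0 ≤ c * ‖η‖ * ‖ζ‖ * ‖b‖ := by positivity
  refine abs_le_of_sq_le_sq' ?_ h0 |>.2
  refine hsq.trans_eq ?_
  ring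

end IsKernel

end Kernel

/-- On `U_nc(n)`, a kernel is multiplicative in the algebra variable. -/
theorem IsKernel.map_tmul_eq {n : ℕ} {S H : Type*} [AddCommGroup S] [Module ℂ S] [StarAddMonoid S]
    [StarModule ℂ S] [NormedAddCommGroup H] [InnerProductSpace ℂ H] [CompleteSpace H]
    {P : MatrixOrder (Unc n ⊗[ℂ] S)} {e : S} {π : Unc n →⋆ₐ[ℂ] (H →L[ℂ] H)}
    {G : H → H → Unc n ⊗[ℂ] S →ₗ[ℂ] ℂ} (hG : IsKernel P e π (Vn n) G) (hP : P.IsConjStable)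
    {s : S} {T : H →L[ℂ] H} (hT : ∀ η ζ, G η ζ (1 ⊗ₜ s) = ⟪η, T ζ⟫_ℂ) (a : Unc n) (η ζ : H) :
    G η ζ (a ⊗ₜ s) = ⟪η, π a (T ζ)⟫_ℂ := by
  have hu : ∀ i j, Unc.u i j ∈ Vn n := fun i j => (Unc.vgen i j).2
  have hinner : ∀ (x : Unc n) (η ζ : H), ⟪π x η, ζ⟫_ℂ = ⟪η, π (star x) ζ⟫_ℂ := fun x η ζ => by
    rw [map_star, ContinuousLinearMap.star_eq_adjoint]
    exact (ContinuousLinearMap.adjoint_inner_right _ _ _).symm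
  -- The spare right factor $b$ lets the induction peel letters off the left of a product.
  have hpoly : ∀ (p : StarPoly n) (b : Unc n), (∀ η ζ, G η ζ (b ⊗ₜ s) = ⟪η, π b (T ζ)⟫_ℂ) →
      ∀ η ζ, G η ζ ((Unc.ofPoly p * b) ⊗ₜ s) = ⟪η, π (Unc.ofPoly p * b) (T ζ)⟫_ℂ := by
    intro p
    induction p using StarPoly.induction with
    | hc c =>
      intro b hb η ζ
      rw [AlgHom.commutes, ← Algebra.smul_def, ← TensorProduct.smul_tmul', map_smul, hb, map_smul]
      exact (inner_smul_right _ _ _).symm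
    | hl y =>
      intro b hb η ζ
      obtain ⟨⟨i, j⟩, t⟩ := y
      have key : ∀ w : Fin n → Unc n, ∑ k, star (w k) * w k = 1 → (∀ k, w k ∈ Vn n) → ∀ k,
          G η ζ ((star (w k) * b) ⊗ₜ s) = ⟪η, π (star (w k) * b) (T ζ)⟫_ℂ := by
        intro w hw hV k
        have h := hG.map_sandwich_star hP Vn.one_mem hw hV (fun k => Vn.star_mem (hV k)) k (b ⊗ₜ s)
          η ζ
        rw [sandwich_tmul, mul_one, hb, hinner] at h
        rw [h, map_mul]; rfl
      cases t
      -- The letter $u_{ij}$ is the adjoint of an entry of the column $(u_{ik}^*)_k$, for which the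
      -- needed relation is $\sum_ku_{ik}u_{ik}^*=1$. Adjoint letters use the columns of $u$; so
      -- both halves of unitarity enter.
      · have h := key (fun k => star (Unc.u i k)) (by
          have h := congrFun (congrFun (Unc.u_mul_star_u (n := n)) i) i
          simpa [Matrix.mul_apply] using h) (fun k => Vn.star_mem (hu i k)) j
        rw [star_star] at h
        exact h
      · have h := key (fun k => Unc.u k j) (by
          have h := congrFun (congrFun (Unc.star_u_mul_u (n := n)) j) j
          simpa [Matrix.mul_apply] using h) (fun k => hu k j) i
        have h2 : StarPoly.letter ((i, j), true) = star (StarPoly.gen i j) := by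
          rw [StarPoly.gen, StarPoly.star_letter]; rfl
        rw [h2, ← Unc.star_ofPoly]
        exact h
    | hm p q hp hq =>
      intro b hb
      rw [map_mul, mul_assoc]
      exact hp _ (hq b hb)
    | ha p q hp hq =>
      intro b hb η ζ
      rw [map_add, add_mul, TensorProduct.add_tmul, map_add, hp b hb, hq b hb, map_add,
        ← inner_add_right]
      rfl
  -- Continuity in the algebra variable carries the identity from polynomials to their completion.
  obtain ⟨C, hC⟩ := hG.exists_norm_le hP Vn.one_mem (1 ⊗ₜ s) η ζ
  let f : Unc n →ₗ[ℂ] ℂ := G η ζ ∘ₗ (TensorProduct.mk ℂ (Unc n) S).flip s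
  have hf : Continuous f := AddMonoidHomClass.continuous_of_bound f C fun b => by
    have h := hC b
    rw [sandwich_tmul, mul_one, mul_one] at h
    exact h
  have hπ : Continuous π := by
    open scoped CStarAlgebra in exact map_continuous π
  refine Unc.induction (P := fun a => f a = ⟪η, π a (T ζ)⟫_ℂ) a
    (isClosed_eq hf (by fun_prop)) fun p => ?_
  have h := hpoly p 1 (fun η ζ => by rw [hT, map_one]; rfl) η ζ
  rw [mul_one] at h
  exact h

end MatrixOrder

end

/-! ### Comparison of the tensor products of $\mathcal V_n$ and $\mathcal U_{nc}(n)$ -/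

noncomputable section

universe v

open scoped InnerProductSpace

namespace Vn

variable {n : ℕ} {S : Type v} [AddCommGroup S] [Module ℂ S] [StarAddMonoid S] [StarModule ℂ S]

/-- The inclusion `V_n ⊗ S → U_nc(n) ⊗ S`. -/
abbrev inclusion (n : ℕ) (S : Type*) [AddCommGroup S] [Module ℂ S] :
    Vn n ⊗[ℂ] S →ₗ[ℂ] Unc n ⊗[ℂ] S :=
  TensorProduct.map (Vn n).subtype LinearMap.id

lemma inclusion_injective : Function.Injective (inclusion n S) :=
  Module.Flat.rTensor_preserves_injective_linearMap (M := S) (Vn n).subtype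
    Subtype.val_injective

lemma inclusion_star (x : Vn n ⊗[ℂ] S) : inclusion n S (star x) = star (inclusion n S x) := by
  induction x using TensorProduct.induction_on with
  | zero => simp
  | add x y hx hy => rw [star_add, map_add, hx, hy, map_add, star_add]
  | tmul a s =>
    rw [TensorProduct.star_tmul, TensorProduct.map_tmul, TensorProduct.map_tmul,
      TensorProduct.star_tmul]
    rfl

lemma isHermitian_map_inclusion {p : ℕ} {X : Matrix (Fin p) (Fin p) (Vn n ⊗[ℂ] S)} :
    (X.map (inclusion n S)).IsHermitian ↔ X.IsHermitian := by
  constructor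
  · intro h
    ext i j
    refine inclusion_injective ?_
    rw [Matrix.conjTranspose_apply, inclusion_star]
    exact congrFun (congrFun h i) j
  · intro h
    ext i j
    rw [Matrix.conjTranspose_apply, Matrix.map_apply, ← inclusion_star]
    exact congrArg _ (congrFun (congrFun h i) j)

lemma isUCP_restrict {B : Type*} [AddCommGroup B] [Module ℂ B] {R : MatrixOrder B}
    {φ : Unc n →ₗ[ℂ] B} (hφ : MatrixOrder.IsUCP (Unc.operatorSystem n).toMatrixOrder R φ) :
    MatrixOrder.IsUCP (Vn.operatorSystem n).toMatrixOrder R (φ ∘ₗ (Vn n).subtype) where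
  map_unit := hφ.map_unit
  map_mem {_ X} hX := hφ.map_mem (X := X.map (Vn n).subtype) hX

lemma prodMap_restrict {B : Type*} [Ring B] [Algebra ℂ B] (φ : Unc n →ₗ[ℂ] B) (ψ : S →ₗ[ℂ] B)
    (x : Vn n ⊗[ℂ] S) : MatrixOrder.prodMap (φ ∘ₗ (Vn n).subtype) ψ x =
      MatrixOrder.prodMap φ ψ (inclusion n S x) := by
  have e : MatrixOrder.prodMap (φ ∘ₗ (Vn n).subtype) ψ =
      MatrixOrder.prodMap φ ψ ∘ₗ inclusion n S := TensorProduct.ext' fun _ _ => rfl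
  rw [e]; rfl

lemma kronMap_restrict {k m : ℕ} (φ : Unc n →ₗ[ℂ] Matrix (Fin k) (Fin k) ℂ)
    (ψ : S →ₗ[ℂ] Matrix (Fin m) (Fin m) ℂ)
    (x : Vn n ⊗[ℂ] S) : MatrixOrder.kronMap (φ ∘ₗ (Vn n).subtype) ψ x =
      MatrixOrder.kronMap φ ψ (inclusion n S x) := by
  have e : MatrixOrder.kronMap (φ ∘ₗ (Vn n).subtype) ψ =
      MatrixOrder.kronMap φ ψ ∘ₗ inclusion n S := TensorProduct.ext' fun _ _ => rfl
  rw [e]; rfl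

open MatrixOrder

variable {Q : MatrixOrder S} {p : ℕ} {X : Matrix (Fin p) (Fin p) (Vn n ⊗[ℂ] S)}

/-- The matrix-valued ucp maps on $\mathcal V_n$ are exactly the restrictions of those on $\mathcal
U_{nc}(n)$, so both cones are defined by the same tests. -/
lemma map_inclusion_mem_minTensor :
    X.map (inclusion n S) ∈ (minTensor (Unc.operatorSystem n).toMatrixOrder Q).cone p ↔
      X ∈ (minTensor (Vn.operatorSystem n).toMatrixOrder Q).cone p := by
  refine and_congr isHermitian_map_inclusion ⟨fun h k m φ ψ hφ hψ => ?_, fun h k m φ ψ hφ hψ => ?_⟩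
  · let _ := Matrix.cstarAlgebra (Fin k)
    obtain ⟨φ', rfl, hφ', -⟩ := Unc.exists_ucp_extension hφ
    convert h k m φ' ψ hφ' hψ using 1
    ext i j : 1
    exact kronMap_restrict φ' ψ _
  · convert h k m _ ψ (isUCP_restrict hφ) hψ using 1
    ext i j : 1
    exact (kronMap_restrict φ ψ _).symm

/-- From left to right, a commuting pair is extended within the commutant of the range of $\psi$,
and the product is positive on the maximal cone. From right to left, the representations that detect
maximal positivity restrict to commuting pairs on $\mathcal V_n$. -/
lemma map_inclusion_mem_maxTensor (hQ : Q.IsOrdered) :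
    X.map (inclusion n S) ∈ (maxTensor (Unc.operatorSystem n).toMatrixOrder Q).cone p ↔
      X ∈ (commTensor (Vn.operatorSystem n).toMatrixOrder Q).cone p := by
  constructor
  · intro h
    refine ⟨isHermitian_map_inclusion.1 h.1, fun H _ _ _ φ ψ hφ hψ hcomm => ?_⟩
    obtain ⟨φ', rfl, hφ', hfac⟩ := Unc.exists_ucp_extension hφ
    have hfac' := hfac (Set.range ψ) (by
      rintro _ ⟨s, rfl⟩
      exact ⟨star s, map_star_of_map_mem hQ hψ.map_mem s⟩) (by
      rintro a _ ⟨s, rfl⟩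
      exact hcomm a s)
    convert map_prodMap_mem_of_mem_maxTensor hφ'.map_unit hfac' hψ h using 1
    ext i j : 1
    exact prodMap_restrict φ' ψ _
  · intro h
    refine mem_maxTensor_of_forall_representation hQ (isHermitian_map_inclusion.2 h.1)
      fun H _ _ _ π ψ hψ hcomm => ?_
    convert h.2 H _ ψ (isUCP_restrict (IsUCP.of_starAlgHom π)) hψ (fun a s => hcomm a s) using 1
    ext i j : 1
    exact (prodMap_restrict _ ψ _).symm

end Vn

namespace MatrixOrder

variable {n : ℕ} {S : Type v} [AddCommGroup S] [Module ℂ S] [StarAddMonoid S] [StarModule ℂ S]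
  {Q : MatrixOrder S}

lemma isConjStable_minTensor (hQ : Q.IsOrdered) :
    (minTensor (Unc.operatorSystem n).toMatrixOrder Q).IsConjStable where
  toIsOrdered := isOrdered_minTensor (Unc.operatorSystem n).isOrdered hQ
  sandwich_mem hX a := by
    refine sandwich_mem_minTensor (fun k => ?_) hX a
    let _ := Matrix.cstarAlgebra (Fin k)
    -- The identity is a unitary matrix, so sending $u$ to it provides a ucp map into every matrix
    -- algebra.
    obtain ⟨π, -, -⟩ := Unc.existsUnique_lift (n := n) (B := Matrix (Fin k) (Fin k) ℂ) 1 (by simp)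
      (by simp)
    exact ⟨π.toAlgHom.toLinearMap, IsUCP.of_starAlgHom π⟩

lemma prodMap_star {A B : Type*} [CStarAlgebra A] [CStarAlgebra B] (π : A →⋆ₐ[ℂ] B)
    {ψ : S →ₗ[ℂ] B} (hψ : ∀ s, ψ (star s) = star (ψ s)) (hcomm : ∀ a s, Commute (π a) (ψ s))
    (x : A ⊗[ℂ] S) : prodMap π.toAlgHom.toLinearMap ψ (star x) =
      star (prodMap π.toAlgHom.toLinearMap ψ x) := by
  induction x using TensorProduct.induction_on with
  | zero => simp
  | add x y hx hy => rw [star_add, map_add, hx, hy, map_add, star_add]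
  | tmul a s =>
    rw [TensorProduct.star_tmul]
    change π (star a) * ψ (star s) = star (π a * ψ s)
    rw [(hcomm _ _).eq, star_mul, hψ, map_star π]

/-- If `V_n ⊗ S` has minimal and commuting tensor products equal, then the minimal cones of
`U_nc(n) ⊗ S` are contained in the maximal ones. -/
theorem minTensor_cone_subset_maxTensor_cone (hQ : Q.IsOrdered)
    (h : ∀ p, (minTensor (Vn.operatorSystem n).toMatrixOrder Q).cone p ⊆
      (commTensor (Vn.operatorSystem n).toMatrixOrder Q).cone p) (p : ℕ) :
    (minTensor (Unc.operatorSystem n).toMatrixOrder Q).cone p ⊆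
      (maxTensor (Unc.operatorSystem n).toMatrixOrder Q).cone p := by
  intro X hX
  refine mem_maxTensor_of_forall_representation hQ hX.1 fun H _ _ _ π ψ hψ hcomm => ?_
  have hstar := prodMap_star π (map_star_of_map_mem hQ hψ.map_mem) hcomm
  set Ψ := prodMap π.toAlgHom.toLinearMap ψ with hΨ
  have hmin := isConjStable_minTensor (n := n) hQ
  -- The coefficients of $\pi\cdot\psi$, indexed by all vectors of $H$. Only their values on
  -- $\mathcal V_n\otimes\mathcal S$ are positive for the minimal cones so far, by the assumption
  -- that these lie in the commuting cones. The extension need not depend sesquilinearly on the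
  -- vectors, and nothing below uses that it does.
  let F : H → H → Unc n ⊗[ℂ] S →ₗ[ℂ] ℂ := fun η ζ =>
    (innerSL ℂ η).toLinearMap ∘ₗ (ContinuousLinearMap.apply ℂ H ζ).toLinearMap ∘ₗ Ψ
  have hF : ∀ η ζ t, F η ζ t = ⟪η, Ψ t ζ⟫_ℂ := fun _ _ _ => rfl
  obtain ⟨G, hGF, hGstar, hGpos⟩ := exists_kernel_extension hmin.toIsOrdered
    (LinearMap.range (Vn.inclusion n S)) (by
      rintro _ ⟨t, rfl⟩
      exact ⟨star t, Vn.inclusion_star t⟩) ⟨(⟨1, Vn.one_mem⟩ : Vn n) ⊗ₜ Q.unit, rfl⟩ F (by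
      intro η ζ t _
      rw [hF, hF, hstar, ContinuousLinearMap.star_eq_adjoint,
        ContinuousLinearMap.adjoint_inner_right, inner_conj_symm]) (by
      intro m f Y hY hYmin
      choose Z hZ using hY
      have e : Y = (Matrix.of Z).map (Vn.inclusion n S) := by
        ext i j; exact (hZ i j).symm
      rw [e, Vn.map_inclusion_mem_minTensor] at hYmin
      have h2 := (h m hYmin).2 H _ ψ (Vn.isUCP_restrict (IsUCP.of_starAlgHom π)) hψ
        (fun a s => hcomm a s)
      have h3 := form_nonneg_of_mem_cone h2 f
      convert h3 using 6 with i _ j _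
      rw [hF, ← hZ, Matrix.map_apply, Vn.prodMap_restrict]
      rfl)
  have hker : IsKernel (minTensor (Unc.operatorSystem n).toMatrixOrder Q) Q.unit π (Vn n) G :=
    { unit_eq := rfl
      apply_star := fun h k t => hGstar h k t
      nonneg := hGpos
      map_tmul := fun η ζ v hv => by
        rw [hGF η ζ (v ⊗ₜ Q.unit) ⟨(⟨v, hv⟩ : Vn n) ⊗ₜ Q.unit, rfl⟩, hF]
        change ⟪η, (π v * ψ Q.unit) ζ⟫_ℂ = _
        rw [hψ.map_unit]
        exact congrArg (fun T : H →L[ℂ] H => ⟪η, T ζ⟫_ℂ) (mul_one (π v)) }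
  -- Rigidity: the extended kernel is forced to be the kernel of $\pi\cdot\psi$, which thereby
  -- inherits positivity on the minimal cones of $\mathcal U_{nc}(n)\otimes\mathcal S$.
  have hG : ∀ t η ζ, G η ζ t = ⟪η, Ψ t ζ⟫_ℂ := by
    intro t η ζ
    rw [← hF]
    congr 1
    refine TensorProduct.ext' fun a s => ?_
    rw [hF]
    refine hker.map_tmul_eq hmin (T := ψ s) (fun η ζ => ?_) a η ζ
    rw [hGF η ζ (1 ⊗ₜ s) ⟨(⟨1, Vn.one_mem⟩ : Vn n) ⊗ₜ s, rfl⟩, hF]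
    change ⟪η, (π 1 * ψ s) ζ⟫_ℂ = _
    rw [map_one, one_mul]
  refine mem_cone_of_form_nonneg ?_ fun x => ?_
  · ext i j : 1
    rw [Matrix.conjTranspose_apply, Matrix.map_apply, ← hstar]
    exact congrArg Ψ (congrFun (congrFun hX.1 i) j)
  · convert hGpos p x X hX using 6
    exact (hG _ _ _).symm

end MatrixOrder

end

theorem mainTheorem12 {S : Type*} [AddCommGroup S] [Module ℂ S] [StarAddMonoid S] [StarModule ℂ S]
    (𝒮 : OperatorSystem S) (n : ℕ) (hn : 2 ≤ n) :
    MatrixOrder.IsCompleteOrderEmbedding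
      (MatrixOrder.commTensor (Vn.operatorSystem n).toMatrixOrder 𝒮.toMatrixOrder)
      (MatrixOrder.maxTensor (Unc.operatorSystem n).toMatrixOrder 𝒮.toMatrixOrder)
      (TensorProduct.map (Vn n).subtype (LinearMap.id : S →ₗ[ℂ] S)) ∧
    (MatrixOrder.minTensor (Vn.operatorSystem n).toMatrixOrder 𝒮.toMatrixOrder =
        MatrixOrder.commTensor (Vn.operatorSystem n).toMatrixOrder 𝒮.toMatrixOrder ↔
      MatrixOrder.minTensor (Unc.operatorSystem n).toMatrixOrder 𝒮.toMatrixOrder =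
        MatrixOrder.maxTensor (Unc.operatorSystem n).toMatrixOrder 𝒮.toMatrixOrder) := by
  have hQ := 𝒮.isOrdered
  refine ⟨⟨Vn.inclusion_injective, rfl, Vn.inclusion_star, Vn.map_inclusion_mem_maxTensor hQ⟩,
    fun h => ?_, fun h => ?_⟩
  · refine MatrixOrder.ext rfl (funext fun p => Set.Subset.antisymm ?_ ?_)
    · exact MatrixOrder.minTensor_cone_subset_maxTensor_cone hQ (fun p => by rw [h]) p
    · exact MatrixOrder.maxTensor_cone_subset_minTensor_cone p
  · refine MatrixOrder.ext rfl (funext fun p => Set.ext fun X => ?_)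
    -- Both cones over $\mathcal V_n$ are pulled back along the same inclusion, from the minimal and
    -- the maximal cone of $\mathcal U_{nc}(n)\otimes\mathcal S$.
    rw [← Vn.map_inclusion_mem_minTensor, h, Vn.map_inclusion_mem_maxTensor hQ]
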